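/- Let $\mathfrak H=\{z\in\mathbb C:\operatorname{Im} z>0\}$ and, for odd $k\ge 3$, let $$\mathbb G_k(\tau)=\sum_{m,r\ge 1} m^{k-1}q^{mr},\qquad q=e^{2\pi i\tau},\ \tau\in\mathfrak H$$ (this is $-\frac{B_k}{2k}+\sum_{m,r\ge1}m^{k-1}q^{mr}$, as the Bernoulli number $B_k$ vanishes). Let $$\overline{\mathcal F}=\{z\in\mathfrak H: |z|\ge 1,\ -\tfrac12\le\operatorname{Re} z\le\tfrac12\}\cup\{i\infty\}$$ be the closed standard fundamental domain of $\mathrm{SL}_2(\mathbb Z)$, and put $\rho=-\frac12+\frac{\sqrt3}{2}i$. For $\tau\in\overline{\mathcal F}$ let $w(\tau)=\frac16$ if $\tau\in\{\rho,\rho+1\}$; $w(\tau)=\frac12$ if $\tau\in\mathfrak H\setminus\{\rho,\rho+1\}$ lies on the boundary of $\overline{\mathcal F}$ (that is, $|\tau|=1$ or $\operatorname{Re}\tau=\pm\frac12$); and $w(\tau)=1$ if $\tau$ is an interior point or $\tau=i\infty$. For a function $f$ holomorphic on $\mathfrak H$ with a Fourier expansion $f=\sum_{n\ge 0}a_nq^n$,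 let $\nu_\tau(f)$ be the order of vanishing of $f$ at $\tau\in\mathfrak H$, let $\nu_{i\infty}(f)=\min\{n\ge0: a_n\ne0\}$, and define the weighted number of zeros of $f$ in $\overline{\mathcal F}$ by $$N_\infty(f)=\sum_{\tau\in\overline{\mathcal F}}w(\tau)\,\nu_\tau(f).$$ Then, for every odd $k\ge3$, $$N_\infty(\mathbb G_k)=\begin{cases}\lceil k/6\rceil & \text{if } k\equiv 3,5,11 \pmod{12},\\ \lfloor k/6\rfloor & \text{if } k\equiv 1,7,9 \pmod{12}.\end{cases}$$ Moreover, all zeros of $\mathbb G_k$ in $\overline{\mathcal F}$ lie in $$\{\pm\tfrac12+it : t\ge\tfrac12\sqrt3\}\cup\{i\infty\}.$$ -/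

import Mathlib

open UpperHalfPlane
open scoped ENNReal

noncomputable section

namespace OddEisenstein

/-- The series `𝔾_k(τ) = -B_k / (2k) + ∑_{m, r ≥ 1} m^(k-1) q^(m r)` with `q = exp (2 π i τ)`,
for an integer `k ≥ 1`. The Bernoulli numbers are normalised by `B_1 = -1/2`; for odd `k ≥ 3`
the constant term vanishes. -/
def GG (k : ℕ) (τ : ℍ) : ℂ :=
  -(bernoulli k : ℂ) / (2 * k) +
    ∑' p : ℕ+ × ℕ+, ((p.1 : ℕ) : ℂ) ^ (k - 1) *
      Complex.exp (2 * Real.pi * Complex.I * (τ : ℂ)) ^ ((p.1 : ℕ) * (p.2 : ℕ))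

/-- The standard closed fundamental domain for `SL₂(ℤ)`, including the cusp `i∞`. In
`OnePoint ℍ` the added point plays the role of `i∞`; no other cusp lies in this set. -/
def closedFD : Set (OnePoint ℍ) :=
  {τ | τ = OnePoint.infty ∨
    ∃ z : ℍ, τ = (z : OnePoint ℍ) ∧ 1 ≤ ‖(z : ℂ)‖ ∧ -(1 / 2) ≤ z.re ∧ z.re ≤ 1 / 2}

/-- The circular part of the boundary of the fundamental domain. -/
def circularSide : Set (OnePoint ℍ) :=
  {τ | ∃ z : ℍ, τ = (z : OnePoint ℍ) ∧ ‖(z : ℂ)‖ = 1 ∧ -(1 / 2) ≤ z.re ∧ z.re ≤ 1 / 2}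

/-- The left vertical side of the fundamental domain, including `i∞`. -/
def leftSide : Set (OnePoint ℍ) :=
  {τ | τ = OnePoint.infty ∨
    ∃ z : ℍ, τ = (z : OnePoint ℍ) ∧ 1 ≤ ‖(z : ℂ)‖ ∧ z.re = -(1 / 2)}

/-- The right vertical side of the fundamental domain, including `i∞`. -/
def rightSide : Set (OnePoint ℍ) :=
  {τ | τ = OnePoint.infty ∨
    ∃ z : ℍ, τ = (z : OnePoint ℍ) ∧ 1 ≤ ‖(z : ℂ)‖ ∧ z.re = 1 / 2}

/-- The boundary of the fundamental domain. -/
def boundaryFD : Set (OnePoint ℍ) := leftSide ∪ circularSide ∪ rightSide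

/-- The two corners `ρ = -1/2 + i √3 / 2` and `ρ + 1`. -/
def corners : Set (OnePoint ℍ) :=
  {((ρ : ℍ) : OnePoint ℍ), (((1 : ℝ) +ᵥ ρ : ℍ) : OnePoint ℍ)}

open Classical in
/-- The weight of a point of the closed fundamental domain: `1/6` at the corners, `1/2` at the
other finite boundary points, `1` at interior points and at `i∞`. -/
def weight (τ : OnePoint ℍ) : ℝ≥0∞ :=
  if τ ∈ corners then 1 / 6
  else if τ ∈ boundaryFD ∧ τ ≠ OnePoint.infty then 1 / 2
  else 1

/-- The order of vanishing at a point of `ℍ ∪ {i∞}` of a function that is holomorphic on `ℍ` and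
at infinity. At `i∞` it is the least `n` with `a_n ≠ 0` in the Fourier expansion
`f = ∑_{n ≥ 0} a_n q ^ n`, and at a point of `ℍ` it is the usual order of vanishing. -/
def vanishingOrder (f : ℍ → ℂ) : OnePoint ℍ → ℕ∞
  | none => (qExpansion 1 f).order
  | some z => analyticOrderAt (f ∘ ofComplex) (z : ℂ)

/-- `τ ∈ ℍ ∪ {i∞}` is a zero of `f`. -/
def IsZeroOf (f : ℍ → ℂ) : OnePoint ℍ → Prop
  | none => IsZeroAtImInfty f
  | some z => f z = 0

/-- The weighted number of zeros `∑ w(τ) ν_τ(f)`, summed over the closed fundamental domain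
including `i∞`. Values are in `[0, ∞]`, so the sum always makes sense. -/
def weightedZeros (f : ℍ → ℂ) : ℝ≥0∞ :=
  ∑' τ : closedFD, weight τ * (vanishingOrder f τ : ℝ≥0∞)

end OddEisenstein

end

/-! For odd `k` there is no modularity and hence no valence formula, so the zeros are counted
directly in the variable q = exp(2πiτ), where 𝔾_k becomes `qSeries (k - 1)`, a power series with
real coefficients on the unit disc. The map τ ↦ q sends the fundamental domain onto a closed region
around q = 0 (the cusp), bounded by the image of the arcs |τ| = 1 and |τ - 1| = 1, joined at
exp(iπ/3). Two facts suffice, with N = `zeroCount k`: the series has exactly N zeros inside this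
curve, with multiplicity, and none on it (`hasZeroCount`); and it has at least N - 1 distinct zeros
on the enclosed part of the negative real axis, which is the image of Re τ = ±1/2
(`exists_lineValue_zeros`). Together with q = 0 the latter exhaust the count, so every zero is
simple and there are no others (`exists_zeros_of_qSeries`). Each negative zero gives one point on
each vertical side, of weight 1/2, and the cusp has weight 1; the weighted total is 1 + (N - 1).

The count. By the argument principle and the symmetry under conjugation, πN is the increase of the
argument of the series as τ runs along the unit circle from i to exp(iπ/3)
(`count_zeros_of_half_log`). For `k ≥ 9` Lipschitz's formula turns the series into a positive
constant times the sum of (-i(cτ + d))^(-k) over c ≥ 1 and all d. Multiplied by (-iτ)^k, this sum is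
1 + (1 - 1/τ)^(-k) plus a small error, and it stays in the slit plane. Its principal argument is 0
at i, while (-iτ)^(-k) gains kπ/6, and integrality then fixes N. The delicate case is k ≡ 3 mod 6,
where the two main terms cancel at exp(iπ/3): there the rotation of order 6 of the lattice leaves a
sum over a single sector, whose sign is visible (`latticeSum_corner_re_neg`). For `k ≤ 7` the first
term q dominates.

The zeros on the line. N heights on Re τ = 1/2 are exhibited at which the real-valued series has
sign (-1)^m for m = 1, ..., N. For m small compared with √k the term m^(k-1) q^m dominates the
q-series at its peak (`norm_qSeries_neg_exp_sub_le`). For larger m the two lattice terms (1, 0) and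
(1, -1) dominate and give 2 cos(kα), with α the angle between τ and the imaginary axis
(`abs_latticeSum_sub_two_cos_le`). The intermediate value theorem finishes. -/

/-! ### Holomorphic logarithms and factoring out zeros on a disc -/

open Metric in
-- A primitive F of h'/h exists on a disc, and h·exp(-F) has zero derivative; the constant is
-- adjusted at the centre.
lemma exists_log_of_ne_zero_on_ball {h : ℂ → ℂ} {R : ℝ} (hh : DifferentiableOn ℂ h (ball 0 R))
    (h0 : ∀ z ∈ ball (0 : ℂ) R, h z ≠ 0) :
    ∃ H : ℂ → ℂ, DifferentiableOn ℂ H (ball 0 R) ∧ ∀ z ∈ ball (0 : ℂ) R, h z = Complex.exp (H z) := by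
  rcases le_or_gt R 0 with hR | hR
  · exact ⟨0, by simp [ball_eq_empty.2 hR], by simp [ball_eq_empty.2 hR]⟩
  have hd : DifferentiableOn ℂ (deriv h) (ball 0 R) := hh.deriv isOpen_ball
  obtain ⟨F, hF⟩ := (hd.div hh h0).isExactOn_ball
  have h0m : (0 : ℂ) ∈ ball (0 : ℂ) R := mem_ball_self hR
  refine ⟨fun z ↦ F z - F 0 + Complex.log (h 0), fun z hz ↦ ?_, fun z hz ↦ ?_⟩
  · exact (((hF z hz).sub_const _).add_const _).differentiableAt.differentiableWithinAt
  · let W : ℂ → ℂ := fun z ↦ h z * Complex.exp (-(F z - F 0 + Complex.log (h 0)))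
    have hW : ∀ z ∈ ball (0 : ℂ) R, HasDerivAt W 0 z := by
      intro z hz
      have h1 : HasDerivAt h (deriv h z) z :=
        (hh.differentiableAt (isOpen_ball.mem_nhds hz)).hasDerivAt
      have h2 := (((hF z hz).sub_const (F 0)).add_const (Complex.log (h 0))).neg.cexp
      have h3 := h1.mul h2
      convert! h3 using 1
      have := h0 z hz
      simp only [Pi.div_apply]
      field_simp
      ring
    have hc : W z = W 0 := by
      refine (convex_ball (0 : ℂ) R).is_const_of_fderivWithin_eq_zero (𝕜 := ℂ) ?_ ?_ hz h0m
      · exact fun w hw ↦ (hW w hw).differentiableAt.differentiableWithinAt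
      · intro w hw
        rw [fderivWithin_of_isOpen isOpen_ball hw]
        ext
        simpa using (hW w hw).deriv
    simp only [W, sub_self, zero_add, Complex.exp_neg, Complex.exp_log (h0 0 h0m)] at hc
    rw [mul_inv_cancel₀ (h0 0 h0m)] at hc
    field_simp at hc
    exact hc

/-- The points of `Z` are divided out one at a time, the quotient being filled in at the removed
point by the local cofactor. Points of `Z` need not be zeros; they then get exponent 0. -/
lemma exists_factor_zeros {U : Set ℂ} (hU : IsOpen U) (Z : Finset ℂ) :
    ∀ g : ℂ → ℂ, AnalyticOnNhd ℂ g U → (∀ z ∈ U, g z = 0 → z ∈ Z) →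
      (∀ z ∈ U, analyticOrderAt g z ≠ ⊤) → (∀ z ∈ Z, z ∈ U) →
      ∃ (h : ℂ → ℂ) (n : ℂ → ℕ), AnalyticOnNhd ℂ h U ∧ (∀ z ∈ U, h z ≠ 0) ∧
        ∀ z ∈ U, g z = (∏ a ∈ Z, (z - a) ^ n a) * h z := by
  induction Z using Finset.induction_on with
  | empty =>
    intro g hg hz _ _
    exact ⟨g, fun _ ↦ 0, hg, fun z hzU h ↦ by simpa using hz z hzU h, by simp⟩
  | insert a Z ha ih =>
    intro g hg hz ho hZ
    have haU : a ∈ U := hZ a (Finset.mem_insert_self _ _)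
    obtain ⟨p, hp, hp0, hpg⟩ := (hg a haU).analyticOrderAt_ne_top.1 (ho a haU)
    set N := analyticOrderNatAt g a
    let g₁ : ℂ → ℂ := fun z ↦ if z = a then p a else g z / (z - a) ^ N
    have hne : ∀ z, z ≠ a → g₁ =ᶠ[nhds z] fun w ↦ g w / (w - a) ^ N := by
      intro z hz
      filter_upwards [isOpen_ne.mem_nhds hz] with w hw
      simp only [g₁, if_neg hw]
    have hpa : g₁ =ᶠ[nhds a] p := by
      filter_upwards [hpg] with w hw
      by_cases hwa : w = a
      · simp [g₁, hwa]
      · have : (w - a) ^ N ≠ 0 := pow_ne_zero _ (sub_ne_zero.2 hwa)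
        simp only [g₁, if_neg hwa, hw, smul_eq_mul]
        field_simp
    have hfac : ∀ z ∈ U, g z = (z - a) ^ N * g₁ z := by
      intro z hzU
      by_cases hwa : z = a
      · subst hwa
        simpa [g₁] using hpg.self_of_nhds
      · have : (z - a) ^ N ≠ 0 := pow_ne_zero _ (sub_ne_zero.2 hwa)
        simp only [g₁, if_neg hwa]
        field_simp
    have han : AnalyticOnNhd ℂ g₁ U := by
      intro z hzU
      by_cases hwa : z = a
      · subst hwa; exact hp.congr hpa.symm
      · refine AnalyticAt.congr ?_ (hne z hwa).symm
        exact (hg z hzU).div (by fun_prop) (pow_ne_zero _ (sub_ne_zero.2 hwa))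
    obtain ⟨h, n, hh, hh0, hfh⟩ := ih g₁ han (fun z hzU h0 ↦ by
        have hza : z ≠ a := by
          rintro rfl
          apply hp0
          simpa [g₁] using h0
        have := hz z hzU (by rw [hfac z hzU, h0, mul_zero])
        exact (Finset.mem_insert.1 this).resolve_left hza)
      (fun z hzU htop ↦ by
        apply ho z hzU
        rw [analyticOrderAt_eq_top] at htop ⊢
        filter_upwards [htop, hU.mem_nhds hzU] with w hw hwU
        rw [hfac w hwU, hw, mul_zero])
      (fun z hz ↦ hZ z (Finset.mem_insert_of_mem hz))
    refine ⟨h, Function.update n a N, hh, hh0, fun z hzU ↦ ?_⟩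
    rw [Finset.prod_insert ha, hfac z hzU, hfh z hzU, Function.update_self, mul_assoc]
    congr 2
    refine Finset.prod_congr rfl fun b hb ↦ ?_
    rw [Function.update_of_ne]
    rintro rfl
    exact ha hb

lemma analyticOrderAt_of_factor {U : Set ℂ} (hU : IsOpen U) {Z : Finset ℂ} {g h : ℂ → ℂ} {n : ℂ → ℕ}
    (hh : AnalyticOnNhd ℂ h U) (hh0 : ∀ z ∈ U, h z ≠ 0) (hg : AnalyticOnNhd ℂ g U)
    (hf : ∀ z ∈ U, g z = (∏ a ∈ Z, (z - a) ^ n a) * h z) {a : ℂ} (ha : a ∈ Z) (haU : a ∈ U) :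
    analyticOrderAt g a = n a := by
  classical
  rw [(hg a haU).analyticOrderAt_eq_natCast]
  refine ⟨fun z ↦ (∏ b ∈ Z.erase a, (z - b) ^ n b) * h z, ?_, ?_, ?_⟩
  · refine AnalyticAt.mul ?_ (hh a haU)
    refine Finset.analyticAt_fun_prod _ fun b _ ↦ ?_
    fun_prop
  · refine mul_ne_zero (Finset.prod_ne_zero_iff.2 fun b hb ↦ pow_ne_zero _ ?_) (hh0 a haU)
    exact sub_ne_zero.2 (Finset.ne_of_mem_erase hb).symm
  · filter_upwards [hU.mem_nhds haU] with z hz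
    rw [hf z hz, ← Finset.mul_prod_erase _ _ ha, smul_eq_mul, mul_assoc]

open Metric in
lemma finite_zeros_closedBall {g : ℂ → ℂ} {R R' : ℝ} (hR : R < R')
    (hg : AnalyticOnNhd ℂ g (ball 0 R')) {z₀ : ℂ} (hz₀ : z₀ ∈ ball (0 : ℂ) R') (h0 : g z₀ ≠ 0) :
    {z | z ∈ closedBall (0 : ℂ) R ∧ g z = 0}.Finite := by
  by_contra hinf
  obtain ⟨x, hx, hacc⟩ := Set.Infinite.exists_accPt_of_subset_isCompact hinf
    (isCompact_closedBall (0 : ℂ) R) (fun z hz ↦ hz.1)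
  refine h0 (hg.eqOn_zero_of_preconnected_of_frequently_eq_zero
    (convex_ball (0 : ℂ) R').isPreconnected (closedBall_subset_ball hR hx) ?_ hz₀)
  exact (accPt_iff_frequently_nhdsNE.1 hacc).mono fun z hz ↦ hz.2

/-! ### The argument principle for curves star-shaped about the origin -/

/-- The closed curve `x ↦ exp (2 π i (x + i y(x)))`. -/
noncomputable def stripCurve (y : ℝ → ℝ) (x : ℝ) : ℂ :=
  Complex.exp (2 * Real.pi * Complex.I * (x + Complex.I * y x))

/-- The points enclosed by `stripCurve y`. -/
def InsideCurve (y : ℝ → ℝ) (a : ℂ) : Prop :=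
  ∃ x ∈ Set.Icc (0 : ℝ) 1, ∃ s : ℝ, 0 ≤ s ∧ s < 1 ∧ a = s * stripCurve y x

lemma stripCurve_ne_zero (y : ℝ → ℝ) (x : ℝ) : stripCurve y x ≠ 0 := Complex.exp_ne_zero _

lemma stripCurve_eq (y : ℝ → ℝ) (x : ℝ) :
    stripCurve y x = Real.exp (-(2 * Real.pi * y x)) * Complex.exp ((2 * Real.pi * x : ℝ) * Complex.I) := by
  rw [stripCurve, Complex.ofReal_exp, ← Complex.exp_add]
  congr 1
  push_cast
  linear_combination (2 * Real.pi * y x) * Complex.I_mul_I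

lemma norm_stripCurve (y : ℝ → ℝ) (x : ℝ) : ‖stripCurve y x‖ = Real.exp (-(2 * Real.pi * y x)) := by
  rw [stripCurve_eq, norm_mul, Complex.norm_exp_ofReal_mul_I, mul_one, Complex.norm_real,
    Real.norm_of_nonneg (Real.exp_pos _).le]

lemma continuousOn_stripCurve {y : ℝ → ℝ} {s : Set ℝ} (hy : ContinuousOn y s) :
    ContinuousOn (stripCurve y) s := by
  unfold stripCurve
  fun_prop

/-- The argument of the curve at x is 2πx, so a ray from 0 determines x modulo 1 and meets the curve
only once. This is what makes `InsideCurve` a genuine interior. -/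
lemma eq_of_mul_exp_eq {y : ℝ → ℝ} (hy01 : y 0 = y 1) {x x' : ℝ} (hx : x ∈ Set.Icc (0 : ℝ) 1)
    (hx' : x' ∈ Set.Icc (0 : ℝ) 1) {s s' : ℝ} (hs : 0 < s) (hs' : 0 < s')
    (h : s * stripCurve y x = s' * stripCurve y x') : s = s' := by
  rw [stripCurve_eq, stripCurve_eq] at h
  have hA : 0 < s * Real.exp (-(2 * Real.pi * y x)) := by positivity
  have hB : 0 < s' * Real.exp (-(2 * Real.pi * y x')) := by positivity
  have hn := congr_arg norm h
  simp only [norm_mul, Complex.norm_exp_ofReal_mul_I, mul_one, Complex.norm_real,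
    Real.norm_of_nonneg hs.le, Real.norm_of_nonneg hs'.le, Real.norm_of_nonneg (Real.exp_pos _).le] at hn
  have hexp : Complex.exp ((2 * Real.pi * x : ℝ) * Complex.I) =
      Complex.exp ((2 * Real.pi * x' : ℝ) * Complex.I) := by
    rw [← mul_assoc, ← mul_assoc, ← Complex.ofReal_mul, ← Complex.ofReal_mul, hn] at h
    exact mul_left_cancel₀ (by exact_mod_cast hB.ne') h
  obtain ⟨n, hn'⟩ := Complex.exp_eq_exp_iff_exists_int.1 hexp
  have hxx : x = x' + n := by
    have h2 : (2 * Real.pi * Complex.I : ℂ) ≠ 0 := Complex.two_pi_I_ne_zero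
    have : (x : ℂ) = x' + n := by
      apply mul_left_cancel₀ h2
      push_cast at hn'
      linear_combination hn'
    exact_mod_cast this
  have hyy : y x = y x' := by
    have h1 : -1 ≤ (n : ℝ) := by linarith [hx.1, hx'.2]
    have h2 : (n : ℝ) ≤ 1 := by linarith [hx.2, hx'.1]
    have h1' : -1 ≤ n := by exact_mod_cast h1
    have h2' : n ≤ 1 := by exact_mod_cast h2
    obtain rfl | rfl | rfl : n = -1 ∨ n = 0 ∨ n = 1 := by omega
    · have : x = 0 := by push_cast at hxx; linarith [hx.1, hx'.2]
      have : x' = 1 := by push_cast at hxx; linarith [hx.1, hx'.2]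
      simp_all
    · simp_all
    · have : x = 1 := by push_cast at hxx; linarith [hx.2, hx'.1]
      have : x' = 0 := by push_cast at hxx; linarith [hx.2, hx'.1]
      simp_all
  rw [hyy] at hn
  exact mul_right_cancel₀ (Real.exp_pos _).ne' hn

lemma mem_slitPlane_one_sub {w : ℂ} (h : ∀ r : ℝ, 1 ≤ r → w ≠ r) : 1 - w ∈ Complex.slitPlane := by
  rw [Complex.mem_slitPlane_iff]
  by_contra! hc
  refine h w.re ?_ ?_
  · simpa using hc.1
  · apply Complex.ext <;> simp
    simpa using hc.2

open Metric in
/-- The argument principle along `stripCurve y`: a logarithm of `g` along the curve gains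
`2 π i` for every zero inside, counted with multiplicity. -/
lemma exists_log_along_stripCurve {g : ℂ → ℂ} {y : ℝ → ℝ} {R R' : ℝ} (hR : R < R')
    (hg : AnalyticOnNhd ℂ g (ball 0 R')) (hy : ContinuousOn y (Set.Icc 0 1)) (hy01 : y 0 = y 1)
    (hγ : ∀ x ∈ Set.Icc (0 : ℝ) 1, ‖stripCurve y x‖ < R)
    (hne : ∀ x ∈ Set.Icc (0 : ℝ) 1, g (stripCurve y x) ≠ 0) :
    ∃ (S : Finset ℂ) (n : ℂ → ℕ) (L : ℝ → ℂ), (∀ a, a ∈ S ↔ InsideCurve y a ∧ g a = 0) ∧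
      (∀ a ∈ S, analyticOrderAt g a = n a) ∧ ContinuousOn L (Set.Icc 0 1) ∧ L 0 = L 1 ∧
      ∀ x ∈ Set.Icc (0 : ℝ) 1, g (stripCurve y x) =
        Complex.exp (2 * Real.pi * Complex.I * (x + Complex.I * y x) * (∑ a ∈ S, n a : ℕ) + L x) := by
  classical
  have h01 : (0 : ℝ) ∈ Set.Icc (0 : ℝ) 1 := by simp
  have hγ01 : stripCurve y 0 = stripCurve y 1 := by
    rw [stripCurve_eq, stripCurve_eq, hy01]
    congr 1
    have := Complex.exp_two_pi_mul_I
    simp [this]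
  have hbR : ball (0 : ℂ) R ⊆ ball 0 R' := ball_subset_ball hR.le
  have hγb : ∀ x ∈ Set.Icc (0 : ℝ) 1, stripCurve y x ∈ ball (0 : ℂ) R := fun x hx ↦ by
    simpa using hγ x hx
  have hfin := finite_zeros_closedBall hR hg (hbR (hγb 0 h01)) (hne 0 h01)
  have hZf : {z | z ∈ ball (0 : ℂ) R ∧ g z = 0}.Finite :=
    hfin.subset fun z hz ↦ ⟨ball_subset_closedBall hz.1, hz.2⟩
  set Z := hZf.toFinset with hZdef
  have hZ : ∀ z, z ∈ Z ↔ z ∈ ball (0 : ℂ) R ∧ g z = 0 := fun z ↦ by simp [hZdef]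
  have hgR : AnalyticOnNhd ℂ g (ball 0 R) := hg.mono hbR
  obtain ⟨h, n, hh, hh0, hfac⟩ := exists_factor_zeros isOpen_ball Z g hgR
    (fun z hz h0 ↦ (hZ z).2 ⟨hz, h0⟩)
    (fun z hz htop ↦ by
      rw [analyticOrderAt_eq_top] at htop
      exact hne 0 h01 (hgR.eqOn_zero_of_preconnected_of_eventuallyEq_zero
        (convex_ball (0 : ℂ) R).isPreconnected hz htop (hγb 0 h01)))
    (fun z hz ↦ ((hZ z).1 hz).1)
  obtain ⟨H, hH, hHexp⟩ := exists_log_of_ne_zero_on_ball hh.differentiableOn hh0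
  -- For a inside, z - a = z(1 - a/z), and 1 - a/z avoids the negative axis along the curve; the
  -- factor z supplies the winding. For a outside, z - a = -a(1 - z/a), and now 1 - z/a avoids it.
  -- So every factor except the powers of z has a closed logarithm.
  let S := Z.filter (InsideCurve y)
  let T := Z.filter fun a ↦ ¬ InsideCurve y a
  have hinR : ∀ a, InsideCurve y a → a ∈ ball (0 : ℂ) R := by
    rintro a ⟨x, hx, s, hs0, hs1, rfl⟩
    rw [mem_ball_zero_iff, norm_mul, Complex.norm_real, Real.norm_of_nonneg hs0]
    exact (mul_le_of_le_one_left (norm_nonneg _) hs1.le).trans_lt (hγ x hx)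
  have hS1 : ∀ a, InsideCurve y a → ∀ x ∈ Set.Icc (0 : ℝ) 1,
      1 - a / stripCurve y x ∈ Complex.slitPlane := by
    rintro a ⟨x', hx', s, hs0, hs1, rfl⟩ x hx
    refine mem_slitPlane_one_sub fun r hr heq ↦ ?_
    rw [div_eq_iff (stripCurve_ne_zero y x)] at heq
    rcases hs0.eq_or_lt with rfl | hs0
    · have h3 : (r : ℂ) = 0 := by simpa [stripCurve_ne_zero] using heq.symm
      have : r = 0 := by exact_mod_cast h3
      linarith
    · have := eq_of_mul_exp_eq hy01 hx' hx hs0 (by linarith) heq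
      linarith
  have hT1 : ∀ a ∈ T, ∀ x ∈ Set.Icc (0 : ℝ) 1, a ≠ 0 ∧
      1 - stripCurve y x / a ∈ Complex.slitPlane := by
    intro a ha x hx
    rw [Finset.mem_filter] at ha
    have ha0 : a ≠ 0 := by
      rintro rfl
      exact ha.2 ⟨0, h01, 0, le_rfl, one_pos, by simp⟩
    refine ⟨ha0, mem_slitPlane_one_sub fun r hr heq ↦ ?_⟩
    rw [div_eq_iff ha0] at heq
    have hr0 : (r : ℂ) ≠ 0 := by exact_mod_cast (by linarith : r ≠ 0)
    rcases hr.eq_or_lt with rfl | hr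
    · rw [Complex.ofReal_one, one_mul] at heq
      exact hne x hx (heq ▸ ((hZ a).1 ha.1).2)
    · refine ha.2 ⟨x, hx, r⁻¹, by positivity, inv_lt_one_of_one_lt₀ hr, ?_⟩
      rw [heq]
      push_cast
      field_simp
  refine ⟨S, n, fun x ↦ ∑ a ∈ S, n a * Complex.log (1 - a / stripCurve y x) +
    ∑ a ∈ T, n a * (Complex.log (1 - stripCurve y x / a) + Complex.log (-a)) + H (stripCurve y x),
    ?_, ?_, ?_, ?_, ?_⟩
  · intro a
    simp only [S, Finset.mem_filter, hZ]
    exact ⟨fun h ↦ ⟨h.2, h.1.2⟩, fun h ↦ ⟨⟨hinR a h.1, h.2⟩, h.1⟩⟩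
  · intro a ha
    have haZ := (Finset.mem_filter.1 ha).1
    exact analyticOrderAt_of_factor isOpen_ball hh hh0 hgR hfac haZ ((hZ a).1 haZ).1
  · have hγc := continuousOn_stripCurve hy
    refine ContinuousOn.add (ContinuousOn.add ?_ ?_) ?_
    · refine continuousOn_finsetSum _ fun a ha ↦ continuousOn_const.mul ?_
      refine ContinuousOn.clog ?_ fun x hx ↦ hS1 a (Finset.mem_filter.1 ha).2 x hx
      exact continuousOn_const.sub (continuousOn_const.div hγc fun x _ ↦ stripCurve_ne_zero y x)
    · refine continuousOn_finsetSum _ fun a ha ↦ continuousOn_const.mul ?_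
      refine ContinuousOn.add (ContinuousOn.clog ?_ fun x hx ↦ (hT1 a ha x hx).2) continuousOn_const
      exact continuousOn_const.sub (hγc.div_const _)
    · exact hH.continuousOn.comp hγc hγb
  · simp only [hγ01]
  · intro x hx
    have hγ0 := stripCurve_ne_zero y x
    rw [hfac _ (hγb x hx), hHexp _ (hγb x hx), Complex.exp_add, Complex.exp_add, Complex.exp_add,
      ← mul_assoc, ← mul_assoc]
    congr 1
    rw [← Finset.prod_filter_mul_prod_filter_not Z (InsideCurve y)]
    congr 1
    · rw [Complex.exp_sum, mul_comm _ (((∑ a ∈ S, n a : ℕ) : ℂ)), Complex.exp_nat_mul, ← stripCurve,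
        ← Finset.prod_pow_eq_pow_sum, ← Finset.prod_mul_distrib]
      refine Finset.prod_congr rfl fun a ha ↦ ?_
      have hs := hS1 a (Finset.mem_filter.1 ha).2 x hx
      rw [Complex.exp_nat_mul, Complex.exp_log (Complex.slitPlane_ne_zero hs), ← mul_pow]
      congr 1
      field_simp
    · rw [Complex.exp_sum]
      refine Finset.prod_congr rfl fun a ha ↦ ?_
      obtain ⟨ha0, hs⟩ := hT1 a ha x hx
      rw [Complex.exp_nat_mul, Complex.exp_add, Complex.exp_log (Complex.slitPlane_ne_zero hs),
        Complex.exp_log (neg_ne_zero.2 ha0)]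
      congr 1
      field_simp
      ring

/-- Two continuous logarithms of the same function differ by a continuous map into the discrete set
2πiℤ, hence by a constant. -/
lemma sub_eq_sub_of_exp_eq {A B : ℝ → ℂ} {a b : ℝ} (hab : a ≤ b)
    (hA : ContinuousOn A (Set.Icc a b)) (hB : ContinuousOn B (Set.Icc a b))
    (h : ∀ x ∈ Set.Icc a b, Complex.exp (A x) = Complex.exp (B x)) :
    A b - A a = B b - B a := by
  have hc : ContinuousOn (fun x ↦ (A x - B x) / (2 * Real.pi * Complex.I)) (Set.Icc a b) :=
    (hA.sub hB).div_const _
  have hint : ∀ x ∈ Set.Icc a b, ∃ n : ℤ, (A x - B x) / (2 * Real.pi * Complex.I) = n := by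
    intro x hx
    obtain ⟨n, hn⟩ := Complex.exp_eq_exp_iff_exists_int.1 (h x hx)
    refine ⟨n, ?_⟩
    rw [hn, add_sub_cancel_left, mul_div_assoc, div_self Complex.two_pi_I_ne_zero, mul_one]
  have hdisc : IsDiscrete (((↑) : ℤ → ℂ) '' Set.univ) :=
    IsDiscrete.univ.image (Complex.isometry_ofReal.isEmbedding.comp
      Int.isClosedEmbedding_coe_real.isEmbedding).isInducing
  have := isPreconnected_Icc.constant_of_mapsTo hdisc hc
    (fun x hx ↦ by obtain ⟨n, hn⟩ := hint x hx; exact ⟨n, trivial, hn.symm⟩)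
    (Set.right_mem_Icc.2 hab) (Set.left_mem_Icc.2 hab)
  rw [div_left_inj' Complex.two_pi_I_ne_zero] at this
  linear_combination this

open Metric in
/-- The number of zeros inside a curve that is symmetric under `x ↦ 1 - x`, in terms of a
logarithm along half of the curve. -/
lemma count_zeros_of_half_log {g : ℂ → ℂ} {y : ℝ → ℝ} {R R' : ℝ} (hR : R < R')
    (hg : AnalyticOnNhd ℂ g (ball 0 R')) (hy : ContinuousOn y (Set.Icc 0 1))
    (hsymm : ∀ x, y (1 - x) = y x)
    (hγ : ∀ x ∈ Set.Icc (0 : ℝ) 1, ‖stripCurve y x‖ < R)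
    (hconj : ∀ q, g (starRingEnd ℂ q) = starRingEnd ℂ (g q))
    {M : ℝ → ℂ} (hM : ContinuousOn M (Set.Icc 0 (1 / 2)))
    (hgM : ∀ x ∈ Set.Icc (0 : ℝ) (1 / 2), g (stripCurve y x) = Complex.exp (M x)) :
    (∀ x ∈ Set.Icc (0 : ℝ) 1, g (stripCurve y x) ≠ 0) ∧
    ∃ (S : Finset ℂ) (n : ℂ → ℕ), (∀ a, a ∈ S ↔ InsideCurve y a ∧ g a = 0) ∧
      (∀ a ∈ S, analyticOrderAt g a = n a) ∧
      Real.pi * (∑ a ∈ S, n a : ℕ) = (M (1 / 2)).im - (M 0).im := by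
  have hγs : ∀ x, stripCurve y (1 - x) = starRingEnd ℂ (stripCurve y x) := by
    intro x
    rw [stripCurve_eq, stripCurve_eq, hsymm, map_mul, Complex.conj_ofReal, ← Complex.exp_conj,
      map_mul, Complex.conj_I, Complex.conj_ofReal]
    congr 1
    rw [Complex.exp_eq_exp_iff_exists_int]
    exact ⟨1, by push_cast; ring⟩
  -- By reflection, the conjugate of M(1 - x) is a logarithm on the second half of the curve.
  have hgM' : ∀ x ∈ Set.Icc (1 / 2 : ℝ) 1, g (stripCurve y x) =
      Complex.exp (starRingEnd ℂ (M (1 - x))) := by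
    intro x hx
    have h1 : (1 - x) ∈ Set.Icc (0 : ℝ) (1 / 2) := ⟨by linarith [hx.2], by linarith [hx.1]⟩
    rw [Complex.exp_conj, ← hgM _ h1, hγs, hconj, Complex.conj_conj]
  have hne : ∀ x ∈ Set.Icc (0 : ℝ) 1, g (stripCurve y x) ≠ 0 := by
    intro x hx
    rcases le_total x (1 / 2) with h | h
    · rw [hgM x ⟨hx.1, h⟩]; exact Complex.exp_ne_zero _
    · rw [hgM' x ⟨h, hx.2⟩]; exact Complex.exp_ne_zero _
  refine ⟨hne, ?_⟩
  have hy01 : y 0 = y 1 := by simpa using (hsymm 0).symm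
  obtain ⟨S, n, L, hS, hn, hL, hL01, hgL⟩ := exists_log_along_stripCurve hR hg hy hy01 hγ hne
  refine ⟨S, n, hS, hn, ?_⟩
  set N : ℕ := ∑ a ∈ S, n a
  have hA : ContinuousOn (fun x : ℝ ↦ 2 * Real.pi * Complex.I * (x + Complex.I * y x) * (N : ℂ) + L x)
      (Set.Icc 0 1) := by fun_prop
  have hs1 : Set.Icc (0 : ℝ) (1 / 2) ⊆ Set.Icc 0 1 := Set.Icc_subset_Icc_right (by norm_num)
  have hs2 : Set.Icc (1 / 2 : ℝ) 1 ⊆ Set.Icc 0 1 := Set.Icc_subset_Icc_left (by norm_num)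
  have e1 := sub_eq_sub_of_exp_eq (by norm_num) (hA.mono hs1) hM
    (fun x hx ↦ by rw [← hgL x (hs1 hx), hgM x hx])
  have hM' : ContinuousOn (fun x : ℝ ↦ starRingEnd ℂ (M (1 - x))) (Set.Icc (1 / 2) 1) := by
    refine Complex.continuous_conj.comp_continuousOn (hM.comp (by fun_prop) fun x hx ↦ ?_)
    exact ⟨by linarith [hx.2], by linarith [hx.1]⟩
  have e2 := sub_eq_sub_of_exp_eq (by norm_num) (hA.mono hs2) hM'
    (fun x hx ↦ by rw [← hgL x (hs2 hx), hgM' x hx])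
  -- Both halves contribute the same imaginary increment, so 2πN = 2(Im M(1/2) - Im M(0)); the
  -- closed part L drops out.
  have e3 := congr_arg Complex.im (congr_arg₂ (· + ·) e1 e2)
  simp only [← hL01, hy01] at e3
  simp at e3
  norm_num at e3
  linarith

/-! ### The q-series and the half lattice sum -/

/-- The double series `∑ m ^ κ q ^ (m r)` over `m, r ≥ 1`. -/
noncomputable def qSeries (κ : ℕ) (q : ℂ) : ℂ :=
  ∑' p : ℕ+ × ℕ+, ((p.1 : ℕ) : ℂ) ^ κ * q ^ ((p.1 : ℕ) * (p.2 : ℕ))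

lemma summable_norm_qSeries (κ : ℕ) {q : ℂ} (hq : ‖q‖ < 1) :
    Summable fun p : ℕ+ × ℕ+ ↦ ‖((p.1 : ℕ) : ℂ) ^ κ * q ^ ((p.1 : ℕ) * (p.2 : ℕ))‖ := by
  have := (summable_prod_mul_pow κ (r := ‖q‖) (by simpa using hq)).prod_symm
  refine this.congr fun p ↦ ?_
  simp [mul_comm]

lemma summable_qSeries (κ : ℕ) {q : ℂ} (hq : ‖q‖ < 1) :
    Summable fun p : ℕ+ × ℕ+ ↦ ((p.1 : ℕ) : ℂ) ^ κ * q ^ ((p.1 : ℕ) * (p.2 : ℕ)) :=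
  (summable_norm_qSeries κ hq).of_norm

open Metric in
lemma analyticOnNhd_qSeries (κ : ℕ) : AnalyticOnNhd ℂ (qSeries κ) (ball 0 1) := by
  intro z hz
  obtain ⟨R, hR, hR1⟩ := exists_between (mem_ball_zero_iff.1 hz)
  have hR0 : 0 ≤ R := (norm_nonneg z).trans hR.le
  have hs := summable_norm_qSeries κ (q := (R : ℂ)) (by simpa [abs_of_nonneg hR0] using hR1)
  have hd : DifferentiableOn ℂ (qSeries κ) (ball 0 R) := by
    refine Complex.differentiableOn_tsum_of_summable_norm hs (fun p ↦ by fun_prop) isOpen_ball ?_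
    intro p w hw
    rw [norm_mul, norm_mul, norm_pow, norm_pow w, norm_pow (R : ℂ)]
    gcongr
    rw [Complex.norm_real, Real.norm_of_nonneg hR0]
    exact (mem_ball_zero_iff.1 hw).le
  exact hd.analyticAt (isOpen_ball.mem_nhds (mem_ball_zero_iff.2 hR))

lemma qSeries_conj (κ : ℕ) (q : ℂ) : qSeries κ (starRingEnd ℂ q) = starRingEnd ℂ (qSeries κ q) := by
  simp [qSeries, Complex.conj_tsum]

lemma qSeries_zero (κ : ℕ) : qSeries κ 0 = 0 := by simp [qSeries]

lemma GG_eq_qSeries {k : ℕ} (hk : 3 ≤ k) (hodd : Odd k) (τ : ℍ) :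
    OddEisenstein.GG k τ = qSeries (k - 1) (Complex.exp (2 * Real.pi * Complex.I * (τ : ℂ))) := by
  rw [OddEisenstein.GG, bernoulli_eq_zero_of_odd hodd (by omega)]
  simp [qSeries]

/-- The term `(-i (c τ + d)) ^ (-k)` of the half lattice sum. -/
noncomputable def latticeTerm (k : ℕ) (τ : ℂ) (p : ℕ+ × ℤ) : ℂ :=
  ((-Complex.I * (((p.1 : ℕ) : ℂ) * τ + p.2)) ^ k)⁻¹

lemma norm_latticeTerm (k : ℕ) (τ : ℂ) (p : ℕ+ × ℤ) :
    ‖latticeTerm k τ p‖ = (‖((p.1 : ℕ) : ℂ) * τ + p.2‖ ^ k)⁻¹ := by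
  simp [latticeTerm]

lemma summable_latticeTerm {k : ℕ} (hk : 3 ≤ k) (τ : ℍ) : Summable (latticeTerm k τ) := by
  have h1 : Summable fun p : ℕ+ × ℤ ↦ EisensteinSeries.eisSummand k ![((p.1 : ℕ) : ℤ), p.2] τ := by
    refine (summable_prod_eisSummand hk τ).comp_injective
      (i := fun p : ℕ+ × ℤ ↦ (((p.1 : ℕ) : ℤ), p.2)) ?_
    rintro ⟨a, b⟩ ⟨c, d⟩ h
    simpa using h
  refine (h1.mul_left (((-Complex.I) ^ k)⁻¹)).congr fun p ↦ ?_
  simp only [latticeTerm, EisensteinSeries.eisSummand, mul_pow, mul_inv]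
  simp

/-- Lipschitz's formula for each cτ, summed over c. The factor -i in `latticeTerm` absorbs the
powers of i in (-2πi)^k, so the constant is real and positive and the lattice sum inherits realness
and signs from the q-series. -/
lemma qSeries_eq_latticeSum {k : ℕ} (hk : 3 ≤ k) (τ : ℍ) :
    qSeries (k - 1) (Complex.exp (2 * Real.pi * Complex.I * (τ : ℂ))) =
      (((k - 1).factorial / (2 * Real.pi) ^ k : ℝ) : ℂ) * ∑' p, latticeTerm k τ p := by
  have hq : ‖Complex.exp (2 * Real.pi * Complex.I * (τ : ℂ))‖ < 1 :=
    UpperHalfPlane.norm_exp_two_pi_I_lt_one τ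
  have hs := summable_qSeries (k - 1) hq
  rw [qSeries, hs.tsum_prod, ← Summable.tsum_comm (f := fun (m r : ℕ+) ↦ ((m : ℕ) : ℂ) ^ (k - 1) *
    Complex.exp (2 * Real.pi * Complex.I * (τ : ℂ)) ^ ((m : ℕ) * (r : ℕ))) hs, (summable_latticeTerm hk τ).tsum_prod,
    ← tsum_mul_left]
  refine tsum_congr fun c ↦ ?_
  have hc : 0 < (((c : ℕ) : ℂ) * τ).im := by
    have := c.pos
    have := τ.im_pos
    simp
    positivity
  have H := EisensteinSeries.qExpansion_identity_pnat (k := k - 1) (by omega)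
    ⟨((c : ℕ) : ℂ) * τ, hc⟩
  rw [Nat.sub_add_cancel (by omega : 1 ≤ k)] at H
  have e1 : ∑' d : ℤ, latticeTerm k τ (c, d) =
      ((-Complex.I) ^ k)⁻¹ * ∑' n : ℤ, 1 / (((c : ℕ) : ℂ) * (τ : ℂ) + n) ^ k := by
    rw [← tsum_mul_left]
    refine tsum_congr fun d ↦ ?_
    simp only [latticeTerm, mul_pow, mul_inv, one_div]
  rw [e1]
  have e2 : ∑' n : ℤ, 1 / (((c : ℕ) : ℂ) * (τ : ℂ) + n) ^ k = _ := H
  rw [e2]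
  have e3 : ∀ m : ℕ+, Complex.exp (2 * Real.pi * Complex.I * (((c : ℕ) : ℂ) * (τ : ℂ))) ^ (m : ℕ) =
      Complex.exp (2 * Real.pi * Complex.I * (τ : ℂ)) ^ ((m : ℕ) * (c : ℕ)) := by
    intro m
    rw [← Complex.exp_nat_mul, ← Complex.exp_nat_mul]
    congr 1
    push_cast
    ring
  have e4 : (-2 * Real.pi * Complex.I : ℂ) ^ k = (-Complex.I) ^ k * (2 * Real.pi) ^ k := by
    rw [← mul_pow]; ring
  have e5 : (-Complex.I : ℂ) ^ k ≠ 0 := pow_ne_zero _ (neg_ne_zero.2 Complex.I_ne_zero)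
  have e6 : (2 * Real.pi : ℂ) ^ k ≠ 0 := pow_ne_zero _ (by exact_mod_cast Real.two_pi_pos.ne')
  have e7 : ((k - 1).factorial : ℂ) ≠ 0 := by exact_mod_cast Nat.factorial_ne_zero _
  simp only [e3]
  rw [e4]
  push_cast
  field_simp

/-! ### A majorant for the lattice sum away from its two main terms -/

lemma hasSum_inv_cube : ∃ z : ℝ, z ≤ 5 / 4 ∧ HasSum (fun n : ℕ ↦ (((n : ℝ) + 1) ^ 3)⁻¹) z := by
  -- ζ(3) ≤ 5/4 by telescoping: n³ ≥ (n - 1)n(n + 1) for n ≥ 2, and the reciprocals of these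
  -- products sum to 1/4.
  have hpart : ∀ N : ℕ, ∑ n ∈ Finset.range (N + 1), (((n : ℝ) + 1) ^ 3)⁻¹ ≤
      5 / 4 - 1 / (2 * ((N : ℝ) + 1) * (N + 2)) := by
    intro N
    induction N with
    | zero => norm_num
    | succ N ih =>
      rw [Finset.sum_range_succ]
      have h : (((N + 1 : ℕ) : ℝ) + 1) ^ 3 ≥ (N + 1) * (N + 2) * (N + 3) := by
        push_cast
        nlinarith [(Nat.cast_nonneg N : (0 : ℝ) ≤ N)]
      have h2 : ((((N + 1 : ℕ) : ℝ) + 1) ^ 3)⁻¹ ≤ (((N : ℝ) + 1) * (N + 2) * (N + 3))⁻¹ :=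
        inv_anti₀ (by positivity) h
      have h3 : (((N : ℝ) + 1) * (N + 2) * (N + 3))⁻¹ =
          1 / (2 * (N + 1) * (N + 2)) - 1 / (2 * (N + 2) * (N + 3)) := by
        field_simp
        ring
      push_cast at ih h2 ⊢
      have h4 : (1 : ℝ) / (2 * (N + 1 + 1) * (N + 1 + 2)) = 1 / (2 * (N + 2) * (N + 3)) := by
        congr 1; ring
      linarith
  have hb : ∀ N : ℕ, ∑ n ∈ Finset.range N, (((n : ℝ) + 1) ^ 3)⁻¹ ≤ 5 / 4 := by
    intro N
    refine le_trans (Finset.sum_le_sum_of_subset_of_nonneg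
      (Finset.range_subset_range.2 (Nat.le_succ N)) fun _ _ _ ↦ by positivity) ((hpart N).trans ?_)
    have : (0 : ℝ) ≤ 1 / (2 * ((N : ℝ) + 1) * (N + 2)) := by positivity
    linarith
  have hs := summable_of_sum_range_le (f := fun n : ℕ ↦ (((n : ℝ) + 1) ^ 3)⁻¹)
    (fun n ↦ by positivity) hb
  exact ⟨_, Real.tsum_le_of_sum_range_le (fun n ↦ by positivity) hb, hs.hasSum⟩

lemma HasSum.mul_of_nonneg_real {ι κ : Type*} {f : ι → ℝ} {g : κ → ℝ} {a b : ℝ} (hf : HasSum f a)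
    (hg : HasSum g b) (hf0 : ∀ i, 0 ≤ f i) (hg0 : ∀ j, 0 ≤ g j) :
    HasSum (fun p : ι × κ ↦ f p.1 * g p.2) (a * b) :=
  hf.mul hg (hf.summable.mul_of_nonneg hg.summable hf0 hg0)

lemma norm_tsum_sub_le {ι : Type*} {f : ι → ℂ} {g : ι → ℝ} {s : ℝ} (a : ι) (hf : Summable f)
    (hg : HasSum g s) (hb : ∀ i ≠ a, ‖f i‖ ≤ g i) : ‖∑' i, f i - f a‖ ≤ s - g a := by
  classical
  have e1 := hf.sum_add_tsum_subtype_compl {a}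
  have e2 := hg.summable.sum_add_tsum_subtype_compl {a}
  rw [Finset.sum_singleton] at e1 e2
  rw [hg.tsum_eq] at e2
  rw [← e1, add_sub_cancel_left, ← e2, add_sub_cancel_left]
  exact tsum_of_norm_bounded (hg.summable.subtype _).hasSum
    (fun p ↦ hb p.1 fun h ↦ p.2 (Finset.mem_singleton.2 h))

/-- The quadratic form `c² + d² + min (c d, 0)`, a lower bound for `|c τ + d|²`. -/
noncomputable def latticeForm (p : ℕ+ × ℤ) : ℝ :=
  ((p.1 : ℕ) : ℝ) ^ 2 + (p.2 : ℝ) ^ 2 + min (((p.1 : ℕ) : ℝ) * p.2) 0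

/-- The factor of `latticeMajorant` depending on the second index. -/
noncomputable def majorantFactor (d : ℤ) : ℝ :=
  if d = 0 then 1 / 8 else (if 0 < d then 1 / 22 else 1 / 5) * (|(d : ℝ)| ^ 3)⁻¹

/-- A summable majorant of `latticeForm ^ (-9/2)`. -/
noncomputable def latticeMajorant (p : ℕ+ × ℤ) : ℝ :=
  (((p.1 : ℕ) : ℝ) ^ 3)⁻¹ * majorantFactor p.2

lemma majorantFactor_nonneg (d : ℤ) : 0 ≤ majorantFactor d := by
  unfold majorantFactor
  split_ifs <;> positivity

/-- The two indices of the dominant terms. -/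
def mainIndices : Finset (ℕ+ × ℤ) := {(1, 0), (1, -1)}

/-- For d < 0 the form is c² + cd + d², which is (c - |d|)² + c|d|; there its value is 1 only at (1,
-1), and otherwise at least 3. For d > 0 it is c² + d² ≥ 2cd. -/
lemma latticeForm_bounds (p : ℕ+ × ℤ) : 1 ≤ latticeForm p ∧
    3 * ((p.2 : ℝ)) ^ 2 ≤ 4 * latticeForm p ∧
    (0 < p.2 → 2 * (((p.1 : ℕ) : ℝ) * p.2) ≤ latticeForm p ∧ 2 ≤ latticeForm p) ∧
    (p.2 = 0 → latticeForm p = ((p.1 : ℕ) : ℝ) ^ 2) ∧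
    (p.2 < 0 → ((p.1 : ℕ) : ℝ) * |(p.2 : ℝ)| ≤ latticeForm p ∧
      (p ∉ mainIndices → 3 ≤ latticeForm p)) := by
  obtain ⟨c, d⟩ := p
  have hc : 1 ≤ ((c : ℕ) : ℝ) := by exact_mod_cast c.pos
  simp only [latticeForm]
  rcases lt_trichotomy d 0 with hd | hd | hd
  · have hd' : (d : ℝ) ≤ -1 := by exact_mod_cast (by omega : d ≤ -1)
    have hcd : ((c : ℕ) : ℝ) * d ≤ 0 := by nlinarith
    rw [min_eq_left hcd, abs_of_nonpos (by linarith)]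
    refine ⟨by nlinarith [sq_nonneg (((c : ℕ) : ℝ) + d)],
      by nlinarith [sq_nonneg (2 * ((c : ℕ) : ℝ) + d)], fun h ↦ by omega, fun h ↦ by omega,
      fun _ ↦ ⟨by nlinarith [sq_nonneg (((c : ℕ) : ℝ) + d)], fun hm ↦ ?_⟩⟩
    have h1 : ¬ (c = 1 ∧ d = -1) := by
      rintro ⟨rfl, rfl⟩
      simp [mainIndices] at hm
    have h2 : 2 ≤ ((c : ℕ) : ℝ) ∨ (d : ℝ) ≤ -2 := by
      by_contra! h
      apply h1
      have ha : (c : ℕ) < 2 := by exact_mod_cast h.1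
      have hb : -2 < d := by exact_mod_cast h.2
      have := c.pos
      exact ⟨PNat.coe_eq_one_iff.1 (by omega), by omega⟩
    rcases h2 with h2 | h2
    · nlinarith [sq_nonneg (((c : ℕ) : ℝ) + 2 * d)]
    · nlinarith [sq_nonneg (2 * ((c : ℕ) : ℝ) + d)]
  · subst hd
    simp
    exact c.pos
  · have hd' : (1 : ℝ) ≤ d := by exact_mod_cast (by omega : 1 ≤ d)
    have hcd : 0 ≤ ((c : ℕ) : ℝ) * d := by nlinarith
    rw [min_eq_right hcd]
    refine ⟨by nlinarith, by nlinarith, fun h ↦ ⟨by nlinarith [sq_nonneg (((c : ℕ) : ℝ) - d)], by nlinarith⟩,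
      fun h ↦ by omega, fun h ↦ by omega⟩

lemma inv_pow_nine_le_latticeMajorant {p : ℕ+ × ℤ} (hp : p ∉ mainIndices) {r : ℝ} (hr0 : 0 ≤ r)
    (hr : latticeForm p ≤ r ^ 2) : (r ^ 9)⁻¹ ≤ latticeMajorant p := by
  obtain ⟨h1, -, hpos, hzero, hneg⟩ := latticeForm_bounds p
  obtain ⟨c, d⟩ := p
  have hc : 1 ≤ ((c : ℕ) : ℝ) := by exact_mod_cast c.pos
  -- For d ≠ 0, the factor (r²)³ bounds the product of cubes and r³ supplies the constant: 3√3 > 5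
  -- for d < 0, and 8·(2√2) > 22 for d > 0. For d = 0 the roles swap: r³ ≥ c³ and (r²)³ ≥ 8.
  have e9 : r ^ 9 = r ^ 3 * (r ^ 2) ^ 3 := by ring
  simp only [latticeMajorant, majorantFactor] at *
  rcases lt_trichotomy d 0 with hd | hd | hd
  · have hd' : (d : ℝ) ≤ -1 := by exact_mod_cast (by omega : d ≤ -1)
    rw [if_neg hd.ne, if_neg hd.not_gt]
    have hd1 : 1 ≤ |(d : ℝ)| := by rw [abs_of_nonpos (by linarith)]; linarith
    obtain ⟨ha, hb⟩ := hneg hd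
    have hb := (hb hp).trans hr
    have ha := ha.trans hr
    have hr3 : 5 ≤ r ^ 3 := by
      have : 1.7 ≤ r := by nlinarith
      nlinarith
    have h6 : (((c : ℕ) : ℝ) * |(d : ℝ)|) ^ 3 ≤ (r ^ 2) ^ 3 := by gcongr
    have : 5 * ((((c : ℕ) : ℝ) * |(d : ℝ)|) ^ 3) ≤ r ^ 9 := by
      rw [e9]; gcongr
    refine (inv_anti₀ (by positivity) this).trans (le_of_eq ?_)
    rw [mul_pow, mul_inv, mul_inv]
    ring
  · subst hd
    rw [if_pos rfl]
    have hform := hzero rfl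
    have hc2 : 2 ≤ ((c : ℕ) : ℝ) := by
      have : (c : ℕ) ≠ 1 := by
        intro h
        have := PNat.coe_eq_one_iff.1 h
        subst this
        simp [mainIndices] at hp
      have := c.pos
      exact_mod_cast (by omega : 2 ≤ (c : ℕ))
    rw [hform] at hr
    have hcr : ((c : ℕ) : ℝ) ≤ r := by
      apply le_of_sq_le_sq hr hr0
    have : ((c : ℕ) : ℝ) ^ 3 * 8 ≤ r ^ 9 := by
      calc ((c : ℕ) : ℝ) ^ 3 * 8 ≤ r ^ 3 * (2 ^ 3) := by
              have : ((c : ℕ) : ℝ) ^ 3 ≤ r ^ 3 := by gcongr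
              linarith
        _ ≤ r ^ 3 * (r ^ 2) ^ 3 := by
              gcongr
              nlinarith
        _ = r ^ 9 := e9.symm
    refine (inv_anti₀ (by positivity) this).trans (le_of_eq ?_)
    rw [mul_inv]
    norm_num
  · have hd' : (1 : ℝ) ≤ d := by exact_mod_cast (by omega : 1 ≤ d)
    rw [if_neg hd.ne', if_pos hd, abs_of_pos (by linarith)]
    obtain ⟨ha, hb⟩ := hpos hd
    have hb := hb.trans hr
    have ha := ha.trans hr
    have hr3 : 11 / 4 ≤ r ^ 3 := by
      have : 1.414 ≤ r := by nlinarith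
      nlinarith
    have h6 : (2 * (((c : ℕ) : ℝ) * d)) ^ 3 ≤ (r ^ 2) ^ 3 := by gcongr
    have : 22 * ((((c : ℕ) : ℝ) * d) ^ 3) ≤ r ^ 9 := by
      rw [e9]
      calc 22 * ((((c : ℕ) : ℝ) * d) ^ 3) = 11 / 4 * (2 * (((c : ℕ) : ℝ) * d)) ^ 3 := by ring
        _ ≤ _ := by gcongr
    refine (inv_anti₀ (by positivity) this).trans (le_of_eq ?_)
    rw [mul_pow, mul_inv, mul_inv]
    ring

lemma hasSum_latticeMajorant : ∃ s : ℝ, s ≤ 109 / 200 ∧ HasSum latticeMajorant s := by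
  obtain ⟨z, hz, hzs⟩ := hasSum_inv_cube
  have hz0 : 0 ≤ z := hzs.nonneg fun n ↦ by positivity
  have hδ1 : HasSum (fun n : ℕ ↦ majorantFactor (n : ℤ)) (1 / 22 * z + 1 / 8) := by
    have : HasSum (fun n : ℕ ↦ majorantFactor ((n + 1 : ℕ) : ℤ)) (1 / 22 * z) := by
      refine (hzs.mul_left (1 / 22)).congr_fun fun n ↦ ?_
      have h1 : ((n + 1 : ℕ) : ℤ) ≠ 0 := by omega
      have h2 : 0 < ((n + 1 : ℕ) : ℤ) := by omega
      rw [majorantFactor, if_neg h1, if_pos h2]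
      push_cast
      rw [abs_of_pos (by positivity)]
    have := (hasSum_nat_add_iff (f := fun n : ℕ ↦ majorantFactor (n : ℤ)) 1).1 this
    simpa [majorantFactor] using this
  have hδ2 : HasSum (fun n : ℕ ↦ majorantFactor (-((n : ℤ) + 1))) (1 / 5 * z) := by
    refine (hzs.mul_left (1 / 5)).congr_fun fun n ↦ ?_
    have h1 : (-((n : ℤ) + 1)) ≠ 0 := by omega
    have h2 : ¬ 0 < (-((n : ℤ) + 1)) := by omega
    rw [majorantFactor, if_neg h1, if_neg h2]
    push_cast
    rw [abs_neg, abs_of_pos (by positivity)]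
  have hδ := HasSum.of_nat_of_neg_add_one hδ1 hδ2
  have hc : HasSum (fun c : ℕ+ ↦ (((c : ℕ) : ℝ) ^ 3)⁻¹) z := by
    rw [← Equiv.pnatEquivNat.symm.hasSum_iff]
    refine hzs.congr_fun fun n ↦ ?_
    simp
  refine ⟨z * (1 / 22 * z + 1 / 8 + 1 / 5 * z), by nlinarith, ?_⟩
  exact hc.mul_of_nonneg_real hδ (fun c ↦ by positivity) majorantFactor_nonneg

/-- The constant is the total 109/200 of the majorant minus its values 1/8 and 1/5 at the two main
indices. -/
lemma norm_tsum_sub_main_le {F : ℕ+ × ℤ → ℂ} {C : ℝ} (hC : 0 ≤ C) (hF : Summable F)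
    (hb : ∀ p ∉ mainIndices, ‖F p‖ ≤ C * latticeMajorant p) :
    ‖∑' p, F p - (F (1, 0) + F (1, -1))‖ ≤ C * (11 / 50) := by
  obtain ⟨s, hs, hsum⟩ := hasSum_latticeMajorant
  have hne : ((1, 0) : ℕ+ × ℤ) ≠ (1, -1) := by simp
  have e1 := hF.sum_add_tsum_subtype_compl mainIndices
  have e2 := hsum.summable.sum_add_tsum_subtype_compl mainIndices
  rw [mainIndices, Finset.sum_pair hne, ← mainIndices] at e1 e2
  rw [← e1, add_sub_cancel_left]
  have h1 : latticeMajorant (1, 0) = 1 / 8 := by simp [latticeMajorant, majorantFactor]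
  have h2 : latticeMajorant (1, -1) = 1 / 5 := by simp [latticeMajorant, majorantFactor]
  rw [h1, h2, hsum.tsum_eq] at e2
  refine (tsum_of_norm_bounded ((hsum.summable.subtype _).hasSum.mul_left C) fun p ↦ hb p.1 p.2).trans ?_
  refine mul_le_mul_of_nonneg_left ?_ hC
  have : ∑' b : {x // x ∉ mainIndices}, latticeMajorant b = s - 13 / 40 := by linarith
  refine (le_of_eq this).trans ?_
  linarith

/-- |cτ + d|² = c²|τ|² + 2cd Re τ + d², with |τ| ≥ 1 and 0 ≤ 2 Re τ ≤ 1. -/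
lemma latticeForm_le_norm_sq {τ : ℂ} (h1 : 1 ≤ ‖τ‖) (hre0 : 0 ≤ τ.re) (hre : τ.re ≤ 1 / 2)
    (p : ℕ+ × ℤ) : latticeForm p ≤ ‖((p.1 : ℕ) : ℂ) * τ + p.2‖ ^ 2 := by
  have hn : 1 ≤ τ.re ^ 2 + τ.im ^ 2 := by
    have : 1 ≤ ‖τ‖ ^ 2 := one_le_pow₀ h1
    rw [Complex.sq_norm, Complex.normSq_apply] at this
    nlinarith
  rw [Complex.sq_norm, Complex.normSq_apply]
  obtain ⟨c, d⟩ := p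
  have hc : 1 ≤ ((c : ℕ) : ℝ) := by exact_mod_cast c.pos
  simp [latticeForm]
  have hc2 : ((c : ℕ) : ℝ) ^ 2 * 1 ≤ ((c : ℕ) : ℝ) ^ 2 * (τ.re ^ 2 + τ.im ^ 2) := by gcongr
  have : min (((c : ℕ) : ℝ) * d) 0 ≤ 2 * (((c : ℕ) : ℝ) * d) * τ.re := by
    rcases le_total (((c : ℕ) : ℝ) * d) 0 with h | h
    · rw [min_eq_left h]
      nlinarith
    · rw [min_eq_right h]
      positivity
  nlinarith

lemma sqrt_latticeForm_le_norm {τ : ℂ} (h1 : 1 ≤ ‖τ‖) (hre0 : 0 ≤ τ.re) (hre : τ.re ≤ 1 / 2)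
    (p : ℕ+ × ℤ) : √(latticeForm p) ≤ ‖((p.1 : ℕ) : ℂ) * τ + p.2‖ :=
  Real.sqrt_le_iff.2 ⟨norm_nonneg _, latticeForm_le_norm_sq h1 hre0 hre p⟩

lemma one_le_sqrt_latticeForm (p : ℕ+ × ℤ) : 1 ≤ √(latticeForm p) :=
  Real.one_le_sqrt.2 (latticeForm_bounds p).1

lemma inv_sqrt_pow_le_latticeMajorant {p : ℕ+ × ℤ} (hp : p ∉ mainIndices) {k : ℕ} (hk : 9 ≤ k) :
    (√(latticeForm p) ^ k)⁻¹ ≤ latticeMajorant p := by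
  refine le_trans ?_ (inv_pow_nine_le_latticeMajorant hp (Real.sqrt_nonneg _)
    (Real.sq_sqrt (zero_le_one.trans (latticeForm_bounds p).1)).ge)
  have := one_le_sqrt_latticeForm p
  exact inv_anti₀ (by positivity) (pow_le_pow_right₀ this hk)

/-! ### The normalised lattice sum on the unit arc -/

/-- The half lattice sum `∑ (-i (c τ + d)) ^ (-k)` over `c ≥ 1`. -/
noncomputable def latticeSum (k : ℕ) (τ : ℂ) : ℂ := ∑' p, latticeTerm k τ p

/-- `latticeTerm`, normalised so that the term `(1, 0)` is `1`. -/
noncomputable def normTerm (k : ℕ) (τ : ℂ) (p : ℕ+ × ℤ) : ℂ :=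
  ((((p.1 : ℕ) : ℂ) + p.2 * τ⁻¹)⁻¹) ^ k

lemma normTerm_eq {τ : ℂ} (hτ : τ ≠ 0) (k : ℕ) (p : ℕ+ × ℤ) :
    normTerm k τ p = (-Complex.I * τ) ^ k * latticeTerm k τ p := by
  have hI : -Complex.I ≠ 0 := neg_ne_zero.2 Complex.I_ne_zero
  rw [normTerm, latticeTerm, ← inv_pow, ← mul_pow]
  congr 1
  rw [mul_inv, mul_mul_mul_comm, mul_inv_cancel₀ hI, one_mul,
    show ((p.1 : ℕ) : ℂ) * τ + p.2 = τ * (((p.1 : ℕ) : ℂ) + p.2 * τ⁻¹) by field_simp, mul_inv,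
    ← mul_assoc, mul_inv_cancel₀ hτ, one_mul]

lemma norm_add_mul_inv {τ : ℂ} (hτ : ‖τ‖ = 1) (p : ℕ+ × ℤ) :
    ‖((p.1 : ℕ) : ℂ) + p.2 * τ⁻¹‖ = ‖((p.1 : ℕ) : ℂ) * τ + p.2‖ := by
  have h0 : τ ≠ 0 := by rintro rfl; simp at hτ
  rw [show ((p.1 : ℕ) : ℂ) * τ + p.2 = τ * (((p.1 : ℕ) : ℂ) + p.2 * τ⁻¹) by field_simp, norm_mul, hτ,
    one_mul]

lemma norm_normTerm_le {τ : ℂ} (hτ : ‖τ‖ = 1) (hre0 : 0 ≤ τ.re) (hre : τ.re ≤ 1 / 2) {k : ℕ}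
    (hk : 9 ≤ k) {p : ℕ+ × ℤ} (hp : p ∉ mainIndices) : ‖normTerm k τ p‖ ≤ latticeMajorant p := by
  refine le_trans ?_ (inv_sqrt_pow_le_latticeMajorant hp hk)
  have := one_le_sqrt_latticeForm p
  rw [normTerm, norm_pow, norm_inv, norm_add_mul_inv hτ, inv_pow]
  exact inv_anti₀ (by positivity)
    (pow_le_pow_left₀ (by positivity) (sqrt_latticeForm_le_norm hτ.ge hre0 hre p) k)

/-- The usual bound n‖a - b‖r^(n - 1), multiplied by r so that no truncated subtraction occurs in
the exponent. -/
lemma norm_pow_sub_pow_le_of_norm_le {a b : ℂ} {r : ℝ} (ha : ‖a‖ ≤ r) (hb : ‖b‖ ≤ r) (n : ℕ) :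
    ‖a ^ n - b ^ n‖ * r ≤ n * ‖a - b‖ * r ^ n := by
  have hr : 0 ≤ r := (norm_nonneg a).trans ha
  induction n with
  | zero => simp
  | succ n ih =>
    have e : a ^ (n + 1) - b ^ (n + 1) = (a ^ n - b ^ n) * a + b ^ n * (a - b) := by ring
    have h1 : ‖a ^ (n + 1) - b ^ (n + 1)‖ ≤ ‖a ^ n - b ^ n‖ * r + r ^ n * ‖a - b‖ := by
      rw [e]
      refine (norm_add_le _ _).trans ?_
      rw [norm_mul, norm_mul, norm_pow]
      gcongr
    push_cast
    calc _ ≤ (‖a ^ n - b ^ n‖ * r + r ^ n * ‖a - b‖) * r := by gcongr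
      _ ≤ (n * ‖a - b‖ * r ^ n + r ^ n * ‖a - b‖) * r := by gcongr
      _ = _ := by ring

/-- A Lipschitz bound in τ with the same majorant. Varying τ costs a factor k|d|/|cτ + d|, and 3d² ≤
4Q gives |d|/√Q ≤ 2/√3 < 1.155 for the lattice form Q. It is needed near the corner for k ≡ 3 mod 6,
where the main terms vanish to first order. -/
lemma norm_normTerm_sub_le {τ τ₀ : ℂ} (hτ : ‖τ‖ = 1) (hre0 : 0 ≤ τ.re) (hre : τ.re ≤ 1 / 2)
    (hτ₀ : ‖τ₀‖ = 1) (hre0' : 0 ≤ τ₀.re) (hre' : τ₀.re ≤ 1 / 2) {k : ℕ}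
    (hk : 9 ≤ k) {p : ℕ+ × ℤ} (hp : p ∉ mainIndices) :
    ‖normTerm k τ p - normTerm k τ₀ p‖ ≤ (1.155 * k * ‖τ - τ₀‖) * latticeMajorant p := by
  have hs1 := one_le_sqrt_latticeForm p
  set s := √(latticeForm p) with hs
  have hs0 : 0 < s := by linarith
  have h0 : τ ≠ 0 := by rintro rfl; simp at hτ
  have h0' : τ₀ ≠ 0 := by rintro rfl; simp at hτ₀
  set a := ((p.1 : ℕ) : ℂ) + p.2 * τ⁻¹ with ha
  set b := ((p.1 : ℕ) : ℂ) + p.2 * τ₀⁻¹ with hb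
  have hna : s ≤ ‖a‖ := by
    rw [ha, norm_add_mul_inv hτ]; exact sqrt_latticeForm_le_norm hτ.ge hre0 hre p
  have hnb : s ≤ ‖b‖ := by
    rw [hb, norm_add_mul_inv hτ₀]; exact sqrt_latticeForm_le_norm hτ₀.ge hre0' hre' p
  have ha0 : a ≠ 0 := norm_pos_iff.1 (hs0.trans_le hna)
  have hb0 : b ≠ 0 := norm_pos_iff.1 (hs0.trans_le hnb)
  have hia : ‖a⁻¹‖ ≤ s⁻¹ := by rw [norm_inv]; exact inv_anti₀ hs0 hna
  have hib : ‖b⁻¹‖ ≤ s⁻¹ := by rw [norm_inv]; exact inv_anti₀ hs0 hnb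
  have hd : |(p.2 : ℝ)| ≤ 1.155 * s := by
    have := (latticeForm_bounds p).2.1
    have h2 : s ^ 2 = latticeForm p := Real.sq_sqrt (zero_le_one.trans (latticeForm_bounds p).1)
    refine abs_le_of_sq_le_sq ?_ (by positivity)
    nlinarith
  have hab : ‖a⁻¹ - b⁻¹‖ ≤ (1.155 * s * ‖τ - τ₀‖) * s⁻¹ * s⁻¹ := by
    have e : a⁻¹ - b⁻¹ = (p.2 * (τ - τ₀) * (τ⁻¹ * τ₀⁻¹)) * a⁻¹ * b⁻¹ := by
      have : a * b * (a⁻¹ - b⁻¹) = b - a := by field_simp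
      have h3 : b - a = p.2 * (τ - τ₀) * (τ⁻¹ * τ₀⁻¹) := by
        rw [ha, hb]; field_simp; ring
      rw [← h3, ← this]
      field_simp
    rw [e, norm_mul, norm_mul, norm_mul, norm_mul, norm_mul, norm_inv, norm_inv τ₀, hτ, hτ₀,
      Complex.norm_intCast]
    norm_num only [inv_one, mul_one] at *
    gcongr
  have key := norm_pow_sub_pow_le_of_norm_le hia hib k
  have hsi : 0 < s⁻¹ := by positivity
  have e1 : ‖a⁻¹ ^ k - b⁻¹ ^ k‖ * s⁻¹ ≤ ((1.155 * k * ‖τ - τ₀‖) * s⁻¹ ^ k) * s⁻¹ := by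
    refine key.trans ?_
    calc (k : ℝ) * ‖a⁻¹ - b⁻¹‖ * s⁻¹ ^ k ≤ k * ((1.155 * s * ‖τ - τ₀‖) * s⁻¹ * s⁻¹) * s⁻¹ ^ k := by
          gcongr
      _ = _ := by field_simp
  have e2 := le_of_mul_le_mul_right e1 hsi
  refine (show ‖normTerm k τ p - normTerm k τ₀ p‖ = ‖a⁻¹ ^ k - b⁻¹ ^ k‖ from rfl).le.trans
    (e2.trans ?_)
  rw [inv_pow]
  gcongr
  exact inv_sqrt_pow_le_latticeMajorant hp hk

lemma latticeConst_pos (k : ℕ) : 0 < ((k - 1).factorial / (2 * Real.pi) ^ k : ℝ) := by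
  have := Real.pi_pos
  positivity

/-- At real q the q-series is real, because its coefficients are, and the constant relating it to
the lattice sum is real and nonzero. -/
lemma latticeSum_im_of_conj {k : ℕ} (hk : 3 ≤ k) (τ : ℍ)
    (h : starRingEnd ℂ (Complex.exp (2 * Real.pi * Complex.I * (τ : ℂ))) =
      Complex.exp (2 * Real.pi * Complex.I * (τ : ℂ))) : (latticeSum k τ).im = 0 := by
  have h1 := qSeries_conj (k - 1) (Complex.exp (2 * Real.pi * Complex.I * (τ : ℂ)))
  rw [h, qSeries_eq_latticeSum hk] at h1
  have h2 := Complex.conj_eq_iff_im.1 h1.symm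
  rw [Complex.im_ofReal_mul] at h2
  exact (mul_eq_zero.1 h2).resolve_left (latticeConst_pos k).ne'

lemma conj_exp_of_re_eq_zero {τ : ℂ} (h : τ.re = 0) :
    starRingEnd ℂ (Complex.exp (2 * Real.pi * Complex.I * τ)) =
      Complex.exp (2 * Real.pi * Complex.I * τ) := by
  have hc : starRingEnd ℂ τ = -τ := by apply Complex.ext <;> simp [h]
  rw [← Complex.exp_conj]
  congr 1
  simp [hc, map_ofNat]

lemma conj_exp_of_re_eq_half {τ : ℂ} (h : τ.re = 1 / 2) :
    starRingEnd ℂ (Complex.exp (2 * Real.pi * Complex.I * τ)) =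
      Complex.exp (2 * Real.pi * Complex.I * τ) := by
  have hc : starRingEnd ℂ τ = 1 - τ := by
    apply Complex.ext
    · simp [h]; norm_num
    · simp
  rw [← Complex.exp_conj, Complex.exp_eq_exp_iff_exists_int]
  refine ⟨-1, ?_⟩
  simp [hc, map_ofNat]
  ring

lemma tsum_normTerm {τ : ℂ} (hτ : τ ≠ 0) (k : ℕ) :
    ∑' p, normTerm k τ p = (-Complex.I * τ) ^ k * latticeSum k τ := by
  rw [latticeSum, ← tsum_mul_left]
  exact tsum_congr fun p ↦ normTerm_eq hτ k p

lemma summable_normTerm {k : ℕ} (hk : 3 ≤ k) (τ : ℍ) : Summable (normTerm k τ) :=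
  ((summable_latticeTerm hk τ).mul_left ((-Complex.I * τ) ^ k)).congr fun p ↦
    (normTerm_eq τ.ne_zero k p).symm

lemma normTerm_one_zero (k : ℕ) (τ : ℂ) : normTerm k τ (1, 0) = 1 := by simp [normTerm]

/-- With the half-angle φ, where τ = exp(2iφ), one has 1 - 1/τ = 2 sin φ · exp(i(π/2 - φ)). This
puts the second main term in polar form; the arc from exp(iπ/3) to i is π/6 ≤ φ ≤ π/4. -/
lemma inv_one_sub_exp {φ : ℝ} (hs : Real.sin φ ≠ 0) :
    (1 - (Complex.exp (Complex.I * (2 * φ : ℝ)))⁻¹)⁻¹ =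
      ((2 * Real.sin φ)⁻¹ : ℝ) * Complex.exp ((φ - Real.pi / 2 : ℝ) * Complex.I) := by
  have hw : Complex.exp (Complex.I * (2 * φ : ℝ)) = Complex.exp (φ * Complex.I) ^ 2 := by
    rw [← Complex.exp_nat_mul]
    congr 1
    push_cast
    ring
  have hpi : Complex.exp ((φ - Real.pi / 2 : ℝ) * Complex.I) =
      -Complex.I * Complex.exp (φ * Complex.I) := by
    have : ((φ - Real.pi / 2 : ℝ) : ℂ) * Complex.I = φ * Complex.I + -(Real.pi / 2 * Complex.I) := by
      push_cast; ring
    rw [this, Complex.exp_add, Complex.exp_neg, Complex.exp_pi_div_two_mul_I, Complex.inv_I]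
    ring
  have hsin : ((2 * Real.sin φ : ℝ) : ℂ) =
      (Complex.exp (φ * Complex.I) - (Complex.exp (φ * Complex.I))⁻¹) * -Complex.I := by
    push_cast
    rw [Complex.sin, ← Complex.exp_neg]
    have : -(φ : ℂ) * Complex.I = -(φ * Complex.I) := by ring
    rw [this]
    ring
  have hs' : ((2 * Real.sin φ : ℝ) : ℂ) ≠ 0 := by
    exact_mod_cast mul_ne_zero two_ne_zero hs
  have hw0 := Complex.exp_ne_zero (φ * Complex.I)
  rw [hw, hpi, Complex.ofReal_inv]
  have h1 : 1 - (Complex.exp (φ * Complex.I) ^ 2)⁻¹ =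
      ((2 * Real.sin φ : ℝ) : ℂ) * (-Complex.I * Complex.exp (φ * Complex.I))⁻¹ := by
    rw [hsin]
    have hI := Complex.I_ne_zero
    field_simp
  rw [h1, mul_inv, inv_inv]

lemma normTerm_one_neg_one {φ : ℝ} (hs : Real.sin φ ≠ 0) (k : ℕ) :
    normTerm k (Complex.exp (Complex.I * (2 * φ : ℝ))) (1, -1) =
      (((2 * Real.sin φ) ^ k)⁻¹ : ℝ) * Complex.exp ((k * (φ - Real.pi / 2) : ℝ) * Complex.I) := by
  have := inv_one_sub_exp hs
  simp only [normTerm]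
  rw [show (((1 : ℕ+) : ℕ) : ℂ) + ((-1 : ℤ) : ℂ) * (Complex.exp (Complex.I * (2 * φ : ℝ)))⁻¹ =
    1 - (Complex.exp (Complex.I * (2 * φ : ℝ)))⁻¹ by push_cast; ring, this, mul_pow,
    ← Complex.exp_nat_mul, ← Complex.ofReal_pow, inv_pow]
  congr 2
  push_cast
  ring

lemma re_normTerm_one_neg_one {φ : ℝ} (hs : Real.sin φ ≠ 0) (k : ℕ) :
    (normTerm k (Complex.exp (Complex.I * (2 * φ : ℝ))) (1, -1)).re =
      ((2 * Real.sin φ) ^ k)⁻¹ * Real.cos (k * (φ - Real.pi / 2)) := by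
  rw [normTerm_one_neg_one hs, Complex.re_ofReal_mul, Complex.exp_ofReal_mul_I_re]

/-- The decay of the second main term away from the corner: 2 sin φ is 1 at π/6 and grows at least
like 1 + 1.5(φ - π/6) on the arc; Bernoulli's inequality does the rest. -/
lemma one_add_le_two_sin_pow {φ : ℝ} (h1 : Real.pi / 6 ≤ φ) (h2 : φ ≤ Real.pi / 4) (k : ℕ) :
    1 + 1.5 * (k * (φ - Real.pi / 6)) ≤ (2 * Real.sin φ) ^ k := by
  obtain ⟨y, rfl⟩ : ∃ y, φ = Real.pi / 6 + y := ⟨φ - Real.pi / 6, by ring⟩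
  have hy0 : 0 ≤ y := by linarith
  have hpi := Real.pi_lt_d2
  have hy1 : y ≤ 0.2625 := by linarith
  have hsin : y - y ^ 3 / 6 ≤ Real.sin y := by
    rcases hy0.eq_or_lt with rfl | h
    · simp
    · exact (Real.sin_gt_sub_cube h).le
  have hcos := Real.one_sub_sq_div_two_le_cos (x := y)
  have h3 : (1.732 : ℝ) ≤ √3 := by
    apply Real.le_sqrt_of_sq_le; norm_num
  have hb : 1 + 1.5 * y ≤ 2 * Real.sin (Real.pi / 6 + y) := by
    rw [Real.sin_add, Real.sin_pi_div_six, Real.cos_pi_div_six]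
    have h5 : 0 ≤ y - y ^ 3 / 6 := by nlinarith [mul_nonneg hy0 hy0]
    have h4 : 1.732 * (y - y ^ 3 / 6) ≤ √3 * Real.sin y := by gcongr
    nlinarith [mul_nonneg hy0 hy0, mul_nonneg hy0 (mul_nonneg hy0 hy0)]
  calc 1 + 1.5 * (k * (Real.pi / 6 + y - Real.pi / 6)) = 1 + k * (1.5 * y) := by ring
    _ ≤ (1 + 1.5 * y) ^ k := one_add_mul_le_pow (by linarith) k
    _ ≤ _ := pow_le_pow_left₀ (by positivity) hb k

lemma arc_geometry {φ : ℝ} (h1 : Real.pi / 6 ≤ φ) (h2 : φ ≤ Real.pi / 4) :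
    ‖Complex.exp (Complex.I * (2 * φ : ℝ))‖ = 1 ∧
    0 ≤ (Complex.exp (Complex.I * (2 * φ : ℝ))).re ∧
    (Complex.exp (Complex.I * (2 * φ : ℝ))).re ≤ 1 / 2 ∧ 0 < Real.sin φ := by
  have hpi := Real.pi_pos
  rw [mul_comm, Complex.norm_exp_ofReal_mul_I, Complex.exp_ofReal_mul_I_re]
  refine ⟨rfl, ?_, ?_, ?_⟩
  · exact Real.cos_nonneg_of_mem_Icc ⟨by linarith, by linarith⟩
  · rw [← Real.cos_pi_div_three]
    exact Real.cos_le_cos_of_nonneg_of_le_pi (by linarith) (by linarith) (by linarith)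
  · exact Real.sin_pos_of_pos_of_lt_pi (by linarith) (by linarith)

lemma abs_re_tsum_normTerm_sub_le {k : ℕ} (hk : 9 ≤ k) {φ : ℝ} (h1 : Real.pi / 6 ≤ φ)
    (h2 : φ ≤ Real.pi / 4) (τ : ℍ) (hτ : (τ : ℂ) = Complex.exp (Complex.I * (2 * φ : ℝ))) :
    |(∑' p, normTerm k τ p).re -
      (1 + ((2 * Real.sin φ) ^ k)⁻¹ * Real.cos (k * (φ - Real.pi / 2)))| ≤ 11 / 50 := by
  obtain ⟨hn, hr0, hr1, hs⟩ := arc_geometry h1 h2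
  have := norm_tsum_sub_main_le zero_le_one (summable_normTerm (by omega : 3 ≤ k) τ) (fun p hp ↦ by
    rw [one_mul, hτ]; exact norm_normTerm_le hn hr0 hr1 hk hp)
  rw [← re_normTerm_one_neg_one hs.ne', ← hτ, ← Complex.one_re, ← normTerm_one_zero k τ,
    ← Complex.add_re, ← Complex.sub_re]
  exact (Complex.abs_re_le_norm _).trans (by linarith)

/-- Modulo 2π the angle is k(φ - π/6) ∓ π/3, which stays within [-π/2, π/2] near the corner. -/
lemma cos_nonneg_of_mod_six {k : ℕ} (hk : k % 6 = 1 ∨ k % 6 = 5) {φ : ℝ}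
    (h1 : Real.pi / 6 ≤ φ) (h2 : k * (φ - Real.pi / 6) ≤ Real.pi / 6) :
    0 ≤ Real.cos (k * (φ - Real.pi / 2)) := by
  have hy : 0 ≤ k * (φ - Real.pi / 6) := mul_nonneg (by positivity) (by linarith)
  have hpi := Real.pi_pos
  have hdiv := Nat.div_add_mod k 6
  rcases hk with hk | hk
  · have hkr : (k : ℝ) = 6 * (k / 6 : ℕ) + 1 := by exact_mod_cast (by omega : k = 6 * (k / 6) + 1)
    have e : k * (φ - Real.pi / 2) =
        (k * (φ - Real.pi / 6) - Real.pi / 3) - (k / 6 : ℕ) * (2 * Real.pi) := by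
      linear_combination (-Real.pi / 3) * hkr
    rw [e, Real.cos_sub_nat_mul_two_pi]
    exact Real.cos_nonneg_of_mem_Icc ⟨by linarith, by linarith⟩
  · have hkr : (k : ℝ) = 6 * (k / 6 : ℕ) + 5 := by exact_mod_cast (by omega : k = 6 * (k / 6) + 5)
    have e : k * (φ - Real.pi / 2) =
        (k * (φ - Real.pi / 6) + Real.pi / 3) - ((k / 6 + 1 : ℕ) : ℝ) * (2 * Real.pi) := by
      push_cast
      linear_combination (-Real.pi / 3) * hkr
    rw [e, Real.cos_sub_nat_mul_two_pi]
    exact Real.cos_nonneg_of_mem_Icc ⟨by linarith, by linarith⟩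

lemma re_tsum_normTerm_pos {k : ℕ} (hk : 9 ≤ k) (hk6 : k % 6 = 1 ∨ k % 6 = 5) {φ : ℝ}
    (h1 : Real.pi / 6 ≤ φ) (h2 : φ ≤ Real.pi / 4) (τ : ℍ)
    (hτ : (τ : ℂ) = Complex.exp (Complex.I * (2 * φ : ℝ))) :
    0 < (∑' p, normTerm k τ p).re := by
  have h := (abs_le.1 (abs_re_tsum_normTerm_sub_le hk h1 h2 τ hτ)).1
  have hρ := one_add_le_two_sin_pow h1 h2 k
  have hy : 0 ≤ k * (φ - Real.pi / 6) := mul_nonneg (by positivity) (by linarith)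
  have hpow : 0 < (2 * Real.sin φ) ^ k := by linarith
  suffices -0.57 ≤ ((2 * Real.sin φ) ^ k)⁻¹ * Real.cos (k * (φ - Real.pi / 2)) by linarith
  -- Near the corner the second term helps. Farther away it is at most 1/(1 + 1.5·π/6) < 0.57 in
  -- size, and 1 - 0.57 - 0.22 > 0.
  rcases le_total (k * (φ - Real.pi / 6)) (Real.pi / 6) with h3 | h3
  · have := mul_nonneg (inv_nonneg.2 hpow.le) (cos_nonneg_of_mod_six hk6 h1 h3)
    linarith
  · have hpi := Real.pi_gt_d2
    have h4 : ((2 * Real.sin φ) ^ k)⁻¹ ≤ 0.57 := by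
      rw [inv_le_comm₀ hpow (by norm_num)]
      norm_num
      linarith
    nlinarith [Real.neg_one_le_cos (k * (φ - Real.pi / 2)), inv_pos.2 hpow]

/-- The main terms give 1 - cos y/(2 sin φ)^k with y = k(φ - π/6), which vanishes at the corner, so
a fixed error bound is useless there. At the corner the real part of the remainder is also 0, by
`h0`, so only its variation along the arc matters. -/
lemma re_tsum_normTerm_pos_of_mod_six_eq_three {k : ℕ} (hk : 9 ≤ k) (hk6 : k % 6 = 3) {φ : ℝ}
    (h1 : Real.pi / 6 < φ) (h2 : φ ≤ Real.pi / 4) (τ τ₀ : ℍ)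
    (hτ : (τ : ℂ) = Complex.exp (Complex.I * (2 * φ : ℝ)))
    (hτ₀ : (τ₀ : ℂ) = Complex.exp (Complex.I * (2 * (Real.pi / 6) : ℝ)))
    (h0 : (∑' p, normTerm k τ₀ p).re = 0) :
    0 < (∑' p, normTerm k τ p).re := by
  have hpi := Real.pi_pos
  have hρ := one_add_le_two_sin_pow h1.le h2 k
  set y := k * (φ - Real.pi / 6) with hy
  have hy0 : 0 < y := mul_pos (by exact_mod_cast (by omega : 0 < k)) (by linarith)
  have hpow : 0 < (2 * Real.sin φ) ^ k := by linarith
  have hcos : Real.cos (k * (φ - Real.pi / 2)) = -Real.cos y := by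
    have hkr : (k : ℝ) = 6 * (k / 6 : ℕ) + 3 := by exact_mod_cast (by omega : k = 6 * (k / 6) + 3)
    have e : k * (φ - Real.pi / 2) = (y - Real.pi) - (k / 6 : ℕ) * (2 * Real.pi) := by
      rw [hy]
      linear_combination (-Real.pi / 3) * hkr
    rw [e, Real.cos_sub_nat_mul_two_pi, Real.cos_sub_pi]
  obtain ⟨hn, hr0, hr1, hs⟩ := arc_geometry h1.le h2
  obtain ⟨hn', hr0', hr1', hs'⟩ := arc_geometry (le_refl (Real.pi / 6)) (by linarith)
  have hm := re_normTerm_one_neg_one hs.ne' k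
  have hm₀ := re_normTerm_one_neg_one hs'.ne' k
  have hs6 : 2 * Real.sin (Real.pi / 6) = 1 := by rw [Real.sin_pi_div_six]; norm_num
  have hcos₀ : Real.cos (k * (Real.pi / 6 - Real.pi / 2)) = -1 := by
    have hkr : (k : ℝ) = 6 * (k / 6 : ℕ) + 3 := by exact_mod_cast (by omega : k = 6 * (k / 6) + 3)
    have e : k * (Real.pi / 6 - Real.pi / 2) = (0 - Real.pi) - (k / 6 : ℕ) * (2 * Real.pi) := by
      linear_combination (-Real.pi / 3) * hkr
    rw [e, Real.cos_sub_nat_mul_two_pi, Real.cos_sub_pi, Real.cos_zero]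
  rw [hs6, one_pow, inv_one, one_mul, hcos₀, ← hτ₀] at hm₀
  rw [hcos, ← hτ] at hm
  have hsum := summable_normTerm (by omega : 3 ≤ k) τ
  have hsum₀ := summable_normTerm (by omega : 3 ≤ k) τ₀
  have b1 := norm_tsum_sub_main_le zero_le_one hsum (fun p hp ↦ by
    rw [one_mul, hτ]; exact norm_normTerm_le hn hr0 hr1 hk hp)
  have b2 := norm_tsum_sub_main_le zero_le_one hsum₀ (fun p hp ↦ by
    rw [one_mul, hτ₀]; exact norm_normTerm_le hn' hr0' hr1' hk hp)
  have b3 := norm_tsum_sub_main_le (F := fun p ↦ normTerm k τ p - normTerm k τ₀ p)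
    (C := 1.155 * k * ‖(τ : ℂ) - τ₀‖) (by positivity) (hsum.sub hsum₀) (fun p hp ↦ by
      rw [hτ, hτ₀]; exact norm_normTerm_sub_le hn hr0 hr1 hn' hr0' hr1' hk hp)
  have hdist : ‖(τ : ℂ) - τ₀‖ ≤ 2 * (φ - Real.pi / 6) := by
    have e : (τ : ℂ) - τ₀ = τ₀ * (Complex.exp (Complex.I * (2 * (φ - Real.pi / 6) : ℝ)) - 1) := by
      rw [mul_sub, hτ, hτ₀, ← Complex.exp_add, mul_one]
      congr 2
      push_cast
      ring
    rw [e, norm_mul, hτ₀, hn', one_mul]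
    refine Real.norm_exp_I_mul_ofReal_sub_one_le.trans ?_
    rw [Real.norm_of_nonneg (by linarith)]
  have hC : 1.155 * k * ‖(τ : ℂ) - τ₀‖ ≤ 2.31 * y := by
    rw [hy]
    calc 1.155 * k * ‖(τ : ℂ) - τ₀‖ ≤ 1.155 * k * (2 * (φ - Real.pi / 6)) := by gcongr
      _ = _ := by ring
  rw [hsum.tsum_sub hsum₀] at b3
  set A := ∑' p, normTerm k τ p
  set B := ∑' p, normTerm k τ₀ p
  have c1 := (abs_le.1 ((Complex.abs_re_le_norm _).trans b1)).1
  have c2 := (abs_le.1 ((Complex.abs_re_le_norm _).trans b2)).2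
  have c3 := (abs_le.1 ((Complex.abs_re_le_norm _).trans b3)).1
  simp only [Complex.sub_re, Complex.add_re, normTerm_one_zero, Complex.one_re, hm, hm₀, h0] at c1 c2 c3
  have hinv : ((2 * Real.sin φ) ^ k)⁻¹ ≤ (1 + 1.5 * y)⁻¹ := inv_anti₀ (by linarith) hρ
  have hcosle : ((2 * Real.sin φ) ^ k)⁻¹ * Real.cos y ≤ (1 + 1.5 * y)⁻¹ := by
    have := Real.cos_le_one y
    have := inv_pos.2 hpow
    nlinarith
  -- For y ≤ 1 the main part is at least 0.6y, and the remainder varies by at most 2.31·0.22·y <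
  -- 0.51y. For y ≥ 1 the crude bound 1 - 0.4 - 0.22 > 0 suffices.
  rcases le_total y 1 with h | h
  · have : (1 + 1.5 * y)⁻¹ ≤ 1 - 0.6 * y := by
      rw [inv_le_iff_one_le_mul₀ (by linarith)]
      nlinarith
    nlinarith
  · have : (1 + 1.5 * y)⁻¹ ≤ 0.4 := by
      rw [inv_le_comm₀ (by linarith) (by norm_num)]
      norm_num
      linarith
    linarith

/-! ### The lattice sum at the corner when k ≡ 3 mod 6 -/

/-- The corner `exp (i π / 3)` of the fundamental domain. -/
noncomputable def corner : ℍ :=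
  ⟨Complex.exp (Complex.I * (2 * (Real.pi / 6) : ℝ)), by
    rw [mul_comm, Complex.exp_ofReal_mul_I_im]
    exact Real.sin_pos_of_pos_of_lt_pi (by positivity) (by linarith [Real.pi_pos])⟩

lemma coe_corner : (corner : ℂ) = Complex.exp (Complex.I * (2 * (Real.pi / 6) : ℝ)) := rfl

lemma corner_re : (corner : ℂ).re = 1 / 2 := by
  rw [coe_corner, mul_comm, Complex.exp_ofReal_mul_I_re, show 2 * (Real.pi / 6) = Real.pi / 3 by ring,
    Real.cos_pi_div_three]

lemma corner_im : (corner : ℂ).im = √3 / 2 := by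
  rw [coe_corner, mul_comm, Complex.exp_ofReal_mul_I_im, show 2 * (Real.pi / 6) = Real.pi / 3 by ring,
    Real.sin_pi_div_three]

lemma corner_sq : (corner : ℂ) ^ 2 = corner - 1 := by
  have h3 : √3 ^ 2 = 3 := Real.sq_sqrt (by norm_num)
  apply Complex.ext
  · simp [pow_two, corner_re, corner_im, -coe_re, -coe_im]
    nlinarith
  · simp [pow_two, corner_re, corner_im, -coe_re, -coe_im]
    ring

lemma corner_cube : (corner : ℂ) ^ 3 = -1 := by
  linear_combination ((corner : ℂ) + 1) * corner_sq

lemma corner_pow {k : ℕ} (hk6 : k % 6 = 3) : (corner : ℂ) ^ k = -1 := by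
  obtain ⟨j, rfl⟩ : ∃ j, k = 3 * (2 * j + 1) := ⟨k / 6, by omega⟩
  rw [pow_mul, corner_cube, Odd.neg_one_pow ⟨j, rfl⟩]

lemma latticeTerm_of_mul {k : ℕ} {p p' : ℕ+ × ℤ} {τ z : ℂ}
    (h : ((p'.1 : ℕ) : ℂ) * τ + p'.2 = z * (((p.1 : ℕ) : ℂ) * τ + p.2)) :
    latticeTerm k τ p' = (z ^ k)⁻¹ * latticeTerm k τ p := by
  rw [latticeTerm, latticeTerm, h, ← mul_inv, ← mul_pow]
  congr 2
  ring

set_option maxHeartbeats 1000000 in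
/-- At the corner, terms cancel along orbits of the rotation by `π / 3`, leaving the sum over one
sector. -/
lemma hasSum_latticeTerm_corner {k : ℕ} (hk : 3 ≤ k) (hk6 : k % 6 = 3) :
    HasSum (fun p : ℕ+ × ℕ+ ↦ latticeTerm k corner (p.1, ((p.2 : ℕ) : ℤ))) (latticeSum k corner) := by
  set F := latticeTerm k corner with hF
  have hs : Summable F := summable_latticeTerm hk corner
  -- The half lattice splits into the open sector `i₁`, the ray `i₂`, and their rotations: `i₃` and
  -- `i₄` by ω = exp(iπ/3), and `i₅` (of the sector) by ω². As ω^k = -1, the contributions are P, Z,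
  -- -P, -Z, P, with total P.
  let i₁ : ℕ+ × ℕ+ → ℕ+ × ℤ := fun p ↦ (p.1, ((p.2 : ℕ) : ℤ))
  let i₂ : ℕ+ → ℕ+ × ℤ := fun c ↦ (c, 0)
  let i₃ : ℕ+ × ℕ+ → ℕ+ × ℤ := fun p ↦ (p.1 + p.2, -((p.1 : ℕ) : ℤ))
  let i₄ : ℕ+ → ℕ+ × ℤ := fun c ↦ (c, -((c : ℕ) : ℤ))
  let i₅ : ℕ+ × ℕ+ → ℕ+ × ℤ := fun p ↦ (p.2, -(((p.1 : ℕ) : ℤ) + (p.2 : ℕ)))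
  have inj₁ : Function.Injective i₁ := by
    rintro ⟨a, b⟩ ⟨c, d⟩ h
    simpa [i₁] using h
  have inj₂ : Function.Injective i₂ := by
    intro a b h
    simpa [i₂] using h
  have inj₃ : Function.Injective i₃ := by
    rintro ⟨a, b⟩ ⟨c, d⟩ h
    simp only [i₃, Prod.mk.injEq, neg_inj, Nat.cast_inj, PNat.coe_inj] at h ⊢
    obtain ⟨h1, rfl⟩ := h
    simpa using h1
  have inj₄ : Function.Injective i₄ := by
    intro a b h
    simpa [i₄] using h
  have inj₅ : Function.Injective i₅ := by
    rintro ⟨a, b⟩ ⟨c, d⟩ h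
    simp only [i₅, Prod.mk.injEq, neg_inj] at h ⊢
    obtain ⟨rfl, h1⟩ := h
    simpa using h1
  have s₁ := hs.comp_injective inj₁
  have s₂ := hs.comp_injective inj₂
  obtain ⟨P, hP⟩ := s₁
  obtain ⟨Z, hZ⟩ := s₂
  have hpow := corner_pow hk6
  have f₃ : ∀ p, F (i₃ p) = -F (i₁ p) := by
    intro p
    have := latticeTerm_of_mul (k := k) (p := i₁ p) (p' := i₃ p) (τ := corner) (z := corner) (by
      simp only [i₁, i₃]
      push_cast
      linear_combination (-((p.1 : ℕ) : ℂ)) * corner_sq)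
    rw [hF, this, hpow]
    ring
  have f₄ : ∀ c, F (i₄ c) = -F (i₂ c) := by
    intro c
    have := latticeTerm_of_mul (k := k) (p := i₂ c) (p' := i₄ c) (τ := corner) (z := corner) (by
      simp only [i₂, i₄]
      push_cast
      linear_combination (-((c : ℕ) : ℂ)) * corner_sq)
    rw [hF, this, hpow]
    ring
  have f₅ : ∀ p, F (i₅ p) = F (i₁ p) := by
    intro p
    have := latticeTerm_of_mul (k := k) (p := i₁ p) (p' := i₅ p) (τ := corner) (z := corner ^ 2) (by
      simp only [i₁, i₅]
      push_cast
      linear_combination (-((p.1 : ℕ) : ℂ) * (corner + 1) - (p.2 : ℕ)) * corner_sq)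
    rw [hF, this, ← pow_mul, mul_comm 2 k, pow_mul, hpow]
    ring
  have h₁ : HasSum (F ∘ ((↑) : Set.range i₁ → ℕ+ × ℤ)) P := inj₁.hasSum_range_iff.2 hP
  have h₂ : HasSum (F ∘ ((↑) : Set.range i₂ → ℕ+ × ℤ)) Z := inj₂.hasSum_range_iff.2 hZ
  have g₃ : HasSum (F ∘ i₃) (-P) := hP.neg.congr_fun f₃
  have g₄ : HasSum (F ∘ i₄) (-Z) := hZ.neg.congr_fun f₄
  have g₅ : HasSum (F ∘ i₅) P := hP.congr_fun f₅
  have h₃ : HasSum (F ∘ ((↑) : Set.range i₃ → ℕ+ × ℤ)) (-P) := inj₃.hasSum_range_iff.2 g₃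
  have h₄ : HasSum (F ∘ ((↑) : Set.range i₄ → ℕ+ × ℤ)) (-Z) := inj₄.hasSum_range_iff.2 g₄
  have h₅ : HasSum (F ∘ ((↑) : Set.range i₅ → ℕ+ × ℤ)) P := inj₅.hasSum_range_iff.2 g₅
  have d₁₂ : Disjoint (Set.range i₁) (Set.range i₂) := by
    rw [Set.disjoint_left]
    rintro _ ⟨p, rfl⟩ ⟨c, hc⟩
    simp only [i₁, i₂, Prod.mk.injEq] at hc
    have := p.2.pos
    omega
  have d₃ : Disjoint (Set.range i₁ ∪ Set.range i₂) (Set.range i₃) := by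
    rw [Set.disjoint_left]
    rintro _ (⟨p, rfl⟩ | ⟨p, rfl⟩) ⟨c, hc⟩ <;> simp only [i₁, i₂, i₃, Prod.mk.injEq] at hc
    · have := c.1.pos; omega
    · have := c.1.pos; omega
  have d₄ : Disjoint (Set.range i₁ ∪ Set.range i₂ ∪ Set.range i₃) (Set.range i₄) := by
    rw [Set.disjoint_left]
    rintro _ ((⟨p, rfl⟩ | ⟨p, rfl⟩) | ⟨p, rfl⟩) ⟨c, hc⟩ <;>
      simp only [i₁, i₂, i₃, i₄, Prod.mk.injEq] at hc <;> have := c.pos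
    · omega
    · omega
    · have h1 : (c : ℕ) = p.1 + p.2 := congr_arg PNat.val hc.1
      have := p.2.pos
      omega
  have d₅ : Disjoint (Set.range i₁ ∪ Set.range i₂ ∪ Set.range i₃ ∪ Set.range i₄) (Set.range i₅) := by
    rw [Set.disjoint_left]
    rintro _ (((⟨p, rfl⟩ | ⟨p, rfl⟩) | ⟨p, rfl⟩) | ⟨p, rfl⟩) ⟨c, hc⟩ <;>
      simp only [i₁, i₂, i₃, i₄, i₅, Prod.mk.injEq] at hc <;> have := c.1.pos
    · omega
    · omega
    · have h1 : (c.2 : ℕ) = p.1 + p.2 := congr_arg PNat.val hc.1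
      omega
    · have h1 : (c.2 : ℕ) = p := congr_arg PNat.val hc.1
      omega
  have huniv : Set.range i₁ ∪ Set.range i₂ ∪ Set.range i₃ ∪ Set.range i₄ ∪ Set.range i₅ = Set.univ := by
    refine Set.eq_univ_of_forall ?_
    rintro ⟨c, d⟩
    have hc := c.pos
    rcases lt_trichotomy d 0 with hd | hd | hd
    · obtain ⟨n, rfl⟩ : ∃ n : ℕ, d = -(n : ℤ) := ⟨d.natAbs, by omega⟩
      rcases lt_trichotomy n (c : ℕ) with h | h | h
      · refine .inl (.inl (.inr ⟨(⟨n, by omega⟩, ⟨c - n, by omega⟩), ?_⟩))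
        refine Prod.ext (PNat.eq ((PNat.add_coe _ _).trans ?_)) rfl
        simp only [PNat.mk_coe]
        omega
      · exact .inl (.inr ⟨c, by simp [i₄, h]⟩)
      · refine .inr ⟨(⟨n - c, by omega⟩, c), ?_⟩
        simp only [i₅, Prod.mk.injEq, PNat.mk_coe, true_and]
        omega
    · exact .inl (.inl (.inl (.inr ⟨c, by simp [i₂, hd]⟩)))
    · refine .inl (.inl (.inl (.inl ⟨(c, ⟨d.natAbs, by omega⟩), ?_⟩)))
      simp only [i₁, Prod.mk.injEq, PNat.mk_coe, true_and]
      omega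
  have htot := (((h₁.add_disjoint d₁₂ h₂).add_disjoint d₃ h₃).add_disjoint d₄ h₄).add_disjoint d₅ h₅
  rw [huniv] at htot
  have htot' := (hasSum_subtype_iff_of_support_subset (Set.subset_univ _)).1 htot
  have : latticeSum k corner = P := by
    rw [latticeSum, ← hF, htot'.tsum_eq]
    ring
  rw [this]
  exact hP

/-- In the remaining sector a² + ab + b² ≥ 3ab. After scaling by √3^k the term (1, 1) is exactly -1,
and the others add up to at most ζ(3)² - 1 ≤ 9/16. -/
lemma latticeSum_corner_re_neg {k : ℕ} (hk : 9 ≤ k) (hk6 : k % 6 = 3) :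
    (latticeSum k corner).re < 0 := by
  have hsum := hasSum_latticeTerm_corner (by omega : 3 ≤ k) hk6
  set F : ℕ+ × ℕ+ → ℂ := fun p ↦ latticeTerm k corner (p.1, ((p.2 : ℕ) : ℤ)) with hF
  have h3 : √3 ^ 2 = 3 := Real.sq_sqrt (by norm_num)
  have h3' : 0 < √3 := by positivity
  have hr := corner_re
  have hi := corner_im
  have hmain : (√3 : ℂ) ^ k * F (1, 1) = -1 := by
    have e : (corner : ℂ) * (-Complex.I * (((1 : ℕ+) : ℕ) * (corner : ℂ) + (((1 : ℕ+) : ℕ) : ℤ))) = √3 := by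
      have : (corner : ℂ) * (-Complex.I * (((1 : ℕ+) : ℕ) * (corner : ℂ) + (((1 : ℕ+) : ℕ) : ℤ))) =
          -Complex.I * (2 * corner - 1) := by
        push_cast
        linear_combination (-Complex.I) * corner_sq
      rw [this]
      apply Complex.ext
      · simp [hr, hi, -coe_re, -coe_im]; ring
      · simp [hr, hi, -coe_re, -coe_im]
    have hne : (√3 : ℂ) ≠ 0 := by exact_mod_cast h3'.ne'
    have hx : -Complex.I * (((1 : ℕ+) : ℕ) * (corner : ℂ) + (((1 : ℕ+) : ℕ) : ℤ)) ≠ 0 := by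
      intro h0
      rw [h0, mul_zero] at e
      exact hne e.symm
    simp only [hF, latticeTerm]
    rw [← e, mul_pow, mul_assoc, mul_inv_cancel₀ (pow_ne_zero _ hx), mul_one, corner_pow hk6]
  obtain ⟨z, hz, hzs⟩ := hasSum_inv_cube
  have hz0 : 0 ≤ z := hzs.nonneg fun n ↦ by positivity
  have hc : HasSum (fun c : ℕ+ ↦ (((c : ℕ) : ℝ) ^ 3)⁻¹) z := by
    rw [← Equiv.pnatEquivNat.symm.hasSum_iff]
    refine hzs.congr_fun fun n ↦ ?_
    simp
  have hcc : HasSum (fun p : ℕ+ × ℕ+ ↦ (((p.1 : ℕ) : ℝ) ^ 3)⁻¹ * (((p.2 : ℕ) : ℝ) ^ 3)⁻¹) (z * z) :=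
    hc.mul_of_nonneg_real hc (fun c ↦ by positivity) (fun d ↦ by positivity)
  have hb : ∀ p, ‖(√3 : ℂ) ^ k * F p‖ ≤ (((p.1 : ℕ) : ℝ) ^ 3)⁻¹ * (((p.2 : ℕ) : ℝ) ^ 3)⁻¹ := by
    rintro ⟨a, b⟩
    have ha : 1 ≤ ((a : ℕ) : ℝ) := by exact_mod_cast a.pos
    have hb : 1 ≤ ((b : ℕ) : ℝ) := by exact_mod_cast b.pos
    have hab : 1 ≤ ((a : ℕ) : ℝ) * (b : ℕ) := by nlinarith
    set r := ‖((a : ℕ) : ℂ) * corner + ((b : ℕ) : ℤ)‖ with hrdef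
    have hr2 : 3 * (((a : ℕ) : ℝ) * (b : ℕ)) ≤ r ^ 2 := by
      rw [hrdef, Complex.sq_norm, Complex.normSq_apply]
      simp [hr, hi, -coe_re, -coe_im]
      nlinarith [sq_nonneg (((a : ℕ) : ℝ) - (b : ℕ))]
    have hsq : √3 * √(((a : ℕ) : ℝ) * (b : ℕ)) ≤ r := by
      rw [← Real.sqrt_mul (by norm_num)]
      exact Real.sqrt_le_iff.2 ⟨norm_nonneg _, hr2⟩
    have hs1 : 1 ≤ √(((a : ℕ) : ℝ) * (b : ℕ)) := Real.one_le_sqrt.2 hab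
    have e1 : ‖(√3 : ℂ) ^ k * F (a, b)‖ = √3 ^ k * (r ^ k)⁻¹ := by
      rw [norm_mul, norm_pow, hF]
      simp only [norm_latticeTerm]
      rw [Complex.norm_real, Real.norm_of_nonneg h3'.le]
    rw [e1, ← mul_inv, ← mul_pow]
    calc √3 ^ k * (r ^ k)⁻¹ ≤ √3 ^ k * ((√3 * √(((a : ℕ) : ℝ) * (b : ℕ))) ^ k)⁻¹ := by gcongr
      _ = (√(((a : ℕ) : ℝ) * (b : ℕ)) ^ k)⁻¹ := by
        rw [mul_pow, mul_inv, ← mul_assoc, mul_inv_cancel₀ (by positivity), one_mul]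
      _ ≤ (√(((a : ℕ) : ℝ) * (b : ℕ)) ^ 6)⁻¹ :=
        inv_anti₀ (by positivity) (pow_le_pow_right₀ hs1 (by omega))
      _ = ((((a : ℕ) : ℝ) * (b : ℕ)) ^ 3)⁻¹ := by
        rw [show √(((a : ℕ) : ℝ) * (b : ℕ)) ^ 6 = (√(((a : ℕ) : ℝ) * (b : ℕ)) ^ 2) ^ 3 by ring,
          Real.sq_sqrt (by linarith)]
  have hG := hsum.mul_left ((√3 : ℂ) ^ k)
  have hbound := norm_tsum_sub_le (1, 1) hG.summable hcc fun p _ ↦ hb p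
  rw [hG.tsum_eq, hmain, PNat.one_coe, Nat.cast_one, one_pow, inv_one, mul_one] at hbound
  have h4 := (Complex.re_le_norm _).trans hbound
  rw [Complex.sub_re, ← Complex.ofReal_pow, Complex.re_ofReal_mul] at h4
  have h6 : √3 ^ k * (latticeSum k corner).re < 0 := by
    have : z * z ≤ 25 / 16 := by nlinarith
    simp only [Complex.neg_re, Complex.one_re] at h4
    linarith
  by_contra! h
  exact h6.not_ge (mul_nonneg (by positivity) h)

/-! ### The number of zeros for k ≥ 9 -/

/-- The height of the lower boundary of `{0 ≤ re z ≤ 1, |z| ≥ 1, |z - 1| ≥ 1}`. -/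
noncomputable def arcHeight (x : ℝ) : ℝ := √(1 - (min x (1 - x)) ^ 2)

lemma arcHeight_symm (x : ℝ) : arcHeight (1 - x) = arcHeight x := by
  rw [arcHeight, arcHeight, sub_sub_cancel, min_comm]

lemma arcHeight_eq {x : ℝ} (hx : x ≤ 1 / 2) : arcHeight x = √(1 - x ^ 2) := by
  rw [arcHeight, min_eq_left (by linarith)]

lemma continuous_arcHeight : Continuous arcHeight := by
  unfold arcHeight
  fun_prop

lemma sqrt_three_div_two_le_arcHeight {x : ℝ} (hx : x ∈ Set.Icc (0 : ℝ) 1) : √3 / 2 ≤ arcHeight x := by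
  apply Real.le_sqrt_of_sq_le
  have h1 : min x (1 - x) ≤ 1 / 2 := by
    rcases le_total x (1 / 2) with h | h
    · exact (min_le_left _ _).trans h
    · exact (min_le_right _ _).trans (by linarith)
  have h2 : 0 ≤ min x (1 - x) := le_min hx.1 (by linarith [hx.2])
  rw [div_pow, Real.sq_sqrt (by norm_num)]
  nlinarith

lemma norm_exp_le_of_im {t : ℝ} (ht : √3 / 2 ≤ t) : Real.exp (-(2 * Real.pi * t)) ≤ 1 / 140 := by
  have h3 : (1.7 : ℝ) ≤ √3 := by
    apply Real.le_sqrt_of_sq_le; norm_num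
  have hpi := Real.pi_gt_three
  have h5 : 5 ≤ 2 * Real.pi * t := by nlinarith
  have he : Real.exp (-(2 * Real.pi * t)) ≤ Real.exp (-5) := Real.exp_le_exp.2 (by linarith)
  have h1 : (140 : ℝ) ≤ Real.exp 5 := by
    have := Real.exp_one_gt_d9
    have h2 : Real.exp 5 = Real.exp 1 ^ 5 := by rw [← Real.exp_nat_mul]; norm_num
    rw [h2]
    calc (140 : ℝ) ≤ 2.7182818283 ^ 5 := by norm_num
      _ ≤ _ := by gcongr
  refine he.trans ?_
  rw [Real.exp_neg, one_div]
  exact inv_anti₀ (by norm_num) h1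

lemma norm_stripCurve_arcHeight_le {x : ℝ} (hx : x ∈ Set.Icc (0 : ℝ) 1) :
    ‖stripCurve arcHeight x‖ ≤ 1 / 140 := by
  rw [norm_stripCurve]
  exact norm_exp_le_of_im (sqrt_three_div_two_le_arcHeight hx)

/-- The point of the unit circle with real part `x`. -/
noncomputable def arcPoint (x : ℝ) : ℂ := x + Complex.I * arcHeight x

lemma stripCurve_arcHeight (x : ℝ) :
    stripCurve arcHeight x = Complex.exp (2 * Real.pi * Complex.I * arcPoint x) := rfl

lemma continuous_arcPoint : Continuous arcPoint := by
  have := continuous_arcHeight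
  unfold arcPoint
  fun_prop

lemma arcPoint_re (x : ℝ) : (arcPoint x).re = x := by simp [arcPoint]

lemma arcPoint_im (x : ℝ) : (arcPoint x).im = arcHeight x := by simp [arcPoint]

lemma arcPoint_im_pos {x : ℝ} (hx : x ∈ Set.Icc (0 : ℝ) 1) : 0 < (arcPoint x).im := by
  rw [arcPoint_im]
  exact lt_of_lt_of_le (by positivity) (sqrt_three_div_two_le_arcHeight hx)

lemma arcPoint_eq_exp {x : ℝ} (hx : x ∈ Set.Icc (0 : ℝ) (1 / 2)) :
    arcPoint x = Complex.exp (Complex.I * (2 * (Real.arccos x / 2) : ℝ)) := by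
  rw [mul_div_cancel₀ _ two_ne_zero, mul_comm]
  apply Complex.ext
  · rw [Complex.exp_ofReal_mul_I_re, Real.cos_arccos (by linarith [hx.1]) (by linarith [hx.2]),
      arcPoint_re]
  · rw [Complex.exp_ofReal_mul_I_im, Real.sin_arccos, arcPoint_im, arcHeight_eq hx.2]

lemma half_arccos_bounds {x : ℝ} (hx : x ∈ Set.Icc (0 : ℝ) (1 / 2)) :
    Real.pi / 6 ≤ Real.arccos x / 2 ∧ Real.arccos x / 2 ≤ Real.pi / 4 := by
  have hpi := Real.pi_pos
  have h1 : Real.arccos (1 / 2) = Real.pi / 3 := by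
    rw [← Real.cos_pi_div_three, Real.arccos_cos (by linarith) (by linarith)]
  have h2 := Real.arccos_le_arccos hx.2
  have h3 := Real.arccos_le_arccos hx.1
  rw [h1] at h2
  rw [Real.arccos_zero] at h3
  constructor <;> linarith

lemma arcPoint_half : arcPoint (1 / 2) = corner := by
  apply Complex.ext
  · rw [arcPoint_re, corner_re]
  · rw [arcPoint_im, corner_im, arcHeight_eq le_rfl]
    rw [show (1 - (1 / 2) ^ 2 : ℝ) = 3 / 2 ^ 2 by norm_num, Real.sqrt_div (by norm_num),
      Real.sqrt_sq (by norm_num)]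

lemma arcPoint_zero : arcPoint 0 = Complex.I := by
  simp [arcPoint, arcHeight]

/-- The weighted number of zeros of `𝔾_k` in the closed fundamental domain. -/
def zeroCount (k : ℕ) : ℕ := if k % 12 = 3 ∨ k % 12 = 5 ∨ k % 12 = 11 then k / 6 + 1 else k / 6

lemma neg_I_mul_corner_pow {k : ℕ} (hk6 : k % 6 = 3) :
    (-Complex.I * corner) ^ k = if k % 12 = 3 then -Complex.I else Complex.I := by
  have h1 : (-Complex.I) ^ k = if k % 4 = 3 then Complex.I else -Complex.I := by
    have h4 : (-Complex.I) ^ 4 = 1 := by rw [neg_pow, Complex.I_pow_four]; norm_num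
    rw [← Nat.div_add_mod k 4, pow_add, pow_mul, h4, one_pow, one_mul]
    have : k % 4 = 1 ∨ k % 4 = 3 := by omega
    rcases this with h | h
    · simp [h]
    · simp [h, pow_succ]
  rw [mul_pow, corner_pow hk6, h1]
  have : k % 12 = 3 ∨ k % 12 = 9 := by omega
  rcases this with h | h
  · have h' : k % 4 = 3 := by omega
    simp [h, h']
  · have h' : k % 4 = 1 := by omega
    simp [h, h']

lemma latticeSum_corner_im {k : ℕ} (hk : 3 ≤ k) : (latticeSum k corner).im = 0 :=
  latticeSum_im_of_conj hk corner (conj_exp_of_re_eq_half corner_re)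

/-- A real number times a power of i: the value is purely imaginary, and k mod 12 together with the
sign of the lattice sum decides between the arguments π/2 and -π/2. -/
lemma tsum_normTerm_corner {k : ℕ} (hk : 3 ≤ k) (hk6 : k % 6 = 3) :
    ∑' p, normTerm k corner p =
      (if k % 12 = 3 then -(latticeSum k corner).re else (latticeSum k corner).re : ℝ) * Complex.I := by
  have hre : latticeSum k corner = ((latticeSum k corner).re : ℝ) := by
    apply Complex.ext <;> simp [latticeSum_corner_im hk]
  rw [tsum_normTerm corner.ne_zero, neg_I_mul_corner_pow hk6]
  split_ifs
  · conv_lhs => rw [hre]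
    push_cast; ring
  · conv_lhs => rw [hre]
    ring

lemma tsum_normTerm_mem_slitPlane {k : ℕ} (hk : 9 ≤ k) (hodd : Odd k) {x : ℝ}
    (hx : x ∈ Set.Icc (0 : ℝ) (1 / 2)) : ∑' p, normTerm k (arcPoint x) p ∈ Complex.slitPlane := by
  obtain ⟨hφ1, hφ2⟩ := half_arccos_bounds hx
  have hx1 : x ∈ Set.Icc (0 : ℝ) 1 := ⟨hx.1, by linarith [hx.2]⟩
  let τ : ℍ := ⟨arcPoint x, arcPoint_im_pos hx1⟩
  rw [Complex.mem_slitPlane_iff]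
  rw [Nat.odd_iff] at hodd
  by_cases hk6 : k % 6 = 3
  · rcases hφ1.eq_or_lt with h | h
    · right
      have hτ : arcPoint x = corner := by rw [arcPoint_eq_exp hx, ← h, coe_corner]
      rw [hτ, tsum_normTerm_corner (by omega) hk6]
      have := latticeSum_corner_re_neg hk hk6
      simp only [Complex.im_ofReal_mul, Complex.I_im, mul_one]
      split_ifs <;> linarith
    · left
      refine re_tsum_normTerm_pos_of_mod_six_eq_three hk hk6 h hφ2 τ corner (arcPoint_eq_exp hx)
        coe_corner ?_
      rw [tsum_normTerm_corner (by omega) hk6]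
      simp
  · left
    exact re_tsum_normTerm_pos hk (by omega) hφ1 hφ2 τ (arcPoint_eq_exp hx)

/-- N = a/π + k/6 is an integer and |a| ≤ π/2, which places N within distance less than 1 of j. At k
≡ 3 mod 6 the half-integer k/6 needs the exact value a = ±π/2. -/
lemma count_of_arg {N j k : ℕ} {a : ℝ} (ha : Real.pi * N = a + k * (Real.pi / 6))
    (h : (k % 6 = 1 ∧ |a| < Real.pi / 2 ∧ j = k / 6) ∨ (k % 6 = 5 ∧ |a| < Real.pi / 2 ∧ j = k / 6 + 1) ∨
      (k % 6 = 3 ∧ a = Real.pi / 2 ∧ j = k / 6 + 1) ∨ (k % 6 = 3 ∧ a = -(Real.pi / 2) ∧ j = k / 6)) :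
    N = j := by
  have hpi := Real.pi_pos
  have hk : (k : ℝ) = 6 * (k / 6 : ℕ) + (k % 6 : ℕ) := by exact_mod_cast (Nat.div_add_mod k 6).symm
  obtain ⟨b, rfl⟩ : ∃ b, a = Real.pi * b := ⟨a / Real.pi, by field_simp⟩
  have hN : (N : ℝ) = b + k / 6 := by
    apply mul_left_cancel₀ hpi.ne'
    linear_combination ha
  have habs : |Real.pi * b| < Real.pi / 2 → |b| < 1 / 2 := by
    intro h
    rw [abs_mul, abs_of_pos hpi] at h
    nlinarith
  have key : |(N : ℝ) - j| < 1 → N = j := by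
    intro h
    have h' : |((N : ℤ) : ℝ) - ((j : ℤ) : ℝ)| < 1 := by exact_mod_cast h
    rw [← Int.cast_sub, ← Int.cast_abs] at h'
    have : |(N : ℤ) - j| < 1 := by exact_mod_cast h'
    rw [Int.abs_lt_one_iff] at this
    omega
  apply key
  rcases h with ⟨h6, hb, rfl⟩ | ⟨h6, hb, rfl⟩ | ⟨h6, hb, rfl⟩ | ⟨h6, hb, rfl⟩ <;>
    rw [h6] at hk <;> push_cast at hk ⊢
  · have := abs_lt.1 (habs hb)
    rw [abs_lt]; constructor <;> linarith
  · have := abs_lt.1 (habs hb)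
    rw [abs_lt]; constructor <;> linarith
  · have : b = 1 / 2 := by
      apply mul_left_cancel₀ hpi.ne'
      linarith
    rw [abs_lt]; constructor <;> linarith
  · have : b = -(1 / 2) := by
      apply mul_left_cancel₀ hpi.ne'
      linarith
    rw [abs_lt]; constructor <;> linarith

/-- The assertion that `qSeries (k - 1)` has exactly `zeroCount k` zeros inside the curve
corresponding to the circular arcs, and none on it. -/
def HasZeroCount (k : ℕ) : Prop :=
  (∀ x ∈ Set.Icc (0 : ℝ) 1, qSeries (k - 1) (stripCurve arcHeight x) ≠ 0) ∧
  ∃ (S : Finset ℂ) (n : ℂ → ℕ), (∀ a, a ∈ S ↔ InsideCurve arcHeight a ∧ qSeries (k - 1) a = 0) ∧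
      (∀ a ∈ S, analyticOrderAt (qSeries (k - 1)) a = n a) ∧ ∑ a ∈ S, n a = zeroCount k

lemma continuousOn_qSeries_stripCurve (κ : ℕ) :
    ContinuousOn (fun x ↦ qSeries κ (stripCurve arcHeight x)) (Set.Icc 0 (1 / 2)) := by
  refine (analyticOnNhd_qSeries κ).continuousOn.comp
    (continuousOn_stripCurve continuous_arcHeight.continuousOn) fun x hx ↦ ?_
  rw [mem_ball_zero_iff]
  exact (norm_stripCurve_arcHeight_le ⟨hx.1, by linarith [hx.2]⟩).trans_lt (by norm_num)

lemma hasZeroCount_of_log {k : ℕ} {M : ℝ → ℂ} (hM : ContinuousOn M (Set.Icc 0 (1 / 2)))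
    (hgM : ∀ x ∈ Set.Icc (0 : ℝ) (1 / 2), qSeries (k - 1) (stripCurve arcHeight x) = Complex.exp (M x))
    (hN : ∀ N : ℕ, Real.pi * N = (M (1 / 2)).im - (M 0).im → N = zeroCount k) : HasZeroCount k := by
  obtain ⟨h1, S, n, h2, h3, h4⟩ := count_zeros_of_half_log (R := 1 / 2) (R' := 1) (by norm_num)
    (analyticOnNhd_qSeries (k - 1)) continuous_arcHeight.continuousOn arcHeight_symm
    (fun x hx ↦ (norm_stripCurve_arcHeight_le hx).trans_lt (by norm_num)) (qSeries_conj _) hM hgM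
  exact ⟨h1, S, n, h2, h3, hN _ h4⟩

lemma hasZeroCount_of_nine_le {k : ℕ} (hk : 9 ≤ k) (hodd : Odd k) : HasZeroCount k := by
  have hk3 : 3 ≤ k := by omega
  set K : ℝ := (k - 1).factorial / (2 * Real.pi) ^ k with hK
  have hK0 : 0 < K := latticeConst_pos k
  have hKc : (K : ℂ) ≠ 0 := by exact_mod_cast hK0.ne'
  have hx1 : ∀ x ∈ Set.Icc (0 : ℝ) (1 / 2), x ∈ Set.Icc (0 : ℝ) 1 := fun x hx ↦
    ⟨hx.1, by linarith [hx.2]⟩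
  let v : ℝ → ℂ := fun x ↦ (-Complex.I * arcPoint x) ^ k * ((K : ℂ)⁻¹ * qSeries (k - 1) (stripCurve arcHeight x))
  have hv : ∀ x ∈ Set.Icc (0 : ℝ) (1 / 2), v x = ∑' p, normTerm k (arcPoint x) p := by
    intro x hx
    have hne : arcPoint x ≠ 0 := fun h ↦ by
      have := arcPoint_im_pos (hx1 x hx)
      simp [h] at this
    rw [tsum_normTerm hne]
    have := qSeries_eq_latticeSum hk3 ⟨arcPoint x, arcPoint_im_pos (hx1 x hx)⟩
    simp only [v]
    rw [stripCurve_arcHeight]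
    simp only [] at this
    rw [this, ← hK, ← mul_assoc (K : ℂ)⁻¹, inv_mul_cancel₀ hKc, one_mul, latticeSum]
  have hslit : ∀ x ∈ Set.Icc (0 : ℝ) (1 / 2), v x ∈ Complex.slitPlane := fun x hx ↦ by
    rw [hv x hx]; exact tsum_normTerm_mem_slitPlane hk hodd hx
  have hvc : ContinuousOn v (Set.Icc 0 (1 / 2)) := by
    refine ContinuousOn.mul ?_ (continuousOn_const.mul (continuousOn_qSeries_stripCurve _))
    have := continuous_arcPoint
    fun_prop
  have hslit' : ∀ x ∈ Set.Icc (0 : ℝ) (1 / 2), -Complex.I * arcPoint x ∈ Complex.slitPlane := by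
    intro x hx
    left
    simpa using arcPoint_im_pos (hx1 x hx)
  -- The product v is the normalised lattice sum, so dividing by (-iτ)^k and multiplying by K
  -- recovers the q-series. Both logarithms are principal: v lies in the slit plane, and -iτ has
  -- positive real part.
  refine hasZeroCount_of_log (M := fun x ↦ Complex.log (v x) - k * Complex.log (-Complex.I * arcPoint x) +
    (Real.log K : ℝ)) ?_ ?_ ?_
  · refine ContinuousOn.add (ContinuousOn.sub (hvc.clog hslit) (continuousOn_const.mul
      (ContinuousOn.clog ?_ hslit'))) continuousOn_const
    have := continuous_arcPoint
    fun_prop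
  · intro x hx
    have h1 := Complex.slitPlane_ne_zero (hslit' x hx)
    rw [Complex.exp_add, Complex.exp_sub, Complex.exp_nat_mul, Complex.exp_log h1,
      Complex.exp_log (Complex.slitPlane_ne_zero (hslit x hx)), ← Complex.ofReal_exp, Real.exp_log hK0]
    simp only [v]
    have := pow_ne_zero k h1
    rw [mul_div_cancel_left₀ _ this, mul_comm, mul_inv_cancel_left₀ hKc]
  · intro N hN
    have h0 : (0 : ℝ) ∈ Set.Icc (0 : ℝ) (1 / 2) := by constructor <;> norm_num
    have hh : (1 / 2 : ℝ) ∈ Set.Icc (0 : ℝ) (1 / 2) := by constructor <;> norm_num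
    have harg0 : Complex.arg (v 0) = 0 := by
      rw [Complex.arg_eq_zero_iff]
      have him : (v 0).im = 0 := by
        rw [hv 0 h0, tsum_normTerm (by simp [arcPoint_zero]), arcPoint_zero]
        have := latticeSum_im_of_conj hk3 UpperHalfPlane.I (conj_exp_of_re_eq_zero (by simp))
        simpa using this
      obtain ⟨hφ1, hφ2⟩ := half_arccos_bounds h0
      refine ⟨?_, him⟩
      rcases hslit 0 h0 with h | h
      · exact h.le
      · exact absurd him h
    have hargc : Complex.arg (-Complex.I * corner) = -(Real.pi / 6) := by
      have : -Complex.I * corner = Complex.exp ((-(Real.pi / 6) : ℝ) * Complex.I) := by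
        rw [coe_corner]
        have hI : -Complex.I = Complex.exp (-(Real.pi / 2 * Complex.I)) := by
          rw [Complex.exp_neg, Complex.exp_pi_div_two_mul_I, Complex.inv_I]
        rw [hI, ← Complex.exp_add]
        congr 1
        push_cast
        ring
      have hpi := Real.pi_pos
      rw [this, Complex.arg_exp_mul_I, toIocMod_eq_self]
      constructor <;> linarith
    have him : ∀ z : ℂ, ((k : ℂ) * z).im = k * z.im := by simp
    simp only [Complex.add_im, Complex.sub_im, Complex.log_im, Complex.ofReal_im, harg0,
      him, arcPoint_half, arcPoint_zero, hargc] at hN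
    have hI1 : -Complex.I * Complex.I = 1 := by rw [neg_mul, Complex.I_mul_I, neg_neg]
    rw [hI1, Complex.arg_one] at hN
    refine count_of_arg (k := k) (a := Complex.arg (v (1 / 2))) (by linear_combination hN) ?_
    have hodd' := Nat.odd_iff.1 hodd
    obtain ⟨hφ1, hφ2⟩ := half_arccos_bounds hh
    have hmod : k % 6 = 1 ∨ k % 6 = 5 ∨ k % 6 = 3 := by omega
    rcases hmod with h | h | h
    · refine .inl ⟨h, ?_, by unfold zeroCount; rw [if_neg (by omega)]⟩
      rw [Complex.abs_arg_lt_pi_div_two_iff, hv _ hh]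
      exact .inl (re_tsum_normTerm_pos hk (.inl h) hφ1 hφ2 ⟨arcPoint (1 / 2), arcPoint_im_pos (hx1 _ hh)⟩
        (arcPoint_eq_exp hh))
    · refine .inr (.inl ⟨h, ?_, by unfold zeroCount; rw [if_pos (by omega)]⟩)
      rw [Complex.abs_arg_lt_pi_div_two_iff, hv _ hh]
      exact .inl (re_tsum_normTerm_pos hk (.inr h) hφ1 hφ2 ⟨arcPoint (1 / 2), arcPoint_im_pos (hx1 _ hh)⟩
        (arcPoint_eq_exp hh))
    · have hneg := latticeSum_corner_re_neg hk h
      have hvh := hv _ hh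
      rw [arcPoint_half, tsum_normTerm_corner hk3 h] at hvh
      have h12 : k % 12 = 3 ∨ k % 12 = 9 := by omega
      rcases h12 with h12 | h12
      · refine .inr (.inr (.inl ⟨h, ?_, by unfold zeroCount; rw [if_pos (by omega)]⟩))
        rw [hvh, if_pos h12, Complex.arg_real_mul _ (by linarith), Complex.arg_I]
      · refine .inr (.inr (.inr ⟨h, ?_, by unfold zeroCount; rw [if_neg (by omega)]⟩))
        rw [hvh, if_neg (by omega)]
        have : (((latticeSum k corner).re : ℝ) : ℂ) * Complex.I =
            ((-(latticeSum k corner).re : ℝ) : ℂ) * -Complex.I := by push_cast; ring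
        rw [this, Complex.arg_real_mul _ (by linarith), Complex.arg_neg_I]

/-! ### The number of zeros for k ≤ 7 -/

lemma hasSum_geometric_pnat {r : ℝ} (h0 : 0 ≤ r) (h1 : r < 1) :
    HasSum (fun n : ℕ+ ↦ r ^ ((n : ℕ) - 1)) (1 - r)⁻¹ := by
  rw [← Equiv.pnatEquivNat.symm.hasSum_iff]
  refine (hasSum_geometric_of_lt_one h0 h1).congr_fun fun n ↦ ?_
  simp

/-- Here m ≤ 2^(m - 1) gives m^κ ≤ 64^(m - 1), and mr ≥ 1 + (m - 1) + (r - 1): a product of two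
geometric series. -/
lemma norm_qSeries_term_le {κ : ℕ} (hκ : κ ≤ 6) {q : ℂ} (hq : ‖q‖ ≤ 1) (p : ℕ+ × ℕ+) :
    ‖((p.1 : ℕ) : ℂ) ^ κ * q ^ ((p.1 : ℕ) * (p.2 : ℕ))‖ ≤
      ‖q‖ * ((64 * ‖q‖) ^ ((p.1 : ℕ) - 1) * ‖q‖ ^ ((p.2 : ℕ) - 1)) := by
  obtain ⟨m, r⟩ := p
  obtain ⟨a, ha⟩ : ∃ a : ℕ, (m : ℕ) = a + 1 := ⟨m - 1, by have := m.pos; omega⟩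
  obtain ⟨b, hb⟩ : ∃ b : ℕ, (r : ℕ) = b + 1 := ⟨r - 1, by have := r.pos; omega⟩
  simp only [ha, hb, Nat.add_sub_cancel, norm_mul, norm_pow, Complex.norm_natCast]
  generalize hx : ‖q‖ = x at *
  have hx0 : 0 ≤ x := hx ▸ norm_nonneg q
  have h1 : ((a + 1 : ℕ) : ℝ) ^ κ ≤ 64 ^ a := by
    have e1 : ((a + 1 : ℕ) : ℝ) ^ κ ≤ ((a + 1 : ℕ) : ℝ) ^ 6 := by
      refine pow_le_pow_right₀ ?_ hκ
      push_cast
      linarith [(Nat.cast_nonneg a : (0 : ℝ) ≤ a)]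
    have e2 : ((a + 1 : ℕ) : ℝ) ≤ 2 ^ a := by exact_mod_cast Nat.lt_two_pow_self
    have e3 : ((2 : ℝ) ^ a) ^ 6 = 64 ^ a := by rw [← pow_mul, mul_comm, pow_mul]; norm_num
    exact e1.trans ((pow_le_pow_left₀ (by positivity) e2 6).trans_eq e3)
  have h2 : x ^ ((a + 1) * (b + 1)) ≤ x * x ^ a * x ^ b := by
    rw [← pow_succ', ← pow_add]
    exact pow_le_pow_of_le_one hx0 hq (by nlinarith)
  calc _ ≤ 64 ^ a * (x * x ^ a * x ^ b) := by gcongr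
    _ = _ := by rw [mul_pow]; ring

lemma norm_qSeries_sub_le {κ : ℕ} (hκ : κ ≤ 6) {q : ℂ} (hq : ‖q‖ ≤ 1 / 140) :
    ‖qSeries κ q - q‖ ≤ 9 / 10 * ‖q‖ := by
  have hx0 : 0 ≤ ‖q‖ := norm_nonneg q
  have hs := summable_qSeries κ (q := q) (lt_of_le_of_lt hq (by norm_num))
  have hb := norm_qSeries_term_le hκ (hq.trans (by norm_num : (1 : ℝ) / 140 ≤ 1))
  have g1 := hasSum_geometric_pnat (r := 64 * ‖q‖) (by positivity) (by linarith)
  have g2 := hasSum_geometric_pnat hx0 (by linarith)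
  have g := (g1.mul_of_nonneg_real g2 (fun _ ↦ by positivity) (fun _ ↦ by positivity)).mul_left ‖q‖
  have hbound := norm_tsum_sub_le (1, 1) hs g fun p _ ↦ hb p
  rw [← qSeries, PNat.one_coe, Nat.cast_one, one_pow, one_mul, mul_one, pow_one, Nat.sub_self,
    pow_zero, pow_zero, mul_one, mul_one] at hbound
  refine hbound.trans ?_
  -- At |q| = 1/140 the product is about 1.855. Removing the leading 1 leaves less than 9/10.
  have h5 : (1 - 64 * ‖q‖)⁻¹ * (1 - ‖q‖)⁻¹ ≤ 1.9 := by
    rw [← mul_inv, inv_le_comm₀ (mul_pos (by linarith) (by linarith)) (by norm_num)]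
    norm_num
    nlinarith
  nlinarith

lemma hasZeroCount_of_le_seven {k : ℕ} (hk : 3 ≤ k) (hk7 : k ≤ 7) (hodd : Odd k) : HasZeroCount k := by
  have hx1 : ∀ x ∈ Set.Icc (0 : ℝ) (1 / 2), x ∈ Set.Icc (0 : ℝ) 1 := fun x hx ↦
    ⟨hx.1, by linarith [hx.2]⟩
  let v : ℝ → ℂ := fun x ↦ qSeries (k - 1) (stripCurve arcHeight x) / stripCurve arcHeight x
  have hγ := continuousOn_stripCurve (s := Set.Icc 0 (1 / 2)) continuous_arcHeight.continuousOn
  have hre : ∀ x ∈ Set.Icc (0 : ℝ) (1 / 2), 0 < (v x).re := by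
    intro x hx
    have h0 := stripCurve_ne_zero arcHeight x
    have h1 := norm_qSeries_sub_le (κ := k - 1) (by omega) (norm_stripCurve_arcHeight_le (hx1 x hx))
    have h2 : ‖v x - 1‖ ≤ 9 / 10 := by
      have : v x - 1 = (qSeries (k - 1) (stripCurve arcHeight x) - stripCurve arcHeight x) /
          stripCurve arcHeight x := by
        simp only [v]; field_simp
      rw [this, norm_div, div_le_iff₀ (norm_pos_iff.2 h0)]
      exact h1
    have := (abs_le.1 ((Complex.abs_re_le_norm _).trans h2)).1
    simp at this
    linarith
  have hvc : ContinuousOn v (Set.Icc 0 (1 / 2)) :=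
    (continuousOn_qSeries_stripCurve _).div hγ fun x _ ↦ stripCurve_ne_zero _ x
  have harg : ∀ x ∈ Set.Icc (0 : ℝ) (1 / 2), starRingEnd ℂ (stripCurve arcHeight x) =
      stripCurve arcHeight x → Complex.arg (v x) = 0 := by
    intro x hx h
    rw [Complex.arg_eq_zero_iff]
    refine ⟨(hre x hx).le, ?_⟩
    rw [← Complex.conj_eq_iff_im]
    simp only [v]
    rw [map_div₀, ← qSeries_conj, h]
  refine hasZeroCount_of_log (M := fun x ↦ 2 * Real.pi * Complex.I * arcPoint x + Complex.log (v x)) ?_ ?_ ?_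
  · refine ContinuousOn.add ?_ (hvc.clog fun x hx ↦ .inl (hre x hx))
    have := continuous_arcPoint
    fun_prop
  · intro x hx
    have hv0 : v x ≠ 0 := Complex.slitPlane_ne_zero (.inl (hre x hx))
    rw [Complex.exp_add, Complex.exp_log hv0, ← stripCurve_arcHeight]
    have h0 := stripCurve_ne_zero arcHeight x
    simp only [v]
    field_simp
  · intro N hN
    have h0 : (0 : ℝ) ∈ Set.Icc (0 : ℝ) (1 / 2) := by constructor <;> norm_num
    have hh : (1 / 2 : ℝ) ∈ Set.Icc (0 : ℝ) (1 / 2) := by constructor <;> norm_num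
    have a0 := harg 0 h0 (by
      rw [stripCurve_arcHeight]; exact conj_exp_of_re_eq_zero (arcPoint_re 0))
    have ah := harg (1 / 2) hh (by
      rw [stripCurve_arcHeight]; exact conj_exp_of_re_eq_half (arcPoint_re _))
    simp [a0, ah, arcPoint_re, Complex.log_im, -one_div] at hN
    have hN1 : (N : ℝ) = 1 := by
      apply mul_left_cancel₀ Real.pi_ne_zero
      linarith
    have : N = 1 := by exact_mod_cast hN1
    rw [this]
    have hodd' := Nat.odd_iff.1 hodd
    obtain rfl | rfl | rfl : k = 3 ∨ k = 5 ∨ k = 7 := by omega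
    all_goals rfl

lemma hasZeroCount {k : ℕ} (hk : 3 ≤ k) (hodd : Odd k) : HasZeroCount k := by
  rcases le_or_gt 9 k with h | h
  · exact hasZeroCount_of_nine_le h hodd
  · have := Nat.odd_iff.1 hodd
    exact hasZeroCount_of_le_seven hk (by omega) hodd

/-! ### The line Re τ = 1/2 near the corner: two dominant lattice terms -/

/-- The values of `qSeries (k - 1)` along the line `re τ = 1 / 2`. -/
noncomputable def lineValue (k : ℕ) (t : ℝ) : ℝ :=
  (qSeries (k - 1) (-(Real.exp (-(2 * Real.pi * t)) : ℝ))).re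

lemma coe_lineValue (k : ℕ) (t : ℝ) :
    (lineValue k t : ℂ) = qSeries (k - 1) (-(Real.exp (-(2 * Real.pi * t)) : ℝ)) := by
  rw [lineValue, ← Complex.conj_eq_iff_re, ← qSeries_conj]
  simp only [map_neg, Complex.conj_ofReal]

lemma continuousOn_lineValue (k : ℕ) : ContinuousOn (lineValue k) (Set.Ioi 0) := by
  refine Complex.continuous_re.comp_continuousOn
    ((analyticOnNhd_qSeries (k - 1)).continuousOn.comp (by fun_prop) fun t ht ↦ ?_)
  rw [mem_ball_zero_iff, norm_neg, Complex.norm_real, Real.norm_of_nonneg (Real.exp_pos _).le,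
    Real.exp_lt_one_iff]
  have := Real.pi_pos
  have : 0 < t := ht
  have : 0 < 2 * Real.pi * t := by positivity
  linarith

lemma exp_half_add (τ : ℂ) (h : τ.re = 1 / 2) :
    Complex.exp (2 * Real.pi * Complex.I * τ) = -(Real.exp (-(2 * Real.pi * τ.im)) : ℝ) := by
  have : 2 * Real.pi * Complex.I * τ = ((-(2 * Real.pi * τ.im) : ℝ) : ℂ) + Real.pi * Complex.I := by
    conv_lhs => rw [← Complex.re_add_im τ, h]
    push_cast
    linear_combination (2 * Real.pi * τ.im) * Complex.I_sq
  rw [this, Complex.exp_add, Complex.exp_pi_mul_I, Complex.ofReal_exp]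
  ring

lemma lineValue_eq_latticeSum {k : ℕ} (hk : 3 ≤ k) (τ : ℍ) (h : (τ : ℂ).re = 1 / 2) :
    lineValue k (τ : ℂ).im =
      ((k - 1).factorial / (2 * Real.pi) ^ k : ℝ) * (latticeSum k τ).re := by
  rw [lineValue, ← exp_half_add _ h, qSeries_eq_latticeSum hk, Complex.re_ofReal_mul, latticeSum]

/-- Dividing by |τ|² = T flattens the lattice form Q to 1 + (Q - 1)/T. Bernoulli with exponent T
undoes this at the cost of T of the available powers, and 9T ≤ k leaves the exponent 9 for which the
majorant was built. -/
lemma sqrt_pow_nine_le_of_bernoulli {Q T r : ℝ} {k : ℕ} (hQ : 1 ≤ Q) (hT : 1 ≤ T) (hr : 0 ≤ r)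
    (hk : 9 * T ≤ k) (h : 1 + (Q - 1) / T ≤ r ^ 2) : √Q ^ 9 ≤ r ^ k := by
  have hT0 : 0 < T := by linarith
  have hq : 0 ≤ (Q - 1) / T := div_nonneg (by linarith) hT0.le
  have hr1 : 1 ≤ r := by nlinarith
  have h1 : Q ≤ (r ^ 2) ^ T := by
    calc Q = 1 + T * ((Q - 1) / T) := by field_simp; ring
      _ ≤ (1 + (Q - 1) / T) ^ T := one_add_mul_self_le_rpow_one_add (by linarith) hT
      _ ≤ _ := Real.rpow_le_rpow (by linarith) h hT0.le
  have h2 : √Q ≤ r ^ T := by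
    refine Real.sqrt_le_iff.2 ⟨by positivity, h1.trans_eq ?_⟩
    rw [← Real.rpow_natCast, ← Real.rpow_mul hr, ← Real.rpow_natCast (r ^ T), ← Real.rpow_mul hr, mul_comm]
  calc √Q ^ 9 ≤ (r ^ T) ^ 9 := pow_le_pow_left₀ (Real.sqrt_nonneg _) h2 9
    _ = r ^ (9 * T) := by
      rw [← Real.rpow_natCast, ← Real.rpow_mul hr, mul_comm]
      norm_num
    _ ≤ r ^ (k : ℝ) := Real.rpow_le_rpow_of_exponent_le hr1 hk
    _ = r ^ k := Real.rpow_natCast _ _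

/-- On the line `re τ = 1 / 2`, not too far up, the lattice sum is dominated by two terms. -/
lemma abs_latticeSum_sub_two_cos_le {k : ℕ} (hk : 9 ≤ k) {α : ℝ} (hα0 : 0 < α)
    (hα : α ≤ Real.pi / 6) (hkα : 9 ≤ k * (2 * Real.sin α) ^ 2) (τ : ℍ)
    (hre : (τ : ℂ).re = 1 / 2) (him : (τ : ℂ).im = (2 * Real.tan α)⁻¹) :
    |((2 * Real.sin α)⁻¹ ^ k) * (latticeSum k τ).re - 2 * Real.cos (k * α)| ≤ 11 / 50 := by
  have hpi := Real.pi_pos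
  have hs : 0 < Real.sin α := Real.sin_pos_of_pos_of_lt_pi hα0 (by linarith)
  have hs2 : Real.sin α ≤ 1 / 2 := by
    rw [← Real.sin_pi_div_six]
    exact Real.sin_le_sin_of_le_of_le_pi_div_two (by linarith) (by linarith) hα
  have hcos : 0 < Real.cos α := Real.cos_pos_of_mem_Ioo ⟨by linarith, by linarith⟩
  set ρ := (2 * Real.sin α)⁻¹ with hρ
  have hρ0 : 0 < ρ := by positivity
  have hρ1 : 1 ≤ ρ := by
    rw [hρ]; exact (one_le_inv₀ (by positivity)).2 (by linarith)
  have him' : (τ : ℂ).im = ρ * Real.cos α := by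
    rw [him, hρ, Real.tan_eq_sin_div_cos]; field_simp
  have hre' : (τ : ℂ).re = ρ * Real.sin α := by rw [hre, hρ]; field_simp
  have hnormsq : (τ : ℂ).im ^ 2 = ρ ^ 2 - 1 / 4 := by
    have h1 : ρ * Real.sin α = 1 / 2 := by rw [← hre', hre]
    rw [him', mul_pow, Real.cos_sq']
    linear_combination (-(ρ * Real.sin α) - 1 / 2) * h1
  have hkT : 9 * ρ ^ 2 ≤ k := by
    rw [hρ, inv_pow, ← div_eq_mul_inv, div_le_iff₀ (by positivity)]
    exact hkα
  have hbound : ∀ p ∉ mainIndices, ‖((ρ ^ k : ℝ) : ℂ) * latticeTerm k τ p‖ ≤ 1 * latticeMajorant p := by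
    intro p hp
    have hQ := (latticeForm_bounds p).1
    -- With |τ| = ρ and Re τ = 1/2, |cτ + d|² = c²ρ² + cd + d², and (c² - 1)(ρ² - 1) ≥ 0.
    have hr2 : 1 + (latticeForm p - 1) / ρ ^ 2 ≤ (‖((p.1 : ℕ) : ℂ) * τ + p.2‖ / ρ) ^ 2 := by
      rw [div_pow, ← sub_nonneg, show ‖((p.1 : ℕ) : ℂ) * τ + p.2‖ ^ 2 / ρ ^ 2 -
        (1 + (latticeForm p - 1) / ρ ^ 2) =
        (‖((p.1 : ℕ) : ℂ) * τ + p.2‖ ^ 2 - (ρ ^ 2 + latticeForm p - 1)) / ρ ^ 2 by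
          field_simp; ring]
      refine div_nonneg ?_ (by positivity)
      rw [Complex.sq_norm, Complex.normSq_apply]
      have hc : 1 ≤ ((p.1 : ℕ) : ℝ) := by exact_mod_cast p.1.pos
      simp only [Complex.add_re, Complex.add_im, Complex.intCast_re,
        Complex.intCast_im, latticeForm]
      have e1 : (((p.1 : ℕ) : ℂ) * (τ : ℂ)).re = ((p.1 : ℕ) : ℝ) * (1 / 2) := by
        simp [hre, -coe_re, -coe_im]
      have e2 : (((p.1 : ℕ) : ℂ) * (τ : ℂ)).im = ((p.1 : ℕ) : ℝ) * (τ : ℂ).im := by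
        simp [-coe_re, -coe_im]
      rw [e1, e2]
      have h3 := min_le_left (((p.1 : ℕ) : ℝ) * (p.2 : ℝ)) 0
      have h4 : 1 ≤ ρ ^ 2 := one_le_pow₀ hρ1
      have h5 : 1 ≤ ((p.1 : ℕ) : ℝ) ^ 2 := one_le_pow₀ hc
      have h6 : 0 ≤ (((p.1 : ℕ) : ℝ) ^ 2 - 1) * (ρ ^ 2 - 1) :=
        mul_nonneg (by linarith) (by linarith)
      have h7 : ((p.1 : ℕ) : ℝ) * (τ : ℂ).im * (((p.1 : ℕ) : ℝ) * (τ : ℂ).im) =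
        ((p.1 : ℕ) : ℝ) ^ 2 * (ρ ^ 2 - 1 / 4) := by rw [← hnormsq]; ring
      rw [add_zero, h7]
      nlinarith
    have key := sqrt_pow_nine_le_of_bernoulli hQ (one_le_pow₀ hρ1) (by positivity) hkT hr2
    rw [one_mul, norm_mul, norm_latticeTerm, Complex.norm_real, Real.norm_of_nonneg (by positivity)]
    refine le_trans (le_trans (le_of_eq ?_) (inv_anti₀ ?_ key))
      (inv_pow_nine_le_latticeMajorant hp (Real.sqrt_nonneg _) (Real.sq_sqrt (by linarith)).ge)
    · rw [div_pow, inv_div, div_eq_mul_inv]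
    · have := one_le_sqrt_latticeForm p
      positivity
  have main := norm_tsum_sub_main_le zero_le_one
    ((summable_latticeTerm (by omega : 3 ≤ k) τ).mul_left ((ρ ^ k : ℝ) : ℂ)) hbound
  -- The angle α is measured from the imaginary axis; τ and τ - 1 are mirror images in it, so the
  -- two main terms are conjugate and add up to 2 cos(kα).
  have hI : -Complex.I * (τ : ℂ) = ρ * Complex.exp ((-α : ℝ) * Complex.I) := by
    apply Complex.ext
    · rw [Complex.re_ofReal_mul, Complex.exp_ofReal_mul_I_re, Real.cos_neg, ← him']
      simp
    · rw [Complex.im_ofReal_mul, Complex.exp_ofReal_mul_I_im, Real.sin_neg, mul_neg, ← hre']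
      simp
  have hI' : -Complex.I * ((τ : ℂ) - 1) = ρ * Complex.exp ((α : ℝ) * Complex.I) := by
    apply Complex.ext
    · rw [Complex.re_ofReal_mul, Complex.exp_ofReal_mul_I_re, ← him']
      simp
    · rw [Complex.im_ofReal_mul, Complex.exp_ofReal_mul_I_im, ← hre', hre]
      have := hre
      simp [-coe_re, -coe_im, this]
      norm_num
  have hρc : (ρ : ℂ) ≠ 0 := by exact_mod_cast hρ0.ne'
  have t0 : ((ρ ^ k : ℝ) : ℂ) * latticeTerm k τ (1, 0) = Complex.exp ((k * α : ℝ) * Complex.I) := by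
    rw [latticeTerm]
    have : -Complex.I * ((((1 : ℕ+) : ℕ) : ℂ) * τ + (0 : ℤ)) = -Complex.I * τ := by push_cast; ring
    rw [this, hI, mul_pow, mul_inv, Complex.ofReal_pow, mul_inv_cancel_left₀ (pow_ne_zero _ hρc),
      ← Complex.exp_nat_mul, ← Complex.exp_neg]
    congr 1
    push_cast
    ring
  have t1 : ((ρ ^ k : ℝ) : ℂ) * latticeTerm k τ (1, -1) = Complex.exp ((-(k * α) : ℝ) * Complex.I) := by
    rw [latticeTerm]
    have : -Complex.I * ((((1 : ℕ+) : ℕ) : ℂ) * τ + (-1 : ℤ)) = -Complex.I * (τ - 1) := by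
      push_cast; ring
    rw [this, hI', mul_pow, mul_inv, Complex.ofReal_pow, mul_inv_cancel_left₀ (pow_ne_zero _ hρc),
      ← Complex.exp_nat_mul, ← Complex.exp_neg]
    congr 1
    push_cast
    ring
  rw [t0, t1, tsum_mul_left, ← latticeSum] at main
  have h := (Complex.abs_re_le_norm _).trans main
  rw [Complex.sub_re, Complex.add_re, Complex.re_ofReal_mul, Complex.exp_ofReal_mul_I_re,
    Complex.exp_ofReal_mul_I_re, Real.cos_neg, ← two_mul, one_mul] at h
  exact h

/-! ### The line Re τ = 1/2 high up: one dominant term of the q-series -/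

theorem Real.one_add_le_exp_sub_sq_div_three {u : ℝ} (h0 : 0 ≤ u) (h1 : u ≤ 1 / 2) :
    1 + u ≤ Real.exp (u - u ^ 2 / 3) := by
  refine le_trans ?_ (Real.quadratic_le_exp_of_nonneg (by nlinarith))
  nlinarith [mul_nonneg (sq_nonneg u) (by linarith : 0 ≤ 1 / 2 - u), sq_nonneg (u ^ 2)]

theorem Real.one_sub_le_exp_neg_sub_sq_div_two {u : ℝ} (h0 : 0 ≤ u) (h1 : u < 1) :
    1 - u ≤ Real.exp (-u - u ^ 2 / 2) := by
  have h := sum_le_hasSum (Finset.range 2) (fun i _ ↦ by positivity)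
    (Real.hasSum_pow_div_log_of_abs_lt_one (abs_lt.2 ⟨by linarith, h1⟩))
  rw [Finset.sum_range_succ, Finset.sum_range_one] at h
  rw [← Real.log_le_iff_le_exp (by linarith)]
  norm_num at h
  linarith

/-- The ratio `((1 + 1/m) e^(-1/m))^κ` of the terms next to the largest one. -/
noncomputable def upperRatio (κ m : ℕ) : ℝ := ((1 + 1 / m) * Real.exp (-(1 / m))) ^ κ

/-- The ratio `((1 - 1/m) e^(1/m))^κ` of the terms next to the largest one. -/
noncomputable def lowerRatio (κ m : ℕ) : ℝ := ((1 - 1 / m) * Real.exp (1 / m)) ^ κ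

theorem upperRatio_nonneg (κ m : ℕ) : 0 ≤ upperRatio κ m := by unfold upperRatio; positivity

theorem one_sub_inv_natCast_nonneg {m : ℕ} : (0 : ℝ) ≤ 1 - 1 / m := by
  rcases Nat.eq_zero_or_pos m with rfl | h
  · simp
  · have : (1 : ℝ) ≤ m := by exact_mod_cast h
    rw [sub_nonneg, div_le_one (by linarith)]; exact this

theorem lowerRatio_nonneg (κ m : ℕ) : 0 ≤ lowerRatio κ m := by
  unfold lowerRatio
  have := one_sub_inv_natCast_nonneg (m := m)
  positivity

theorem upperRatio_le {κ m : ℕ} (hκ : 8 ≤ κ) (hm : 1 ≤ m) (h : 7 * m ^ 2 ≤ 2 * κ + 1) :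
    upperRatio κ m ≤ 1 / 3 := by
  have he := Real.exp_one_gt_d9
  unfold upperRatio
  rcases hm.eq_or_lt with rfl | hm
  · have h1 : (1 + 1 / ((1 : ℕ) : ℝ)) * Real.exp (-(1 / ((1 : ℕ) : ℝ))) ≤ 3 / 4 := by
      norm_num [Real.exp_neg]
      rw [← div_eq_mul_inv, div_le_iff₀ (by positivity)]
      linarith
    calc _ ≤ (3 / 4 : ℝ) ^ κ := pow_le_pow_left₀ (by positivity) h1 _
      _ ≤ (3 / 4) ^ 8 := pow_le_pow_of_le_one (by norm_num) (by norm_num) hκ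
      _ ≤ _ := by norm_num
  · have hm' : (2 : ℝ) ≤ m := by exact_mod_cast hm
    have h' : 7 * (m : ℝ) ^ 2 ≤ 2 * κ + 1 := by exact_mod_cast h
    have hu : 1 / (m : ℝ) ≤ 1 / 2 := by gcongr
    have h1 : (1 + 1 / (m : ℝ)) * Real.exp (-(1 / m)) ≤ Real.exp (-(1 / m) ^ 2 / 3) := by
      refine (mul_le_mul_of_nonneg_right (Real.one_add_le_exp_sub_sq_div_three
        (by positivity) hu) (Real.exp_pos _).le).trans (le_of_eq ?_)
      rw [← Real.exp_add]; ring_nf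
    refine (pow_le_pow_left₀ (by positivity) h1 _).trans ?_
    rw [← Real.exp_nat_mul]
    -- From 7m² ≤ 2κ + 1 and m ≥ 2: κ/m² ≥ 7/2 - 1/8.
    have h2 : (27 / 8 : ℝ) ≤ κ * (1 / m) ^ 2 := by
      rw [div_pow, one_pow, mul_one_div, le_div_iff₀ (by positivity)]
      nlinarith
    calc _ ≤ Real.exp (-(1 + 1 / 8)) := Real.exp_le_exp.2 (by linarith)
      _ ≤ _ := by
        rw [Real.exp_neg, Real.exp_add, one_div (3 : ℝ)]
        have := Real.add_one_le_exp (1 / 8 : ℝ)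
        exact inv_anti₀ three_pos (by nlinarith)

theorem lowerRatio_le {κ m : ℕ} (hκ : 8 ≤ κ) (hm : 1 ≤ m) (h : 7 * m ^ 2 ≤ 2 * κ + 1) :
    lowerRatio κ m ≤ 1 / 5 := by
  have he := Real.exp_one_gt_d9
  unfold lowerRatio
  rcases hm.eq_or_lt with rfl | hm
  · have : κ ≠ 0 := by omega
    norm_num [this]
  · have hm' : (2 : ℝ) ≤ m := by exact_mod_cast hm
    have h' : 7 * (m : ℝ) ^ 2 ≤ 2 * κ + 1 := by exact_mod_cast h
    have hu : 1 / (m : ℝ) ≤ 1 / 2 := by gcongr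
    have h1 : (1 - 1 / (m : ℝ)) * Real.exp (1 / m) ≤ Real.exp (-(1 / m) ^ 2 / 2) := by
      refine (mul_le_mul_of_nonneg_right (Real.one_sub_le_exp_neg_sub_sq_div_two
        (by positivity) (by linarith)) (Real.exp_pos _).le).trans (le_of_eq ?_)
      rw [← Real.exp_add]; ring_nf
    refine (pow_le_pow_left₀ (mul_nonneg one_sub_inv_natCast_nonneg (Real.exp_pos _).le)
      h1 _).trans ?_
    rw [← Real.exp_nat_mul]
    have h2 : (27 / 8 : ℝ) ≤ κ * (1 / m) ^ 2 := by
      rw [div_pow, one_pow, mul_one_div, le_div_iff₀ (by positivity)]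
      nlinarith
    calc _ ≤ Real.exp (-(1 + 11 / 16)) := Real.exp_le_exp.2 (by linarith)
      _ ≤ _ := by
        rw [Real.exp_neg, Real.exp_add, one_div]
        have := Real.quadratic_le_exp_of_nonneg (by norm_num : (0 : ℝ) ≤ 11 / 16)
        exact inv_anti₀ (by norm_num) (by nlinarith)

/-- The two-sided geometric majorant of the relative size of the terms with `r = 1`. -/
noncomputable def twoSidedMajorant (κ m : ℕ) : ℤ → ℝ
  | Int.ofNat j => upperRatio κ m ^ j
  | Int.negSucc j => lowerRatio κ m ^ (j + 1)

theorem twoSidedMajorant_nonneg (κ m : ℕ) (j : ℤ) : 0 ≤ twoSidedMajorant κ m j := by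
  rcases j with j | j
  · exact pow_nonneg (upperRatio_nonneg κ m) _
  · exact pow_nonneg (lowerRatio_nonneg κ m) _

theorem hasSum_twoSidedMajorant {κ m : ℕ} (hκ : 8 ≤ κ) (hm : 1 ≤ m)
    (h : 7 * m ^ 2 ≤ 2 * κ + 1) :
    ∃ z ≤ (7 / 4 : ℝ), HasSum (fun n : ℕ+ ↦ twoSidedMajorant κ m ((n : ℕ) - m)) z := by
  have hx0 := upperRatio_nonneg κ m
  have hy0 := lowerRatio_nonneg κ m
  have hx := upperRatio_le hκ hm h
  have hy := lowerRatio_le hκ hm h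
  have h1 : HasSum (fun j : ℕ ↦ twoSidedMajorant κ m j) (1 - upperRatio κ m)⁻¹ :=
    hasSum_geometric_of_lt_one hx0 (by linarith)
  have h2 : HasSum (fun j : ℕ ↦ twoSidedMajorant κ m (-(j + 1 : ℤ)))
      (lowerRatio κ m * (1 - lowerRatio κ m)⁻¹) := by
    refine ((hasSum_geometric_of_lt_one hy0 (by linarith)).mul_left (lowerRatio κ m)).congr_fun
      fun j ↦ ?_
    rw [show -((j : ℤ) + 1) = Int.negSucc j by rw [Int.negSucc_eq]]
    exact pow_succ' _ _
  have h3 := HasSum.of_nat_of_neg_add_one h1 h2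
  have hinj : Function.Injective (fun n : ℕ+ ↦ ((n : ℕ) : ℤ) - m) := by
    intro a b hab
    simpa using hab
  refine ⟨_, ?_, (h3.summable.comp_injective hinj).hasSum⟩
  refine (tsum_comp_le_tsum_of_inj h3.summable (twoSidedMajorant_nonneg κ m) hinj).trans ?_
  rw [h3.tsum_eq]
  have e1 : (1 - upperRatio κ m)⁻¹ ≤ 3 / 2 := by
    rw [inv_le_comm₀ (by linarith) (by norm_num)]; linarith
  have e2 : lowerRatio κ m * (1 - lowerRatio κ m)⁻¹ ≤ 1 / 4 := by
    rw [← div_eq_mul_inv, div_le_iff₀ (by linarith)]; linarith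
  linarith

/-- The exponential factor is exactly geometric in n - m, and Bernoulli bounds the linear factor 1 +
j/m by (1 + 1/m)^j, for either sign of the increment. -/
theorem relativeTerm_one_le {κ m : ℕ} (hm : 1 ≤ m) (n : ℕ+) :
    ((n : ℕ) / m * Real.exp (1 - (n : ℕ) / m)) ^ κ ≤ twoSidedMajorant κ m ((n : ℕ) - m) := by
  have hm' : (1 : ℝ) ≤ m := by exact_mod_cast hm
  rcases le_or_gt m n with hmn | hmn
  · obtain ⟨j, hj⟩ := Nat.exists_eq_add_of_le hmn
    have e : ((n : ℕ) : ℤ) - m = Int.ofNat j := by rw [hj]; simp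
    rw [e]
    change _ ≤ upperRatio κ m ^ j
    rw [upperRatio, ← pow_mul, mul_comm κ, pow_mul]
    refine pow_le_pow_left₀ (by positivity) ?_ _
    rw [mul_pow, ← Real.exp_nat_mul, hj]
    refine mul_le_mul ?_ (le_of_eq ?_) (Real.exp_pos _).le (by positivity)
    · refine le_trans (le_of_eq ?_) (one_add_mul_le_pow (a := 1 / (m : ℝ)) ?_ j)
      · push_cast; field_simp
      · have : 0 ≤ 1 / (m : ℝ) := by positivity
        linarith
    · congr 1; push_cast; field_simp; ring
  · obtain ⟨j, hj⟩ := Nat.exists_eq_add_of_lt hmn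
    have e : ((n : ℕ) : ℤ) - m = Int.negSucc j := by rw [hj, Int.negSucc_eq]; push_cast; ring
    have hj' : ((n : ℕ) : ℝ) = m - (j + 1) := by rw [hj]; push_cast; ring
    rw [e]
    change _ ≤ lowerRatio κ m ^ (j + 1)
    rw [lowerRatio, ← pow_mul, mul_comm κ, pow_mul]
    refine pow_le_pow_left₀ (by positivity) ?_ _
    rw [mul_pow, ← Real.exp_nat_mul, hj']
    refine mul_le_mul ?_ (le_of_eq ?_) (Real.exp_pos _).le
      (pow_nonneg one_sub_inv_natCast_nonneg _)
    · refine le_trans (le_of_eq ?_) (one_add_mul_le_pow (a := -(1 / (m : ℝ))) ?_ (j + 1)) |>.trans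
        (le_of_eq ?_)
      · push_cast; field_simp; ring
      · have : 1 / (m : ℝ) ≤ 1 := by rw [div_le_one (by linarith)]; exact hm'
        linarith
      · ring
    · congr 1; push_cast; field_simp; ring

theorem mul_exp_one_sub_pow_le {κ : ℕ} (hκ : 1 ≤ κ) {v : ℝ} (hv : 0 ≤ v) :
    (v * Real.exp (1 - v)) ^ κ ≤ 2 * Real.exp (-(v / 2)) := by
  have h1 : v * Real.exp (1 - v) ≤ 1 := by
    have := Real.add_one_le_exp (v - 1)
    rw [show 1 - v = -(v - 1) by ring, Real.exp_neg, ← div_eq_mul_inv, div_le_one (by positivity)]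
    linarith
  refine (pow_le_of_le_one (by positivity) h1 (by omega)).trans ?_
  have h2 : v / 2 ≤ Real.exp (v / 2 - 1) := by
    have := Real.add_one_le_exp (v / 2 - 1)
    linarith
  calc v * Real.exp (1 - v) ≤ 2 * Real.exp (v / 2 - 1) * Real.exp (1 - v) := by gcongr; linarith
    _ = _ := by rw [mul_assoc, ← Real.exp_add]; ring_nf

theorem hasSum_inv_cube_ge_two :
    ∃ z ≤ (1 / 4 : ℝ), HasSum (fun r : ℕ+ ↦ if r = 1 then (0 : ℝ) else (((r : ℕ) : ℝ) ^ 3)⁻¹) z := by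
  obtain ⟨z, hz, h⟩ := hasSum_inv_cube
  have h' : HasSum (fun r : ℕ+ ↦ (((r : ℕ) : ℝ) ^ 3)⁻¹) z := by
    rw [← Equiv.pnatEquivNat.symm.hasSum_iff]
    convert h using 2 with n
    simp
  refine ⟨z - 1, by linarith, ?_⟩
  refine (h'.sub (hasSum_ite_eq (1 : ℕ+) (1 : ℝ))).congr_fun fun r ↦ ?_
  split_ifs with hr
  · simp [hr]
  · simp

theorem hasSum_exp_neg_div {m : ℕ} (hm : 1 ≤ m) :
    ∃ z ≤ (m : ℝ), HasSum (fun n : ℕ+ ↦ Real.exp (-(((n : ℕ) : ℝ) / m))) z := by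
  have hm' : (0 : ℝ) < m := by exact_mod_cast hm
  set r := Real.exp (-(1 / (m : ℝ))) with hr
  have hr1 : r < 1 := by rw [hr, Real.exp_lt_one_iff]; simpa using hm'
  refine ⟨r * (1 - r)⁻¹, ?_, ?_⟩
  · rw [← div_eq_mul_inv, div_le_iff₀ (by linarith)]
    have h1 : (1 + 1 / (m : ℝ)) * r ≤ 1 := by
      rw [hr, Real.exp_neg, ← div_eq_mul_inv, div_le_one (by positivity)]
      linarith [Real.add_one_le_exp (1 / (m : ℝ))]
    have h2 := mul_le_mul_of_nonneg_left h1 hm'.le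
    have h3 : (m : ℝ) * ((1 + 1 / (m : ℝ)) * r) = m * r + r := by field_simp
    linarith
  · refine ((hasSum_geometric_pnat (Real.exp_pos _).le hr1).mul_left r).congr_fun fun n ↦ ?_
    rw [← pow_succ', Nat.sub_add_cancel n.pos, hr, ← Real.exp_nat_mul]
    congr 1; ring

/-- Writing n/m = v/r with v = nr/m, the factor v·exp(1 - v) never exceeds 1, and (1/r)^κ makes all
terms with r ≥ 2 tiny while keeping 1/r³ for convergence. -/
theorem relativeTerm_le {κ m : ℕ} (hκ : 3 ≤ κ) (hm : 1 ≤ m) (n : ℕ+) {r : ℕ} (hr : 2 ≤ r) :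
    ((n : ℕ) / m * Real.exp (1 - (n : ℕ) * r / m)) ^ κ ≤
      Real.exp (-(((n : ℕ) : ℝ) / m)) * (2 * (1 / 2) ^ (κ - 3) * ((r : ℝ) ^ 3)⁻¹) := by
  have hm' : (0 : ℝ) < m := by exact_mod_cast hm
  have hr' : (2 : ℝ) ≤ r := by exact_mod_cast hr
  have h1 := mul_exp_one_sub_pow_le (by omega : 1 ≤ κ) (v := (n : ℕ) * r / m) (by positivity)
  have h2 : ((n : ℕ) / m * Real.exp (1 - (n : ℕ) * r / m)) ^ κ =
      ((n : ℕ) * r / m * Real.exp (1 - (n : ℕ) * r / m)) ^ κ * ((1 / (r : ℝ)) ^ (κ - 3) * (1 / r) ^ 3) := by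
    rw [← pow_add, Nat.sub_add_cancel hκ, ← mul_pow]
    congr 1; field_simp
  rw [h2]
  calc _ ≤ (2 * Real.exp (-((n : ℕ) / m))) * ((1 / 2) ^ (κ - 3) * (1 / (r : ℝ)) ^ 3) := by
        refine mul_le_mul (h1.trans ?_) ?_ (by positivity) (by positivity)
        · have : ((n : ℕ) : ℝ) / m ≤ (n : ℕ) * r / m / 2 := by
            rw [div_div, div_le_div_iff₀ hm' (by positivity)]
            nlinarith [mul_nonneg (mul_nonneg n.val.cast_nonneg hm'.le) (by linarith : (0:ℝ) ≤ r - 2)]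
          gcongr
        · gcongr
    _ = _ := by rw [one_div_pow _ 3, one_div]; ring

/-- At |q| = exp(-κ/m) the function x^κ|q|^x peaks at x = m, so the term with first index m and r =
1 dominates; q < 0 gives it the sign (-1)^m. The error is (7/4 - 1) from r = 1 and 1/8 from r ≥ 2.
-/
theorem norm_qSeries_neg_exp_sub_le {κ m : ℕ} (hκ : 8 ≤ κ) (hm : 1 ≤ m)
    (h : 7 * m ^ 2 ≤ 2 * κ + 1) :
    ‖(((Real.exp 1 / m) ^ κ : ℝ) : ℂ) * qSeries κ (-(Real.exp (-(κ / m)) : ℝ)) - (-1) ^ m‖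
      ≤ 7 / 8 := by
  have hm' : (0 : ℝ) < m := by exact_mod_cast hm
  have hκ' : (8 : ℝ) ≤ κ := by exact_mod_cast hκ
  obtain ⟨z₁, hz₁, hs₁⟩ := hasSum_twoSidedMajorant hκ hm h
  obtain ⟨z₂, hz₂, hs₂⟩ := hasSum_exp_neg_div hm
  obtain ⟨z₃, hz₃, hs₃⟩ := hasSum_inv_cube_ge_two
  have hz₃0 : 0 ≤ z₃ := hs₃.nonneg fun r ↦ by split_ifs <;> positivity
  set c : ℝ := 2 * (1 / 2) ^ (κ - 3) with hc
  have hsum := (hs₁.mul_of_nonneg_real (hasSum_ite_eq (1 : ℕ+) (1 : ℝ))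
    (fun n ↦ twoSidedMajorant_nonneg κ m _) (fun r ↦ by split_ifs <;> norm_num)).add
    (hs₂.mul_of_nonneg_real (hs₃.mul_left c) (fun n ↦ (Real.exp_pos _).le)
      (fun r ↦ by split_ifs <;> positivity))
  set q : ℂ := -(Real.exp (-(κ / m)) : ℝ) with hq
  have hqn : ‖q‖ = Real.exp (-(κ / m)) := by
    rw [hq, norm_neg, Complex.norm_real, Real.norm_of_nonneg (Real.exp_pos _).le]
  have hq1 : ‖q‖ < 1 := by
    rw [hqn, Real.exp_lt_one_iff, neg_lt_zero]; positivity
  set F : ℕ+ × ℕ+ → ℂ := fun p ↦ (((Real.exp 1 / m) ^ κ : ℝ) : ℂ) *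
    (((p.1 : ℕ) : ℂ) ^ κ * q ^ ((p.1 : ℕ) * (p.2 : ℕ))) with hF
  have hnorm (p : ℕ+ × ℕ+) :
      ‖F p‖ = ((p.1 : ℕ) / m * Real.exp (1 - (p.1 : ℕ) * (p.2 : ℕ) / m)) ^ κ := by
    rw [hF]
    simp only [norm_mul, norm_pow, hqn, Complex.norm_real, Complex.norm_natCast]
    rw [Real.norm_of_nonneg (by positivity), ← Real.exp_nat_mul, mul_pow, ← Real.exp_nat_mul,
      div_pow, div_pow, ← Real.exp_nat_mul]
    rw [show (κ : ℝ) * (1 - (p.1 : ℕ) * (p.2 : ℕ) / m) = κ * 1 + ((p.1 : ℕ) * (p.2 : ℕ) : ℕ) * (-(κ / m))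
      by push_cast; ring, Real.exp_add]
    ring
  have hFs : Summable F := (summable_qSeries κ hq1).mul_left _
  have key := norm_tsum_sub_le (⟨m, hm⟩, 1) hFs hsum (by
    rintro ⟨n, r⟩ -
    rw [hnorm]
    rcases eq_or_ne r 1 with rfl | hr
    · have := relativeTerm_one_le (κ := κ) hm n
      simpa using this
    · have hr2 : 2 ≤ (r : ℕ) := by
        have : (r : ℕ) ≠ 1 := fun h ↦ hr (PNat.coe_injective h)
        have := r.pos
        omega
      have := relativeTerm_le (by omega : 3 ≤ κ) hm n hr2
      simpa only [hr, if_false, mul_zero, zero_add] using this)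
  have hFm : F (⟨m, hm⟩, 1) = (-1) ^ m := by
    simp only [hF, PNat.mk_coe, PNat.one_coe, mul_one, hq]
    rw [neg_pow, ← Complex.ofReal_pow, ← Real.exp_nat_mul, div_pow, ← Real.exp_nat_mul]
    have e : (m : ℝ) * (-(κ / m)) = -(κ * 1) := by field_simp
    rw [e, Real.exp_neg]
    have : (Real.exp (κ * 1) : ℂ) ≠ 0 := by exact_mod_cast (Real.exp_pos _).ne'
    have : (m : ℂ) ≠ 0 := by exact_mod_cast hm'.ne'
    push_cast
    field_simp
  rw [hFm, hF, tsum_mul_left] at key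
  refine key.trans ?_
  have h0 : twoSidedMajorant κ m 0 = 1 := pow_zero _
  simp only [PNat.mk_coe, sub_self, h0, if_true, mul_zero, mul_one, add_zero]
  have hmκ : m ≤ κ := by nlinarith
  -- Equality holds at κ = 8; this makes c·m ≤ 1/2.
  have hpow : κ ≤ 2 ^ (κ - 5) := by
    clear_value c
    clear * - hκ
    induction κ, hκ using Nat.le_induction with
    | base => norm_num
    | succ n hn ih => rw [show n + 1 - 5 = (n - 5) + 1 by omega, pow_succ]; omega
  have hcm : c * m ≤ 1 / 2 := by
    have e : (m : ℝ) ≤ 2 ^ (κ - 5) := by exact_mod_cast hmκ.trans hpow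
    rw [hc, show κ - 3 = (κ - 5) + 2 by omega, pow_add, one_div_pow]
    have : (0 : ℝ) < 2 ^ (κ - 5) := by positivity
    rw [show 2 * (1 / 2 ^ (κ - 5) * (1 / 2) ^ 2) * (m : ℝ) = (1 / 2) * (m / 2 ^ (κ - 5)) by ring]
    have := (div_le_one this).2 e
    linarith
  have hc0 : 0 ≤ c := by positivity
  have : z₂ * (c * z₃) ≤ 1 / 8 := calc
    z₂ * (c * z₃) ≤ m * (c * z₃) := by gcongr
    _ = c * m * z₃ := by ring
    _ ≤ 1 / 2 * (1 / 4) := by gcongr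
    _ = _ := by norm_num
  linarith

theorem neg_one_pow_mul_lineValue_pos {k m : ℕ} (hk : 9 ≤ k) (hm : 1 ≤ m) (h : 7 * m ^ 2 < 2 * k) :
    0 < (-1) ^ m * lineValue k ((k - 1 : ℕ) / (2 * Real.pi * m)) := by
  have hm' : (0 : ℝ) < m := by exact_mod_cast hm
  have key := norm_qSeries_neg_exp_sub_le (by omega : 8 ≤ k - 1) hm (by omega)
  have h1 := (Complex.abs_re_le_norm _).trans key
  have e : ((-1 : ℂ) ^ m).re = (-1) ^ m := by
    rw [show (-1 : ℂ) ^ m = (((-1 : ℝ) ^ m : ℝ) : ℂ) by push_cast; rfl, Complex.ofReal_re]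
  have e2 : (2 * Real.pi * ((k - 1 : ℕ) / (2 * Real.pi * m))) = (k - 1 : ℕ) / m := by
    have := Real.pi_pos
    field_simp
  rw [Complex.sub_re, Complex.re_ofReal_mul, e] at h1
  rw [lineValue, e2]
  have hC : 0 < (Real.exp 1 / m) ^ (k - 1) := by positivity
  set v := (qSeries (k - 1) (-(Real.exp (-((k - 1 : ℕ) / m)) : ℝ))).re
  refine pos_of_mul_pos_right (a := (Real.exp 1 / m) ^ (k - 1)) ?_ hC.le
  rw [abs_le] at h1
  rcases neg_one_pow_eq_or ℝ m with hs | hs <;> rw [hs] at h1 ⊢ <;> linarith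

/-! ### Sample heights with alternating signs -/

/-- The angle `min (π m / k) (π / 6)` of the sample points near the corner. -/
noncomputable def sampleAngle (k m : ℕ) : ℝ := min (Real.pi * m / k) (Real.pi / 6)

/-- Heights on the line `re τ = 1 / 2` at which `𝔾_k` takes values of alternating sign. -/
noncomputable def sampleHeight (k m : ℕ) : ℝ :=
  if 7 * m ^ 2 < 2 * k then (k - 1 : ℕ) / (2 * Real.pi * m) else (2 * Real.tan (sampleAngle k m))⁻¹

theorem sampleAngle_pos {k m : ℕ} (hk : 1 ≤ k) (hm : 1 ≤ m) : 0 < sampleAngle k m := by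
  have := Real.pi_pos
  have : (0 : ℝ) < k := by exact_mod_cast hk
  have : (0 : ℝ) < m := by exact_mod_cast hm
  exact lt_min (by positivity) (by positivity)

theorem tan_sampleAngle_pos {k m : ℕ} (hk : 1 ≤ k) (hm : 1 ≤ m) :
    0 < Real.tan (sampleAngle k m) := by
  have := Real.pi_pos
  have := min_le_right (Real.pi * m / k) (Real.pi / 6)
  exact Real.tan_pos_of_pos_of_lt_pi_div_two (sampleAngle_pos hk hm)
    (by unfold sampleAngle; linarith)

/-- The two regimes overlap enough to meet: once 7m² ≥ 2k, the angle α = πm/k has kα² ≥ 2π²/7, and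
sin α ≥ 0.93α for α ≤ π/6 yields the 9 required by the two-term approximation. -/
theorem nine_le_mul_sin_sampleAngle {k m : ℕ} (hk : 9 ≤ k) (hm : 1 ≤ m) (h : 2 * k ≤ 7 * m ^ 2) :
    9 ≤ k * (2 * Real.sin (sampleAngle k m)) ^ 2 := by
  have hpi := Real.pi_gt_d2
  have hpi' := Real.pi_lt_d2
  have hk' : (9 : ℝ) ≤ k := by exact_mod_cast hk
  rcases le_total (Real.pi * m / k) (Real.pi / 6) with h1 | h1
  · rw [sampleAngle, min_eq_left h1]
    have hm' : (1 : ℝ) ≤ m := by exact_mod_cast hm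
    have h' : 2 * (k : ℝ) ≤ 7 * m ^ 2 := by exact_mod_cast h
    set a := Real.pi * m / k with ha
    have ha0 : 0 < a := by positivity
    have ha1 : a ≤ 21 / 40 := by linarith
    have h2 := Real.sin_gt_sub_cube ha0
    have h3 : 93 / 100 * a ≤ Real.sin a := by
      have : a ^ 2 ≤ (21 / 40) ^ 2 := by gcongr
      nlinarith
    have h4 : (93 / 100 * a) ^ 2 ≤ Real.sin a ^ 2 := by gcongr
    have h5 : k * a ^ 2 = Real.pi ^ 2 * (m ^ 2 / k) := by rw [ha]; field_simp
    have h6 : (2 / 7 : ℝ) ≤ m ^ 2 / k := by rw [le_div_iff₀ (by linarith)]; linarith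
    have h7 : (3.14 : ℝ) ^ 2 ≤ Real.pi ^ 2 := by gcongr
    have h8 : (3.14 : ℝ) ^ 2 * (2 / 7) ≤ k * a ^ 2 := by rw [h5]; gcongr
    calc (9 : ℝ) ≤ 4 * (93 / 100) ^ 2 * (k * a ^ 2) := by linarith
      _ = 4 * k * (93 / 100 * a) ^ 2 := by ring
      _ ≤ 4 * k * Real.sin a ^ 2 := by gcongr
      _ = _ := by ring
  · rw [sampleAngle, min_eq_right h1, Real.sin_pi_div_six]
    linarith

theorem six_mul_lt_of_lt_zeroCount {k m : ℕ} (hodd : Odd k) (h : m < zeroCount k) : 6 * m < k := by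
  obtain ⟨j, rfl⟩ := hodd
  unfold zeroCount at h
  split_ifs at h <;> omega

theorem cos_natCast_mul_pi_sub (m : ℕ) (x : ℝ) :
    Real.cos (m * Real.pi - x) = (-1) ^ m * Real.cos x := by
  rw [Real.cos_sub, Real.cos_nat_mul_pi, Real.sin_nat_mul_pi]; ring

theorem neg_one_pow_mul_lineValue_sampleHeight_pos {k m : ℕ} (hk : 9 ≤ k) (hodd : Odd k)
    (hm : 1 ≤ m) (hmN : m ≤ zeroCount k) : 0 < (-1) ^ m * lineValue k (sampleHeight k m) := by
  by_cases h : 7 * m ^ 2 < 2 * k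
  · rw [sampleHeight, if_pos h]
    exact neg_one_pow_mul_lineValue_pos hk hm h
  rw [sampleHeight, if_neg h]
  have hpi := Real.pi_pos
  have hk0 : (0 : ℝ) < k := by exact_mod_cast (by omega : 0 < k)
  have hα0 := sampleAngle_pos (by omega : 1 ≤ k) hm
  have htan := tan_sampleAngle_pos (by omega : 1 ≤ k) hm
  set τ : ℍ := ⟨⟨1 / 2, (2 * Real.tan (sampleAngle k m))⁻¹⟩, inv_pos.2 (mul_pos two_pos htan)⟩ with hτ
  have hre : (τ : ℂ).re = 1 / 2 := rfl
  have him : (τ : ℂ).im = (2 * Real.tan (sampleAngle k m))⁻¹ := rfl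
  have hK : (0 : ℝ) < (k - 1).factorial / (2 * Real.pi) ^ k := by positivity
  rw [← him, lineValue_eq_latticeSum (by omega) τ hre, mul_left_comm]
  refine mul_pos hK ?_
  -- Only for k ≡ 3 mod 12 and m = N does 2 cos(kα) vanish: the sample point is then the corner
  -- itself, m is odd, and the known sign of the lattice sum there is used.
  by_cases hcorner : k % 12 = 3 ∧ k < 6 * m
  · have hm2 : Odd m := by
      unfold zeroCount at hmN
      rw [if_pos (Or.inl hcorner.1)] at hmN
      exact ⟨k / 12, by omega⟩
    have hα : sampleAngle k m = Real.pi / 6 := by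
      refine min_eq_right ?_
      rw [div_le_div_iff₀ (by norm_num) hk0, mul_assoc]
      have : (k : ℝ) < 6 * m := by exact_mod_cast hcorner.2
      gcongr
      linarith
    have : τ = corner := by
      apply UpperHalfPlane.ext
      apply Complex.ext
      · rw [hre, corner_re]
      · rw [him, corner_im, hα, Real.tan_pi_div_six]
        field_simp
    rw [this, hm2.neg_one_pow]
    have := latticeSum_corner_re_neg hk (by omega)
    linarith
  have key := abs_latticeSum_sub_two_cos_le hk hα0 (min_le_right _ _)
    (nine_le_mul_sin_sampleAngle hk hm (by omega)) τ hre him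
  have hcos : 4 / 5 ≤ (-1) ^ m * Real.cos (k * sampleAngle k m) := by
    have hsq : ((-1 : ℝ) ^ m) * (-1) ^ m = 1 := by rw [← mul_pow]; norm_num
    rcases le_or_gt (6 * m) k with h6 | h6
    · have hα : sampleAngle k m = Real.pi * m / k := by
        refine min_eq_left ?_
        rw [div_le_div_iff₀ hk0 (by norm_num), mul_assoc]
        have : (6 * m : ℝ) ≤ k := by exact_mod_cast h6
        gcongr
        linarith
      have : k * sampleAngle k m = m * Real.pi - 0 := by rw [hα]; field_simp; ring
      rw [this, cos_natCast_mul_pi_sub, ← mul_assoc, hsq, Real.cos_zero]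
      norm_num
    -- Here k ≡ 5 mod 6 and m = N: the angle is truncated to π/6, so kα falls short of mπ by π/6 and
    -- the cosine is still ±√3/2.
    · have hkm : k + 1 = 6 * m := by
        obtain ⟨j, rfl⟩ := hodd
        unfold zeroCount at hmN
        split_ifs at hmN <;> omega
      have hkm' : (k : ℝ) = 6 * m - 1 := by
        have : (k : ℝ) + 1 = 6 * m := by exact_mod_cast hkm
        linarith
      have hα : sampleAngle k m = Real.pi / 6 := by
        refine min_eq_right ?_
        rw [div_le_div_iff₀ (by norm_num) hk0, mul_assoc]
        gcongr
        linarith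
      have : k * sampleAngle k m = m * Real.pi - Real.pi / 6 := by rw [hα, hkm']; ring
      rw [this, cos_natCast_mul_pi_sub, ← mul_assoc, hsq, Real.cos_pi_div_six]
      have : (1.7 : ℝ) ≤ √3 := Real.le_sqrt_of_sq_le (by norm_num)
      linarith
  refine pos_of_mul_pos_right (a := (2 * Real.sin (sampleAngle k m))⁻¹ ^ k) ?_ ?_
  · rw [abs_le] at key
    rcases neg_one_pow_eq_or ℝ m with hs | hs <;> rw [hs] at hcos ⊢ <;> linarith
  · have hsin : 0 < Real.sin (sampleAngle k m) := Real.sin_pos_of_pos_of_lt_pi hα0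
      (by have := min_le_right (Real.pi * m / k) (Real.pi / 6); unfold sampleAngle; linarith)
    positivity

theorem sampleHeight_succ_lt {k m : ℕ} (hk : 9 ≤ k) (hodd : Odd k) (hm : 1 ≤ m)
    (hmN : m < zeroCount k) : sampleHeight k (m + 1) < sampleHeight k m := by
  have hpi := Real.pi_pos
  have h6 := six_mul_lt_of_lt_zeroCount hodd hmN
  have h6' : (6 * m + 1 : ℝ) ≤ k := by exact_mod_cast h6
  have hm' : (1 : ℝ) ≤ m := by exact_mod_cast hm
  have hk0 : (0 : ℝ) < k := by linarith
  have htan := tan_sampleAngle_pos (by omega : 1 ≤ k) hm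
  have htan' := tan_sampleAngle_pos (by omega : 1 ≤ k) (by omega : 1 ≤ m + 1)
  have hle := min_le_right (Real.pi * (m + 1 : ℕ) / k) (Real.pi / 6)
  have hcast : ((k - 1 : ℕ) : ℝ) = k - 1 := by rw [Nat.cast_sub (by omega)]; simp
  unfold sampleHeight
  by_cases h1 : 7 * m ^ 2 < 2 * k
  · rw [if_pos h1, hcast]
    by_cases h2 : 7 * (m + 1) ^ 2 < 2 * k
    · rw [if_pos h2]
      have : (0 : ℝ) < k - 1 := by linarith
      push_cast
      gcongr
      linarith
    · rw [if_neg h2]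
      -- At the change of regime the upper height is 1/(2β) with β = πm/(k - 1). Since β is at most
      -- the next angle, which is less than its tangent, the heights still decrease.
      have h3 : Real.pi * m / (k - 1) ≤ sampleAngle k (m + 1) := by
        refine le_min ?_ ?_
        · rw [div_le_div_iff₀ (by linarith) hk0, mul_assoc, mul_assoc]
          refine mul_le_mul_of_nonneg_left ?_ hpi.le
          push_cast
          linarith
        · rw [div_le_div_iff₀ (by linarith) (by norm_num), mul_assoc]
          gcongr
          linarith
      have h4 := Real.lt_tan (sampleAngle_pos (by omega : 1 ≤ k) (by omega : 1 ≤ m + 1))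
        (by unfold sampleAngle; linarith)
      have h5 : (k - 1 : ℝ) / (2 * Real.pi * m) = (2 * (Real.pi * m / (k - 1)))⁻¹ := by
        have : (k - 1 : ℝ) ≠ 0 := by linarith
        field_simp
      rw [h5]
      have : 0 < Real.pi * m / (k - 1) := div_pos (by positivity) (by linarith)
      gcongr
      linarith
  · have h2 : ¬ 7 * (m + 1) ^ 2 < 2 * k := by nlinarith
    rw [if_neg h1, if_neg h2]
    have h3 : sampleAngle k m < sampleAngle k (m + 1) := by
      refine lt_min ?_ ?_
      · refine (min_le_left _ _).trans_lt ?_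
        push_cast
        gcongr
        linarith
      · refine (min_le_left _ _).trans_lt ?_
        rw [div_lt_div_iff₀ hk0 (by norm_num), mul_assoc]
        gcongr
        linarith
    have h4 := Real.tan_lt_tan_of_lt_of_lt_pi_div_two
      (by linarith [sampleAngle_pos (by omega : 1 ≤ k) hm])
      (by unfold sampleAngle; linarith) h3
    gcongr

theorem sqrt_three_div_two_le_sampleHeight {k : ℕ} (hk : 9 ≤ k) (hN : 1 ≤ zeroCount k) :
    √3 / 2 ≤ sampleHeight k (zeroCount k) := by
  have hpi := Real.pi_pos
  have h3 : √3 < 1.74 := by rw [Real.sqrt_lt' (by norm_num)]; norm_num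
  have h30 : 0 < √3 := by positivity
  unfold sampleHeight
  split_ifs with h
  · have hk' : (9 : ℝ) ≤ k := by exact_mod_cast hk
    have hN' : (1 : ℝ) ≤ zeroCount k := by exact_mod_cast hN
    rw [le_div_iff₀ (by positivity), Nat.cast_sub (by omega)]
    have h1 : 11 * (zeroCount k : ℝ) ≤ 2 * (k - 1) := by
      have : 11 * zeroCount k + 2 ≤ 2 * k := by
        rcases hN.eq_or_lt with h2 | h2
        · omega
        · nlinarith
      have : (11 * zeroCount k + 2 : ℝ) ≤ 2 * k := by exact_mod_cast this
      linarith
    have h2 : √3 * Real.pi ≤ 1.74 * 3.15 := by gcongr; exact Real.pi_lt_d2.le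
    push_cast
    nlinarith
  · have htan : 0 < Real.tan (sampleAngle k (zeroCount k)) := tan_sampleAngle_pos (by omega) hN
    have hα := min_le_right (Real.pi * (zeroCount k : ℕ) / k) (Real.pi / 6)
    have hα0 := sampleAngle_pos (by omega : 1 ≤ k) hN
    have h1 : Real.tan (sampleAngle k (zeroCount k)) ≤ (√3)⁻¹ := by
      rw [← one_div, ← Real.tan_pi_div_six]
      rcases hα.eq_or_lt with h2 | h2
      · rw [sampleAngle, h2]
      · exact (Real.tan_lt_tan_of_lt_of_lt_pi_div_two (by unfold sampleAngle at hα0; linarith)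
          (by linarith) h2).le
    rw [mul_inv]
    have h2 := inv_anti₀ htan h1
    rw [inv_inv] at h2
    linarith

/-- N alternating signs at decreasing heights give N - 1 sign changes. For k < 9 one has N = 1 and
nothing to find. -/
theorem exists_lineValue_zeros {k : ℕ} (hk : 3 ≤ k) (hodd : Odd k) :
    ∃ T : Finset ℝ, T.card + 1 = zeroCount k ∧ ∀ s ∈ T, √3 / 2 < s ∧ lineValue k s = 0 := by
  have hN : 1 ≤ zeroCount k := by
    obtain ⟨j, rfl⟩ := hodd
    unfold zeroCount
    split_ifs <;> omega
  rcases lt_or_ge k 9 with h9 | h9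
  · refine ⟨∅, ?_, by simp⟩
    obtain ⟨j, rfl⟩ := hodd
    rw [Finset.card_empty, zero_add]
    unfold zeroCount
    split_ifs <;> omega
  have hbound : ∀ m, 1 ≤ m → m ≤ zeroCount k → √3 / 2 ≤ sampleHeight k m := by
    intro m hm hmN
    induction hmN using Nat.decreasingInduction with
    | of_succ n hn ih => exact (ih (by omega)).trans (sampleHeight_succ_lt h9 hodd hm hn).le
    | self => exact sqrt_three_div_two_le_sampleHeight h9 hN
  have hex : ∀ m, ∃ s, 1 ≤ m → m < zeroCount k →
      s ∈ Set.Ioo (sampleHeight k (m + 1)) (sampleHeight k m) ∧ lineValue k s = 0 := by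
    intro m
    by_cases hm : 1 ≤ m ∧ m < zeroCount k
    · have hlt := sampleHeight_succ_lt h9 hodd hm.1 hm.2
      have h1 := neg_one_pow_mul_lineValue_sampleHeight_pos h9 hodd hm.1 hm.2.le
      have h2 := neg_one_pow_mul_lineValue_sampleHeight_pos h9 hodd (by omega : 1 ≤ m + 1) hm.2
      have hpos : 0 < sampleHeight k (m + 1) :=
        lt_of_lt_of_le (by positivity) (hbound (m + 1) (by omega) hm.2)
      have hc : ContinuousOn (fun t ↦ (-1) ^ m * lineValue k t)
          (Set.Icc (sampleHeight k (m + 1)) (sampleHeight k m)) :=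
        continuousOn_const.mul ((continuousOn_lineValue k).mono fun t ht ↦ hpos.trans_le ht.1)
      obtain ⟨s, hs, hs0⟩ := intermediate_value_Ioo hlt.le hc
        (show (0 : ℝ) ∈ _ from ⟨by rw [pow_succ] at h2; linarith, h1⟩)
      exact ⟨s, fun _ _ ↦ ⟨hs, by simpa using hs0⟩⟩
    · exact ⟨0, fun h h' ↦ (hm ⟨h, h'⟩).elim⟩
  choose s hs using hex
  have hanti : StrictAntiOn s (Set.Ico 1 (zeroCount k)) := by
    refine strictAntiOn_of_succ_lt Set.ordConnected_Ico fun m _ hm hm' ↦ ?_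
    rw [Order.succ_eq_add_one] at hm' ⊢
    exact (hs (m + 1) hm'.1 hm'.2).1.2.trans (hs m hm.1 hm.2).1.1
  refine ⟨(Finset.Ico 1 (zeroCount k)).image s, ?_, ?_⟩
  · rw [Finset.card_image_of_injOn (by simpa using hanti.injOn), Nat.card_Ico]
    omega
  · intro x hx
    obtain ⟨m, hm, rfl⟩ := Finset.mem_image.1 hx
    rw [Finset.mem_Ico] at hm
    have := hs m hm.1 hm.2
    exact ⟨(hbound (m + 1) (by omega) hm.2).trans_lt this.1.1, this.2⟩

theorem exp_two_pi_I_mul_eq (z : ℂ) :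
    Complex.exp (2 * Real.pi * Complex.I * z) =
      Real.exp (-(2 * Real.pi * z.im)) * Complex.exp ((2 * Real.pi * z.re : ℝ) * Complex.I) := by
  rw [Complex.ofReal_exp, ← Complex.exp_add]
  congr 1
  conv_lhs => rw [← Complex.re_add_im z]
  push_cast
  linear_combination (2 * Real.pi * z.im) * Complex.I_sq

theorem norm_exp_two_pi_I_mul (z : ℂ) :
    ‖Complex.exp (2 * Real.pi * Complex.I * z)‖ = Real.exp (-(2 * Real.pi * z.im)) := by
  rw [exp_two_pi_I_mul_eq, norm_mul, Complex.norm_exp_ofReal_mul_I, mul_one, Complex.norm_real,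
    Real.norm_of_nonneg (Real.exp_pos _).le]

theorem stripCurve_arcHeight_half :
    stripCurve arcHeight (1 / 2) = -(Real.exp (-(2 * Real.pi * (√3 / 2))) : ℝ) := by
  have h : arcHeight (1 / 2) = √3 / 2 := by
    rw [arcHeight_eq le_rfl, show (1 - (1 / 2) ^ 2 : ℝ) = 3 / 2 ^ 2 by norm_num,
      Real.sqrt_div (by norm_num), Real.sqrt_sq (by norm_num)]
  rw [stripCurve_eq, h, show 2 * Real.pi * (1 / 2) = Real.pi by ring, Complex.exp_pi_mul_I]
  ring

theorem insideCurve_neg_exp {s : ℝ} (hs : √3 / 2 < s) :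
    InsideCurve arcHeight (-(Real.exp (-(2 * Real.pi * s)) : ℝ)) := by
  have hpi := Real.pi_pos
  refine ⟨1 / 2, by norm_num, Real.exp (-(2 * Real.pi * (s - √3 / 2))), (Real.exp_pos _).le, ?_, ?_⟩
  · rw [Real.exp_lt_one_iff, neg_lt_zero]
    have : 0 < s - √3 / 2 := by linarith
    positivity
  · rw [stripCurve_arcHeight_half, mul_neg, ← Complex.ofReal_mul, ← Real.exp_add]
    congr 3; ring

theorem insideCurve_zero : InsideCurve arcHeight 0 :=
  ⟨0, by norm_num, 0, le_rfl, one_pos, by simp⟩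

theorem neg_exp_injective :
    Function.Injective fun s : ℝ ↦ (-(Real.exp (-(2 * Real.pi * s)) : ℝ) : ℂ) := by
  intro a b h
  have := Real.pi_pos
  simp only [neg_inj, Complex.ofReal_inj, Real.exp_eq_exp] at h
  exact mul_left_cancel₀ (by positivity) h

theorem norm_lt_one_of_insideCurve {a : ℂ} (h : InsideCurve arcHeight a) : ‖a‖ < 1 := by
  obtain ⟨x, -, s, hs0, hs1, rfl⟩ := h
  have hpi := Real.pi_pos
  have hy : 0 ≤ arcHeight x := Real.sqrt_nonneg _
  rw [norm_mul, norm_stripCurve, Complex.norm_real, Real.norm_of_nonneg hs0]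
  have : Real.exp (-(2 * Real.pi * arcHeight x)) ≤ 1 := by
    rw [Real.exp_le_one_iff, neg_nonpos]; positivity
  nlinarith

/-- The zeros of the `q`-series enclosed by the arc are simple; they are `0` and points on the
negative real axis. -/
theorem exists_zeros_of_qSeries {k : ℕ} (hk : 3 ≤ k) (hodd : Odd k) :
    ∃ T : Finset ℝ, T.card + 1 = zeroCount k ∧ (∀ s ∈ T, √3 / 2 < s) ∧
      (∀ a, InsideCurve arcHeight a → (qSeries (k - 1) a = 0 ↔
        a = 0 ∨ ∃ s ∈ T, a = -(Real.exp (-(2 * Real.pi * s)) : ℝ))) ∧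
      (∀ a, InsideCurve arcHeight a → qSeries (k - 1) a = 0 →
        analyticOrderAt (qSeries (k - 1)) a = 1) := by
  obtain ⟨T, hcard, hT⟩ := exists_lineValue_zeros hk hodd
  obtain ⟨-, S, n, hS, hn, hsum⟩ := hasZeroCount hk hodd
  -- U has N elements and lies in S, whose multiplicities are at least 1 and add up to N; hence U =
  -- S and every multiplicity is 1.
  set U : Finset ℂ := insert 0 (T.image fun s : ℝ ↦ (-(Real.exp (-(2 * Real.pi * s)) : ℝ) : ℂ)) with hU
  have hUS : U ⊆ S := by
    intro a ha
    rw [hU, Finset.mem_insert, Finset.mem_image] at ha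
    rw [hS]
    rcases ha with rfl | ⟨s, hs, rfl⟩
    · exact ⟨insideCurve_zero, qSeries_zero _⟩
    · exact ⟨insideCurve_neg_exp (hT s hs).1, by rw [← coe_lineValue, (hT s hs).2, Complex.ofReal_zero]⟩
  have hUcard : U.card = zeroCount k := by
    rw [hU, Finset.card_insert_of_notMem, Finset.card_image_of_injective _ neg_exp_injective, hcard]
    rw [Finset.mem_image]
    rintro ⟨s, -, h⟩
    exact (Real.exp_pos (-(2 * Real.pi * s))).ne' (by simpa only [neg_eq_zero, Complex.ofReal_eq_zero] using h)
  have hn1 : ∀ a ∈ S, 1 ≤ n a := by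
    intro a ha
    have ha' := (hS a).1 ha
    have h1 : analyticOrderAt (qSeries (k - 1)) a ≠ 0 :=
      ((analyticOnNhd_qSeries (k - 1) a
        (mem_ball_zero_iff.2 (norm_lt_one_of_insideCurve ha'.1))).analyticOrderAt_ne_zero).2 ha'.2
    rw [hn a ha] at h1
    exact Nat.one_le_iff_ne_zero.2 (by exact_mod_cast h1)
  have hScard : S.card ≤ zeroCount k := by
    rw [← hsum, Finset.card_eq_sum_ones]
    exact Finset.sum_le_sum hn1
  have hUS' : U = S := Finset.eq_of_subset_of_card_le hUS (by rw [hUcard]; exact hScard)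
  have hn1' : ∀ a ∈ S, 1 = n a := by
    rw [← Finset.sum_eq_sum_iff_of_le hn1, hsum, ← Finset.card_eq_sum_ones, ← hUS', hUcard]
  refine ⟨T, hcard, fun s hs ↦ (hT s hs).1, fun a ha ↦ ?_, fun a ha h0 ↦ ?_⟩
  · have h : qSeries (k - 1) a = 0 ↔ a ∈ S := by rw [hS]; tauto
    rw [h, ← hUS', hU, Finset.mem_insert, Finset.mem_image]
    simp only [eq_comm]
  · have h : a ∈ S := (hS a).2 ⟨ha, h0⟩
    rw [hn a h, ← hn1' a h, Nat.cast_one]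

/-! ### Transfer to the fundamental domain and the weighted count -/

theorem arcHeight_fract_of_mem_Icc {x : ℝ} (h0 : -(1 / 2) ≤ x) (h1 : x ≤ 1 / 2) :
    ∃ x' ∈ Set.Icc (0 : ℝ) 1, (∃ n : ℤ, x' = x + n) ∧ arcHeight x' = √(1 - x ^ 2) := by
  rcases le_or_gt 0 x with h | h
  · exact ⟨x, ⟨h, by linarith⟩, ⟨0, by simp⟩, by rw [arcHeight_eq h1]⟩
  · refine ⟨x + 1, ⟨by linarith, by linarith⟩, ⟨1, by simp⟩, ?_⟩
    rw [arcHeight, min_eq_right (by linarith)]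
    congr 2; ring

/-- The left half of the domain is shifted by 1 into the strip 0 ≤ Re z ≤ 1; the height above the
arc becomes the radial factor in `InsideCurve`. -/
theorem exp_eq_of_mem_fundamentalDomain {z : ℂ} (hz : 0 < z.im) (hn : 1 ≤ ‖z‖)
    (h0 : -(1 / 2) ≤ z.re) (h1 : z.re ≤ 1 / 2) :
    (∃ x ∈ Set.Icc (0 : ℝ) 1, Complex.exp (2 * Real.pi * Complex.I * z) = stripCurve arcHeight x) ∨
      InsideCurve arcHeight (Complex.exp (2 * Real.pi * Complex.I * z)) := by
  have hpi := Real.pi_pos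
  obtain ⟨x, hx, ⟨n, hxn⟩, hy⟩ := arcHeight_fract_of_mem_Icc h0 h1
  have hsq : 1 ≤ z.re ^ 2 + z.im ^ 2 := by
    have h2 : 1 ≤ ‖z‖ ^ 2 := one_le_pow₀ hn
    rw [Complex.sq_norm, Complex.normSq_apply] at h2
    linarith
  have hle : arcHeight x ≤ z.im := by
    rw [hy]
    exact Real.sqrt_le_iff.2 ⟨hz.le, by linarith⟩
  have hE : Complex.exp (2 * Real.pi * Complex.I * z) =
      (Real.exp (-(2 * Real.pi * (z.im - arcHeight x))) : ℝ) * stripCurve arcHeight x := by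
    rw [stripCurve_eq, ← mul_assoc, ← Complex.ofReal_mul, ← Real.exp_add, exp_two_pi_I_mul_eq, hxn]
    congr 1
    · congr 2; ring
    · rw [Complex.exp_eq_exp_iff_exists_int]
      exact ⟨-n, by push_cast; ring⟩
  rcases hle.eq_or_lt with h | h
  · exact Or.inl ⟨x, hx, by rw [hE, h]; simp⟩
  · refine Or.inr ⟨x, hx, _, (Real.exp_pos _).le, ?_, hE⟩
    rw [Real.exp_lt_one_iff, neg_lt_zero]
    have : 0 < z.im - arcHeight x := by linarith
    positivity

theorem exp_eq_neg_exp_iff {z : ℂ} (h0 : -(1 / 2) ≤ z.re) (h1 : z.re ≤ 1 / 2) (s : ℝ) :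
    Complex.exp (2 * Real.pi * Complex.I * z) = -(Real.exp (-(2 * Real.pi * s)) : ℝ) ↔
      (z.re = 1 / 2 ∨ z.re = -(1 / 2)) ∧ z.im = s := by
  have hpi := Real.pi_pos
  rw [exp_two_pi_I_mul_eq]
  constructor
  · intro h
    have hn := congr_arg norm h
    rw [norm_neg, norm_mul, Complex.norm_exp_ofReal_mul_I, mul_one, Complex.norm_real,
      Complex.norm_real, Real.norm_of_nonneg (Real.exp_pos _).le,
      Real.norm_of_nonneg (Real.exp_pos _).le, Real.exp_eq_exp] at hn
    have him : z.im = s := by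
      rw [neg_inj] at hn
      exact mul_left_cancel₀ (by positivity) hn
    refine ⟨?_, him⟩
    rw [him] at h
    have hne : ((Real.exp (-(2 * Real.pi * s)) : ℝ) : ℂ) ≠ 0 := by
      exact_mod_cast (Real.exp_pos _).ne'
    have h2 : Complex.exp ((2 * Real.pi * z.re : ℝ) * Complex.I) = -1 :=
      mul_left_cancel₀ hne (by rw [h]; ring)
    have h3 := congr_arg Complex.re h2
    rw [Complex.exp_ofReal_mul_I_re, Complex.neg_re, Complex.one_re] at h3
    have h4 : Real.cos (Real.pi - |2 * Real.pi * z.re|) = 1 := by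
      rw [Real.cos_pi_sub, Real.cos_abs, h3, neg_neg]
    have h5 : |z.re| ≤ 1 / 2 := abs_le.2 ⟨h0, h1⟩
    have h6 : |2 * Real.pi * z.re| = 2 * Real.pi * |z.re| := by
      rw [abs_mul, abs_of_pos (by positivity : 0 < 2 * Real.pi)]
    rw [h6] at h4
    have h7 := (Real.cos_eq_one_iff_of_lt_of_lt
      (by nlinarith [abs_nonneg z.re]) (by nlinarith [abs_nonneg z.re])).1 h4
    have h8 : |z.re| = 1 / 2 := by
      have : Real.pi * (1 - 2 * |z.re|) = 0 := by linarith
      rcases mul_eq_zero.1 this with h | h <;> linarith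
    exact eq_or_eq_neg_of_abs_eq h8
  · rintro ⟨hre, rfl⟩
    have : Complex.exp ((2 * Real.pi * z.re : ℝ) * Complex.I) = -1 := by
      rcases hre with h | h
      · rw [h, show 2 * Real.pi * (1 / 2) = Real.pi by ring, Complex.exp_pi_mul_I]
      · rw [h, show 2 * Real.pi * -(1 / 2) = -Real.pi by ring, Complex.ofReal_neg, neg_mul,
          Complex.exp_neg_pi_mul_I]
    rw [this]; ring

/-- The derivative of τ ↦ q never vanishes, so orders are preserved. -/
theorem vanishingOrder_coe_GG {k : ℕ} (hk : 3 ≤ k) (hodd : Odd k) (z : ℍ) :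
    OddEisenstein.vanishingOrder (OddEisenstein.GG k) (z : OnePoint ℍ) =
      analyticOrderAt (qSeries (k - 1)) (Complex.exp (2 * Real.pi * Complex.I * (z : ℂ))) := by
  change analyticOrderAt (OddEisenstein.GG k ∘ ofComplex) (z : ℂ) = _
  have h : OddEisenstein.GG k ∘ ofComplex =ᶠ[nhds (z : ℂ)]
      qSeries (k - 1) ∘ fun w ↦ Complex.exp (2 * Real.pi * Complex.I * w) := by
    filter_upwards [isOpen_upperHalfPlaneSet.mem_nhds z.im_pos] with w hw
    rw [Function.comp_apply, Function.comp_apply, GG_eq_qSeries hk hodd, ofComplex_apply_of_im_pos hw]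
  rw [analyticOrderAt_congr h, analyticOrderAt_comp_of_deriv_ne_zero (by fun_prop)]
  have hd : HasDerivAt (fun w : ℂ ↦ Complex.exp (2 * Real.pi * Complex.I * w))
      (Complex.exp (2 * Real.pi * Complex.I * z) * (2 * Real.pi * Complex.I * 1)) (z : ℂ) :=
    ((hasDerivAt_id' (z : ℂ)).const_mul _).cexp
  rw [hd.deriv, mul_one]
  exact mul_ne_zero (Complex.exp_ne_zero _) Complex.two_pi_I_ne_zero

theorem cuspFunction_GG {k : ℕ} (hk : 3 ≤ k) (hodd : Odd k) :
    cuspFunction 1 (OddEisenstein.GG k) =ᶠ[nhds 0] qSeries (k - 1) := by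
  have hne : ∀ q : ℂ, q ≠ 0 → ‖q‖ < 1 →
      (OddEisenstein.GG k ∘ ofComplex) (Function.Periodic.invQParam 1 q) = qSeries (k - 1) q := by
    intro q hq hq1
    have him : 0 < (Function.Periodic.invQParam 1 q).im :=
      Function.Periodic.im_invQParam_pos_of_norm_lt_one one_pos hq1 hq
    rw [Function.comp_apply, GG_eq_qSeries hk hodd, ofComplex_apply_of_im_pos him]
    have := Function.Periodic.qParam_right_inv (one_ne_zero (α := ℝ)) hq
    rw [Function.Periodic.qParam] at this
    simpa using congr_arg (qSeries (k - 1)) this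
  have hball : Metric.ball (0 : ℂ) 1 ∈ nhds 0 := Metric.ball_mem_nhds _ one_pos
  have hcont : ContinuousAt (qSeries (k - 1)) 0 :=
    ((analyticOnNhd_qSeries (k - 1)) 0 (Metric.mem_ball_self one_pos)).continuousAt
  have hlim : Filter.limUnder (nhdsWithin 0 {0}ᶜ)
      ((OddEisenstein.GG k ∘ ofComplex) ∘ Function.Periodic.invQParam 1) = qSeries (k - 1) 0 := by
    refine Filter.Tendsto.limUnder_eq ((hcont.tendsto.mono_left nhdsWithin_le_nhds).congr' ?_)
    filter_upwards [self_mem_nhdsWithin, nhdsWithin_le_nhds hball] with q hq hq1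
    exact (hne q hq (mem_ball_zero_iff.1 hq1)).symm
  filter_upwards [hball] with q hq
  rw [UpperHalfPlane.cuspFunction, Function.Periodic.cuspFunction]
  rcases eq_or_ne q 0 with rfl | hq0
  · rw [Function.update_self, hlim]
  · rw [Function.update_of_ne hq0]
    exact hne q hq0 (mem_ball_zero_iff.1 hq)

theorem vanishingOrder_infty_GG {k : ℕ} (hk : 3 ≤ k) (hodd : Odd k)
    (h : analyticOrderAt (qSeries (k - 1)) 0 = 1) :
    OddEisenstein.vanishingOrder (OddEisenstein.GG k) OnePoint.infty = 1 := by
  change (qExpansion 1 (OddEisenstein.GG k)).order = ((1 : ℕ) : ℕ∞)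
  have hA : AnalyticAt ℂ (qSeries (k - 1)) 0 :=
    analyticOnNhd_qSeries (k - 1) 0 (Metric.mem_ball_self one_pos)
  rw [PowerSeries.order_eq_nat]
  simp only [qExpansion_coeff, ((cuspFunction_GG hk hodd).iteratedDeriv_eq _)]
  constructor
  · have h1 := hA.analyticOrderAt_deriv_add_one
    simp only [qSeries_zero, sub_zero] at h1
    have h2 : analyticOrderAt (deriv (qSeries (k - 1))) 0 = 0 := by
      rw [h] at h1
      have : analyticOrderAt (deriv (qSeries (k - 1))) 0 + 1 = 0 + 1 := by rw [h1, zero_add]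
      exact (ENat.add_left_injective_of_ne_top ENat.one_ne_top) this
    simpa [iteratedDeriv_one] using (hA.deriv.analyticOrderAt_eq_zero).1 h2
  · intro i hi
    obtain rfl : i = 0 := by omega
    simp [qSeries_zero]

/-- The point `x + i s`, regarded as a point of the completed upper half-plane. -/
noncomputable def linePoint (x s : ℝ) : OnePoint ℍ := ((ofComplex (⟨x, s⟩ : ℂ) : ℍ) : OnePoint ℍ)

theorem coe_ofComplex_mk {s : ℝ} (hs : 0 < s) (x : ℝ) :
    ((ofComplex (⟨x, s⟩ : ℂ) : ℍ) : ℂ) = ⟨x, s⟩ := by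
  rw [ofComplex_apply_of_im_pos (show 0 < (⟨x, s⟩ : ℂ).im from hs)]

theorem linePoint_inj {x x' s s' : ℝ} (hs : 0 < s) (hs' : 0 < s') :
    linePoint x s = linePoint x' s' ↔ x = x' ∧ s = s' := by
  rw [linePoint, linePoint, OnePoint.coe_eq_coe, UpperHalfPlane.ext_iff, coe_ofComplex_mk hs,
    coe_ofComplex_mk hs', Complex.mk.injEq]

theorem coe_eq_linePoint (z : ℍ) : (z : OnePoint ℍ) = linePoint (z : ℂ).re (z : ℂ).im := by
  rw [linePoint, Complex.eta, ofComplex_apply]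

theorem one_le_norm_of_abs_re_eq {z : ℂ} (hre : z.re = 1 / 2 ∨ z.re = -(1 / 2))
    (him : √3 / 2 < z.im) : 1 ≤ ‖z‖ := by
  have h3 : (√3 / 2) ^ 2 < z.im ^ 2 := pow_lt_pow_left₀ him (by positivity) two_ne_zero
  rw [div_pow, Real.sq_sqrt (by norm_num)] at h3
  have hre2 : z.re ^ 2 = 1 / 4 := by rcases hre with h | h <;> rw [h] <;> norm_num
  have h : 1 ^ 2 ≤ ‖z‖ ^ 2 := by
    rw [Complex.sq_norm, Complex.normSq_apply]
    nlinarith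
  exact le_of_sq_le_sq h (norm_nonneg _)

theorem linePoint_mem_sides {x s : ℝ} (hx : x = 1 / 2 ∨ x = -(1 / 2)) (hs : √3 / 2 < s) :
    linePoint x s ∈ OddEisenstein.leftSide ∪ OddEisenstein.rightSide := by
  have hs0 : 0 < s := lt_trans (by positivity) hs
  have hc := coe_ofComplex_mk hs0 x
  have hn : 1 ≤ ‖((ofComplex (⟨x, s⟩ : ℂ) : ℍ) : ℂ)‖ := by
    rw [hc]; exact one_le_norm_of_abs_re_eq hx hs
  have hre : (ofComplex (⟨x, s⟩ : ℂ) : ℍ).re = x := by rw [← coe_re, hc]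
  rcases hx with h | h
  · exact Or.inr (Or.inr ⟨_, rfl, hn, hre.trans h⟩)
  · exact Or.inl (Or.inr ⟨_, rfl, hn, hre.trans h⟩)

theorem linePoint_mem_closedFD {x s : ℝ} (hx : x = 1 / 2 ∨ x = -(1 / 2)) (hs : √3 / 2 < s) :
    linePoint x s ∈ OddEisenstein.closedFD := by
  have hs0 : 0 < s := lt_trans (by positivity) hs
  have hc := coe_ofComplex_mk hs0 x
  have hn : 1 ≤ ‖((ofComplex (⟨x, s⟩ : ℂ) : ℍ) : ℂ)‖ := by
    rw [hc]; exact one_le_norm_of_abs_re_eq hx hs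
  have hre : (ofComplex (⟨x, s⟩ : ℂ) : ℍ).re = x := by rw [← coe_re, hc]
  refine Or.inr ⟨_, rfl, hn, ?_, ?_⟩ <;> rw [hre] <;> rcases hx with h | h <;> rw [h] <;> norm_num

theorem weight_linePoint {x s : ℝ} (hx : x = 1 / 2 ∨ x = -(1 / 2)) (hs : √3 / 2 < s) :
    OddEisenstein.weight (linePoint x s) = 1 / 2 := by
  have hs0 : 0 < s := lt_trans (by positivity) hs
  have hc := coe_ofComplex_mk hs0 x
  have him : (ofComplex (⟨x, s⟩ : ℂ) : ℍ).im = s := by rw [← coe_im, hc]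
  have hρ : ρ.im = √3 / 2 := rfl
  rw [OddEisenstein.weight, if_neg, if_pos]
  · refine ⟨?_, OnePoint.coe_ne_infty _⟩
    rcases linePoint_mem_sides hx hs with h | h
    · exact Or.inl (Or.inl h)
    · exact Or.inr h
  · rintro (h | h)
    · rw [linePoint, OnePoint.coe_eq_coe] at h
      rw [h, hρ] at him
      exact hs.ne him
    · rw [Set.mem_singleton_iff, linePoint, OnePoint.coe_eq_coe] at h
      rw [h, vadd_im, hρ] at him
      exact hs.ne him

theorem weight_infty : OddEisenstein.weight OnePoint.infty = 1 := by
  rw [OddEisenstein.weight, if_neg, if_neg]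
  · exact fun h ↦ h.2 rfl
  · rintro (h | h)
    · exact OnePoint.infty_ne_coe _ h
    · exact OnePoint.infty_ne_coe _ h

/-- The zeros of `𝔾_k` in the closed fundamental domain are simple; apart from `i∞` they are
given by heights on the two vertical sides. -/
theorem exists_zeros_GG {k : ℕ} (hk : 3 ≤ k) (hodd : Odd k) :
    ∃ T : Finset ℝ, T.card + 1 = zeroCount k ∧ (∀ s ∈ T, √3 / 2 < s) ∧
      OddEisenstein.vanishingOrder (OddEisenstein.GG k) OnePoint.infty = 1 ∧
      (∀ s ∈ T, ∀ x : ℝ, x = 1 / 2 ∨ x = -(1 / 2) →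
        OddEisenstein.vanishingOrder (OddEisenstein.GG k) (linePoint x s) = 1) ∧
      ∀ z : ℍ, (z : OnePoint ℍ) ∈ OddEisenstein.closedFD → OddEisenstein.GG k z = 0 →
        ((z : ℂ).re = 1 / 2 ∨ (z : ℂ).re = -(1 / 2)) ∧ (z : ℂ).im ∈ T := by
  obtain ⟨T, hcard, hT, hzero, horder⟩ := exists_zeros_of_qSeries hk hodd
  refine ⟨T, hcard, hT, vanishingOrder_infty_GG hk hodd (horder 0 insideCurve_zero (qSeries_zero _)),
    fun s hs x hx ↦ ?_, fun z hz h0 ↦ ?_⟩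
  · have hs0 : 0 < s := lt_trans (by positivity) (hT s hs)
    have hin := insideCurve_neg_exp (hT s hs)
    rw [linePoint, vanishingOrder_coe_GG hk hodd, coe_ofComplex_mk hs0,
      (exp_eq_neg_exp_iff (by rcases hx with h | h <;> simp only [h] <;> norm_num)
        (by rcases hx with h | h <;> simp only [h] <;> norm_num) s).2 ⟨hx, rfl⟩]
    exact horder _ hin ((hzero _ hin).2 (Or.inr ⟨s, hs, rfl⟩))
  · rcases hz with h | ⟨w, hw, hn, h1, h2⟩
    · exact (OnePoint.coe_ne_infty _ h).elim
    obtain rfl : z = w := OnePoint.coe_eq_coe.1 hw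
    rw [GG_eq_qSeries hk hodd] at h0
    rcases exp_eq_of_mem_fundamentalDomain z.im_pos hn h1 h2 with ⟨x, hx, h⟩ | h
    · rw [h] at h0
      exact ((hasZeroCount hk hodd).1 x hx h0).elim
    · rcases (hzero _ h).1 h0 with h | ⟨s, hs, h⟩
      · exact (Complex.exp_ne_zero _ h).elim
      · obtain ⟨hre, him⟩ := (exp_eq_neg_exp_iff h1 h2 s).1 h
        exact ⟨hre, him ▸ hs⟩

theorem vanishingOrder_coe_eq_zero {k : ℕ} (hk : 3 ≤ k) (hodd : Odd k) {z : ℍ}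
    (h : OddEisenstein.GG k z ≠ 0) :
    OddEisenstein.vanishingOrder (OddEisenstein.GG k) (z : OnePoint ℍ) = 0 := by
  rw [vanishingOrder_coe_GG hk hodd]
  rw [GG_eq_qSeries hk hodd] at h
  refine ((analyticOnNhd_qSeries (k - 1) _ ?_).analyticOrderAt_eq_zero).2 h
  rw [mem_ball_zero_iff, norm_exp_two_pi_I_mul, Real.exp_lt_one_iff, neg_lt_zero]
  have := Real.pi_pos
  have : 0 < (z : ℂ).im := z.im_pos
  positivity

theorem weightedZeros_GG {k : ℕ} (hk : 3 ≤ k) (hodd : Odd k) :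
    OddEisenstein.weightedZeros (OddEisenstein.GG k) = (zeroCount k : ℕ) := by
  classical
  obtain ⟨T, hcard, hT, hinf, hone, hz⟩ := exists_zeros_GG hk hodd
  have hT0 : ∀ s ∈ T, 0 < s := fun s hs ↦ lt_trans (by positivity) (hT s hs)
  have hinj (x : ℝ) : Set.InjOn (linePoint x) T := fun s hs s' hs' h ↦
    ((linePoint_inj (hT0 s hs) (hT0 s' hs')).1 h).2
  set R := T.image (linePoint (1 / 2)) with hR
  set L := T.image (linePoint (-(1 / 2))) with hL
  have hdisj : Disjoint R L := by
    rw [Finset.disjoint_left]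
    intro τ h1 h2
    obtain ⟨s, hs, rfl⟩ := Finset.mem_image.1 h1
    obtain ⟨s', hs', h⟩ := Finset.mem_image.1 h2
    have := ((linePoint_inj (hT0 s' hs') (hT0 s hs)).1 h).1
    norm_num at this
  have hnot : OnePoint.infty ∉ R ∪ L := by
    rw [Finset.mem_union, Finset.mem_image, Finset.mem_image]
    rintro (⟨s, -, h⟩ | ⟨s, -, h⟩) <;> exact OnePoint.coe_ne_infty _ h
  -- All heights in T exceed √3/2 strictly, so no zero is a corner and the weight is always 1/2.
  have hval : ∀ x : ℝ, x = 1 / 2 ∨ x = -(1 / 2) → ∀ s ∈ T,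
      OddEisenstein.closedFD.indicator (fun τ ↦ OddEisenstein.weight τ *
        (OddEisenstein.vanishingOrder (OddEisenstein.GG k) τ : ℝ≥0∞)) (linePoint x s) = 1 / 2 := by
    intro x hx s hs
    rw [Set.indicator_of_mem (linePoint_mem_closedFD hx (hT s hs)), weight_linePoint hx (hT s hs),
      hone s hs x hx, ENat.toENNReal_one, mul_one]
  rw [OddEisenstein.weightedZeros, tsum_subtype OddEisenstein.closedFD (fun τ ↦
    OddEisenstein.weight τ * (OddEisenstein.vanishingOrder (OddEisenstein.GG k) τ : ℝ≥0∞)),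
    tsum_eq_sum (s := insert OnePoint.infty (R ∪ L)), Finset.sum_insert hnot,
    Finset.sum_union hdisj, Finset.sum_image (hinj _), Finset.sum_image (hinj _),
    Finset.sum_congr rfl (hval _ (Or.inl rfl)), Finset.sum_congr rfl (hval _ (Or.inr rfl)),
    Set.indicator_of_mem (show OnePoint.infty ∈ OddEisenstein.closedFD from Or.inl rfl), weight_infty, hinf, ENat.toENNReal_one, mul_one,
    ← Finset.sum_add_distrib, ENNReal.add_halves, Finset.sum_const, nsmul_one, ← hcard]
  · push_cast; ring
  · intro τ hτ
    rw [Finset.mem_insert, Finset.mem_union, not_or, not_or] at hτ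
    by_cases hFD : τ ∈ OddEisenstein.closedFD
    · rw [Set.indicator_of_mem hFD]
      induction τ using OnePoint.rec with
      | infty => exact (hτ.1 rfl).elim
      | coe z =>
        rw [vanishingOrder_coe_eq_zero hk hodd, ENat.toENNReal_zero, mul_zero]
        intro h0
        obtain ⟨hre, him⟩ := hz z hFD h0
        rw [coe_eq_linePoint] at hτ
        rcases hre with h | h
        · exact hτ.2.1 (Finset.mem_image.2 ⟨_, him, by rw [h]⟩)
        · exact hτ.2.2 (Finset.mem_image.2 ⟨_, him, by rw [h]⟩)
    · exact Set.indicator_of_notMem hFD _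

theorem theorem4 (k : ℕ) (hk : 3 ≤ k) (hodd : Odd k) :
    ((k % 12 = 3 ∨ k % 12 = 5 ∨ k % 12 = 11) →
      OddEisenstein.weightedZeros (OddEisenstein.GG k) = ((⌈(k : ℚ) / 6⌉₊ : ℕ) : ENNReal)) ∧
    ((k % 12 = 1 ∨ k % 12 = 7 ∨ k % 12 = 9) →
      OddEisenstein.weightedZeros (OddEisenstein.GG k) = ((⌊(k : ℚ) / 6⌋₊ : ℕ) : ENNReal)) ∧
    ∀ τ ∈ OddEisenstein.closedFD, OddEisenstein.IsZeroOf (OddEisenstein.GG k) τ →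
      τ ∈ OddEisenstein.leftSide ∪ OddEisenstein.rightSide := by
  have hkq : (k : ℚ) = 6 * (k / 6 : ℕ) + (k % 6 : ℕ) := by exact_mod_cast (Nat.div_add_mod k 6).symm
  refine ⟨fun h ↦ ?_, fun h ↦ ?_, fun τ hτ h0 ↦ ?_⟩
  · rw [weightedZeros_GG hk hodd, zeroCount, if_pos h]
    congr 1
    refine ((Nat.ceil_eq_iff (by omega)).2 ⟨?_, ?_⟩).symm
    · have : (1 : ℚ) ≤ (k % 6 : ℕ) := by exact_mod_cast (by omega : 1 ≤ k % 6)
      rw [Nat.add_sub_cancel, lt_div_iff₀ (by norm_num)]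
      linarith
    · have : ((k % 6 : ℕ) : ℚ) ≤ 6 := by exact_mod_cast (by omega : k % 6 ≤ 6)
      rw [div_le_iff₀ (by norm_num)]
      push_cast at *
      linarith
  · rw [weightedZeros_GG hk hodd, zeroCount, if_neg (by omega)]
    congr 1
    exact (Nat.floor_div_ofNat (k : ℚ) 6 |>.trans (by rw [Nat.floor_natCast])).symm
  · obtain ⟨T, -, hT, -, -, hz⟩ := exists_zeros_GG hk hodd
    induction τ using OnePoint.rec with
    | infty => exact Or.inl (Or.inl rfl)
    | coe z =>
      obtain ⟨hre, him⟩ := hz z hτ h0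
      rw [coe_eq_linePoint]
      exact linePoint_mem_sides hre (hT _ him)
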